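/- For real $x,y,\tau$ let $$K_P(x,y;\tau)=\frac1{(2\pi i)^2}\int_{\gamma_L\cup\gamma_R}d\mu\int_{i\mathbb R}d\lambda\,\frac{e^{\Theta_x(\mu)-\Theta_y(\lambda)}}{\lambda-\mu},\qquad \Theta_x(\mu)=\frac{\mu^4}{4}-\frac{\tau}{2}\mu^2-x\mu,$$ be the Pearcey kernel. Here $i\mathbb R$ is oriented upwards, $\gamma_R$ lies in the open right half plane and runs from $\infty e^{i\pi/4}$ to $\infty e^{-i\pi/4}$, and $\gamma_L=-\gamma_R$ lies in the open left half plane and runs from $\infty e^{-3i\pi/4}$ to $\infty e^{3i\pi/4}$; for definiteness $\gamma_R(t)=\sqrt{1+t^2}-it$, $t\in\mathbb R$. For $a<b$ let $$\det\bigl(\mathrm{Id}-K_P|_{[a,b]}\bigr)=\sum_{n\ge0}\frac{(-1)^n}{n!}\int_{[a,b]^n}\det\bigl[K_P(x_i,x_j;\tau)\bigr]_{i,j=1}^n\,dx_1\cdots dx_n$$ be the Fredholm determinant of the operator with kernel $K_P$ on $L^2([a,b])$. Write $\partial_E=\partial_a+\partial_b$ and $\epsilon=a\partial_a+b\partial_b$.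 Then for all real $a<b$ and $\tau$ the determinant is real and strictly positive, the function $g(a,b,\tau)=\log\det(\mathrm{Id}-K_P|_{[a,b]})$ is smooth on $\{a<b\}$, and it satisfies there the three equations $$\partial_E^4g+6(\partial_E^2g)^2-4\tau\,\partial_E^2g+12\,\partial_\tau^2g=0,\tag{1}$$ $$\left(-3\epsilon-2\tau\partial_\tau+2\partial_\tau\partial_E^2+1\right)\partial_Eg+12(\partial_E^2g)(\partial_\tau\partial_Eg)=0,\tag{2}$$ $$\begin{aligned}&\epsilon\left(12\,\partial_\tau g-2\,\partial_E^2g\right)+\tau\left(8\,\partial_\tau^2g+4\,\partial_\tau\partial_E^2g-4\,\partial_E^4g-8(\partial_E^2g)^2\right)+4\,\partial_E^2g+16(\partial_E^2g)^3\\&+8(\partial_E\partial_\tau g)\,\partial_E^3g+10(\partial_E^3g)^2+16(\partial_E^4g)\,\partial_E^2g+\partial_E^6g-16\,\partial_\tau^3g+4\,\partial_\tau^2\partial_E^2g\\&-24(\partial_E\partial_\tau g)^2-8(\partial_\tau\partial_E^2g)\,\partial_E^2g-8\,\partial_\tau g=0.\end{aligned}\tag{3}$$ Moreover, (3) is not a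 consequence of (1) and (2): there is a smooth function of $(a,b,\tau)$ on $\{a<b\}$ that satisfies (1) and (2) at every point but does not satisfy (3) at some point. -/

import Mathlib

open scoped Nat ContDiff

noncomputable section

/-- The integral `∫_γ f(z) dz` along a parametrized curve `γ : ℝ → ℂ` extending to infinity in
both directions. -/
def contourIntegral (γ : ℝ → ℂ) (f : ℂ → ℂ) : ℂ := ∫ t : ℝ, f (γ t) * deriv γ t

/-- The contour `γ_R`: a branch of a hyperbola in the open right half plane, coming from infinity
along the direction `arg = π/4` and going to infinity along `arg = -π/4`. -/
def gammaR (t : ℝ) : ℂ := (Real.sqrt (1 + t ^ 2) : ℂ) - (t : ℂ) * Complex.I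

/-- The contour `γ_L = -γ_R` in the open left half plane, coming from infinity along the
direction `arg = -3π/4` and going to infinity along `arg = 3π/4`. -/
def gammaL (t : ℝ) : ℂ := -gammaR t

/-- The imaginary axis, oriented upwards. -/
def imagAxis (t : ℝ) : ℂ := (t : ℂ) * Complex.I

/-- The phase `Θ_x(μ) = μ⁴/4 - (τ/2) μ² - x μ`. -/
def pearceyPhase (τ x : ℝ) (μ : ℂ) : ℂ := μ ^ 4 / 4 - (τ : ℂ) / 2 * μ ^ 2 - (x : ℂ) * μ

/-- The integrand, integrated over `i ℝ` in `l`, as a function of `μ`. -/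
def pearceyInner (τ x y : ℝ) (μ : ℂ) : ℂ :=
  contourIntegral imagAxis fun l =>
    Complex.exp (pearceyPhase τ x μ - pearceyPhase τ y l) / (l - μ)

/-- The Pearcey kernel `K_P(x, y; τ)`. -/
def pearceyKernel (τ x y : ℝ) : ℂ :=
  1 / (2 * (Real.pi : ℂ) * Complex.I) ^ 2 *
    (contourIntegral gammaL (pearceyInner τ x y) + contourIntegral gammaR (pearceyInner τ x y))

/-- The Fredholm determinant `det(Id - K|_[a,b])` of the integral operator with (continuous)
kernel `K` on `L²([a,b])`, through the Fredholm series. -/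
def fredholmDet (K : ℝ → ℝ → ℂ) (a b : ℝ) : ℂ :=
  ∑' n : ℕ, (-1 : ℂ) ^ n / (n ! : ℂ) *
    ∫ x in Set.pi Set.univ (fun _ : Fin n => Set.Icc a b),
      (Matrix.of fun i j : Fin n => K (x i) (x j)).det

/-- `det(Id - K_P|_[a,b])`. -/
def pearceyDet (a b τ : ℝ) : ℂ := fredholmDet (pearceyKernel τ) a b

/-- `g(a,b,τ) = log det(Id - K_P|_[a,b])`; the determinant is a positive real number, which is
part of the theorem. -/
def pearceyLogDet (a b τ : ℝ) : ℝ := Real.log (pearceyDet a b τ).re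

/-- The operator `∂_E = ∂_a + ∂_b` on functions of `(a, b, τ)`. -/
def dE (u : ℝ → ℝ → ℝ → ℝ) (a b τ : ℝ) : ℝ :=
  deriv (fun s => u s b τ) a + deriv (fun s => u a s τ) b

/-- The operator `∂_τ` on functions of `(a, b, τ)`. -/
def dTau (u : ℝ → ℝ → ℝ → ℝ) (a b τ : ℝ) : ℝ := deriv (fun s => u a b s) τ

/-- The operator `ε = a ∂_a + b ∂_b` on functions of `(a, b, τ)`. -/
def eulerOp (u : ℝ → ℝ → ℝ → ℝ) (a b τ : ℝ) : ℝ :=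
  a * deriv (fun s => u s b τ) a + b * deriv (fun s => u a s τ) b

/-- `u` is a smooth function of `(a, b, τ)` on the open set `a < b`. -/
def SmoothOnIntervals (u : ℝ → ℝ → ℝ → ℝ) : Prop :=
  ContDiffOn ℝ ∞ (fun p : ℝ × ℝ × ℝ => u p.1 p.2.1 p.2.2) {p | p.1 < p.2.1}

/-- The first equation, for `u` at the point `(a, b, τ)`. -/
def PearceyPDE1 (u : ℝ → ℝ → ℝ → ℝ) (a b τ : ℝ) : Prop :=
  dE^[4] u a b τ + 6 * (dE^[2] u a b τ) ^ 2 - 4 * τ * dE^[2] u a b τ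
    + 12 * dTau^[2] u a b τ = 0

/-- The second equation, for `u` at the point `(a, b, τ)`. -/
def PearceyPDE2 (u : ℝ → ℝ → ℝ → ℝ) (a b τ : ℝ) : Prop :=
  (-3 * eulerOp (dE u) a b τ - 2 * τ * dTau (dE u) a b τ + 2 * dTau (dE^[2] (dE u)) a b τ
      + dE u a b τ)
    + 12 * dE^[2] u a b τ * dTau (dE u) a b τ = 0

/-- The third equation, for `u` at the point `(a, b, τ)`. -/
def PearceyPDE3 (u : ℝ → ℝ → ℝ → ℝ) (a b τ : ℝ) : Prop :=
  eulerOp (fun a b τ => 12 * dTau u a b τ - 2 * dE^[2] u a b τ) a b τ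
    + (8 * dTau^[2] u a b τ + 4 * dTau (dE^[2] u) a b τ - 4 * dE^[4] u a b τ
        - 8 * (dE^[2] u a b τ) ^ 2) * τ
    + 4 * dE^[2] u a b τ + 16 * (dE^[2] u a b τ) ^ 3
    + 8 * dE (dTau u) a b τ * dE^[3] u a b τ + 10 * (dE^[3] u a b τ) ^ 2
    + 16 * dE^[4] u a b τ * dE^[2] u a b τ
    + dE^[6] u a b τ - 16 * dTau^[3] u a b τ + 4 * dTau^[2] (dE^[2] u) a b τ
    - 24 * (dE (dTau u) a b τ) ^ 2
    - 8 * dTau (dE^[2] u) a b τ * dE^[2] u a b τ - 8 * dTau u a b τ = 0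

end

/-! The equations hold exactly for finite determinants, and they are then carried to the limit. Let
p_i and b_j be the single integrals of (-μ)^i e^{Θ_x(μ)} and λ^j e^{-Θ_y(λ)} (`pTot`, `bInt`). The
factor 1/(λ-μ) of the kernel K is cancelled by what ∂_x + ∂_y or 2∂_τ brings down from the exponent
and, after an integration by parts, by multiplication with x - y. Each of these operations, and
hence also 1 + x∂_x + y∂_y, turns K into a short sum of products p_i(x) b_j(y), with coefficients 1
or τ up to sign.

Sample K at the points a + k(b-a)/n with weight (b-a)/n. This grid is translated by E = ∂_E, dilated
by ε and fixed by T = 2∂_τ, so the resulting matrix M inherits these finite-rank relations without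
any discretization error. With ρ = (1-M)⁻¹ and u_ij = b_j·ρp_i, the derivatives of the u_ij form a
closed Riccati system, and those of g = log det(1-M) are polynomials in the u_ij and τ. If X is the
diagonal matrix of grid points, then tr ρ[X,M] = 0 gives a linear relation between the u_ij whose
derivatives are (1) and (2). Equation (3) also needs the entry b_2·[X,ρ]p_0, evaluated through the
third order differential equations of p_0 and b_0. This is `pearcey_equations_of_riccati`,
`pearcey_equations_of_matrix` and `pearcey_equations_of_grid`.

Hadamard's inequality bounds the finite determinants locally uniformly in complex (a,b,τ), so they
converge locally uniformly, with all derivatives, to an entire function `pearceyDetC`. Where its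
real part is positive, logarithms and equations pass to the limit (`pearceyLogDet_pdes`).

For positivity, the weight e^{-z⁴/4+τz²/2} is approximated by an even polynomial with simple real
zeros times a Gaussian. Residues turn the corresponding kernel into that of a biorthogonal ensemble
of exponentials against polynomials times a Gaussian (`sum_modelU_mul_modelV_eq`). Both families are
Chebyshev systems, so the ensemble has a density of constant sign, and its gap probability is
nonnegative and nonincreasing in b. The limit inherits this. A zero at one b would persist for all
larger b, and by analyticity the determinant would vanish identically in b, although it equals 1 at
b = a (`pearceyDet_pos`). -/

/-! ### Differential algebra: from the Riccati system to the three equations. -/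

theorem pearcey_equations_of_riccati {R : Type*} [CommRing R] [Algebra ℂ R]
    (E T ε : Derivation ℂ R R) (u : ℕ → ℕ → R) (g τ : R)
    (hEu : ∀ i j, E (u i j) = u (i + 1) j + u i (j + 1) + u i 0 * u 0 j)
    (hTu : ∀ i j, T (u i j) = -u (i + 2) j + u i (j + 2) + u i 1 * u 0 j - u i 0 * u 1 j)
    (hEτ : E τ = 0) (hTτ : T τ = 2)
    (hEg : E g = -u 0 0) (hTg : T g = u 1 0 - u 0 1)
    (hεg : ε g = u 3 0 - u 2 1 + u 1 2 - u 0 3 - τ * T g)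
    (hEε : E (ε g) = ε (E g) + E g)
    (hEEε : E (ε (E g)) = ε (E (E g)) + E (E g)) (hTε : T (ε g) = ε (T g))
    (c0 : τ * u 0 0 = u 2 0 - u 1 1 + u 0 2)
    (C02 : u 0 5 + u 3 2 - τ * (u 0 3 + u 1 2 + u 0 2 * u 0 0) + u 2 2 * u 0 0 - u 1 2 * u 0 1
      + u 0 2 * u 0 2 - 2 * u 0 1 = 0) :
    (E (E (E (E g))) + 6 * (E (E g)) ^ 2 - 4 * τ * E (E g) + 3 * T (T g) = 0) ∧
    (-3 * ε (E g) - τ * T (E g) + T (E (E (E g))) + E g + 6 * E (E g) * T (E g) = 0) ∧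
    (6 * ε (T g) - 2 * ε (E (E g))
      + (2 * T (T g) + 2 * T (E (E g)) - 4 * E (E (E (E g))) - 8 * (E (E g)) ^ 2) * τ
      + 4 * E (E g) + 16 * (E (E g)) ^ 3 + 4 * E (T g) * E (E (E g)) + 10 * (E (E (E g))) ^ 2
      + 16 * E (E (E (E g))) * E (E g) + E (E (E (E (E (E g))))) - 2 * T (T (T g))
      + T (T (E (E g))) - 6 * (E (T g)) ^ 2 - 4 * T (E (E g)) * E (E g) - 4 * T g = 0) := by
  -- The first equation is a multiple of E `c0` and the second a multiple of T `c0`. The third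
  -- combines both with E² `c0`, E T `c0` and `C02`.
  have c1 := congrArg E c0
  have ct := congrArg T c0
  have c2 := congrArg E c1
  have ct1 := congrArg E ct
  -- The commutation rules bring ε next to g, so that ε is only ever applied to g itself, where its
  -- value is known.
  have e1 : ε (E g) = E (ε g) - E g := by rw [hEε]; ring
  have e2 : ε (E (E g)) = E (E (ε g)) - 2 * E (E g) := by
    rw [hEε, map_add, hEEε]; ring
  have hE2 : E 2 = 0 := by simpa using E.map_natCast 2
  rw [e2, ← hTε, e1]
  simp only [Derivation.leibniz, smul_eq_mul, hEu, hTu, hEτ, hTτ, hE2, hεg, hEg, hTg, map_add,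
    map_sub, map_neg, Nat.reduceAdd, zero_add, map_zero] at c1 ct c2 ct1 ⊢
  refine ⟨?_, ?_, ?_⟩
  · linear_combination 4 * c1
  · linear_combination (-2) * ct
  · linear_combination 16 * u 0 1 * c1 + 8 * u 0 0 * ct + 8 * u 0 0 * c2 - 12 * ct1 - 16 * C02

/-! ### Derivations acting on determinants and resolvents of matrices. -/

section MatrixDerivation

open Matrix

variable {R : Type*} [CommRing R] {n : ℕ}

theorem trace_mul_vecMulVec (A : Matrix (Fin n) (Fin n) R) (p b : Fin n → R) :
    (A * vecMulVec p b).trace = b ⬝ᵥ A *ᵥ p := by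
  rw [mul_vecMulVec, trace_vecMulVec, dotProduct_comm]

/-- This factorization is the source of the quadratic terms of the Riccati system. -/
theorem dotProduct_vecMulVec_mulVec (A B : Matrix (Fin n) (Fin n) R) (b p b' p' : Fin n → R) :
    b ⬝ᵥ (A * vecMulVec p' b' * B) *ᵥ p = (b ⬝ᵥ A *ᵥ p') * (b' ⬝ᵥ B *ᵥ p) := by
  rw [mul_vecMulVec, vecMulVec_mul, vecMulVec_mulVec, dotProduct_smul, ← dotProduct_mulVec]
  simp

variable [Algebra ℂ R]

theorem Derivation.map_finset_prod {ι : Type*} [DecidableEq ι] (δ : Derivation ℂ R R)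
    (s : Finset ι) (f : ι → R) : δ (∏ i ∈ s, f i) = ∑ i ∈ s, (∏ j ∈ s.erase i, f j) * δ (f i) := by
  induction s using Finset.induction_on with
  | empty => simp
  | insert a s ha ih =>
    rw [Finset.prod_insert ha, Derivation.leibniz, ih, Finset.sum_insert ha,
      Finset.erase_insert ha, smul_eq_mul, smul_eq_mul, Finset.mul_sum, add_comm]
    congr 1
    refine Finset.sum_congr rfl fun i hi => ?_
    have : i ≠ a := fun h => ha (h ▸ hi)
    rw [Finset.erase_insert_of_ne this.symm, Finset.prod_insert (by simp [ha]), mul_assoc]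

/-- Jacobi's formula for derivations. -/
theorem Derivation.map_det (δ : Derivation ℂ R R) (A : Matrix (Fin n) (Fin n) R) :
    δ A.det = (A.adjugate * A.map δ).trace := by
  have key : ∀ i, (A.adjugate * A.map δ) i i = (A.updateCol i (fun k => δ (A k i))).det := by
    intro i
    rw [← Matrix.cramer_apply, cramer_eq_adjugate_mulVec]
    rfl
  simp only [trace, diag_apply, key, det_apply, map_sum]
  rw [Finset.sum_comm]
  refine Finset.sum_congr rfl fun σ _ => ?_
  rw [Units.smul_def, map_zsmul, Derivation.map_finset_prod, Finset.smul_sum]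
  refine Finset.sum_congr rfl fun i _ => ?_
  rw [Units.smul_def, ← Finset.prod_erase_mul _ _ (Finset.mem_univ i), updateCol_self]
  congr 2
  refine Finset.prod_congr rfl fun j hj => ?_
  rw [updateCol_ne (Finset.ne_of_mem_erase hj)]

theorem Derivation.matrix_map_mul (δ : Derivation ℂ R R) (A B : Matrix (Fin n) (Fin n) R) :
    (A * B).map δ = A.map δ * B + A * B.map δ := by
  ext i j
  simp only [map_apply, mul_apply, map_sum, Derivation.leibniz, smul_eq_mul, Matrix.add_apply,
    ← Finset.sum_add_distrib]
  exact Finset.sum_congr rfl fun k _ => by ring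

theorem Derivation.map_dotProduct_mulVec (δ : Derivation ℂ R R) (b p : Fin n → R)
    (A : Matrix (Fin n) (Fin n) R) :
    δ (b ⬝ᵥ A *ᵥ p) = (fun k => δ (b k)) ⬝ᵥ A *ᵥ p + b ⬝ᵥ A.map δ *ᵥ p
      + b ⬝ᵥ A *ᵥ fun k => δ (p k) := by
  simp only [dotProduct, mulVec, map_sum, Derivation.leibniz, smul_eq_mul, map_apply,
    ← Finset.sum_add_distrib]
  refine Finset.sum_congr rfl fun k _ => ?_
  simp only [Finset.sum_add_distrib, mul_add]
  rw [add_comm, add_assoc, add_comm (b k * ∑ x, δ (A k x) * p x)]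
  congr 1
  · ring
  · congr 2
    exact Finset.sum_congr rfl fun j _ => by ring

/-- Differentiate ρ(1 - M) = 1 and multiply by ρ from the right. -/
theorem Derivation.map_resolvent (δ : Derivation ℂ R R) {M ρ : Matrix (Fin n) (Fin n) R}
    (h : ρ * (1 - M) = 1) : ρ.map δ = ρ * M.map δ * ρ := by
  have h' : (1 - M) * ρ = 1 := mul_eq_one_comm.mp h
  have h1 : (1 : Matrix (Fin n) (Fin n) R).map δ = 0 := by
    ext i j
    by_cases hij : i = j <;> simp [hij, one_apply]
  have h2 := Derivation.matrix_map_mul δ ρ (1 - M)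
  have h4 : (1 - M).map δ = (1 : Matrix (Fin n) (Fin n) R).map δ - M.map δ := by
    ext i j; simp
  rw [h, h4, h1, zero_sub, mul_neg, ← sub_eq_add_neg] at h2
  have h3 := (sub_eq_zero.mp h2.symm)
  calc ρ.map δ = ρ.map δ * ((1 - M) * ρ) := by rw [h', mul_one]
    _ = _ := by rw [← mul_assoc, h3]

/-- The finite problem in abstract form, with x the vector of grid points. The hypothesis `hg` says
that g is a logarithm of the determinant, without requiring exponentials in R. -/
theorem pearcey_equations_of_matrix (E T ε : Derivation ℂ R R)
    {M ρ : Matrix (Fin n) (Fin n) R} (hρ : ρ * (1 - M) = 1) (p b : ℕ → Fin n → R)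
    (x : Fin n → R) (g τ : R)
    (hEp : ∀ i k, E (p i k) = p (i + 1) k) (hEb : ∀ i k, E (b i k) = b (i + 1) k)
    (hTp : ∀ i k, T (p i k) = -p (i + 2) k) (hTb : ∀ i k, T (b i k) = b (i + 2) k)
    (hEM : M.map E = vecMulVec (p 0) (b 0))
    (hTM : M.map T = vecMulVec (p 0) (b 1) - vecMulVec (p 1) (b 0))
    (hεM : M.map ε = -vecMulVec (p 3) (b 0) + vecMulVec (p 2) (b 1) - vecMulVec (p 1) (b 2)
      + vecMulVec (p 0) (b 3) - τ • M.map T)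
    (hxM : diagonal x * M - M * diagonal x = τ • vecMulVec (p 0) (b 0) - vecMulVec (p 2) (b 0)
      + vecMulVec (p 1) (b 1) - vecMulVec (p 0) (b 2))
    (hp3 : ∀ k, x k * p 0 k = τ * p 1 k - p 3 k)
    (hb5 : ∀ k, x k * b 2 k = b 5 k - τ * b 3 k - 2 * b 1 k)
    (hEτ : E τ = 0) (hTτ : T τ = 2)
    (hg : ∀ δ ∈ ({E, T, ε} : Set (Derivation ℂ R R)), (1 - M).det * δ g = δ (1 - M).det)
    (hEε : E (ε g) = ε (E g) + E g)
    (hEEε : E (ε (E g)) = ε (E (E g)) + E (E g)) (hTε : T (ε g) = ε (T g)) :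
    (E (E (E (E g))) + 6 * (E (E g)) ^ 2 - 4 * τ * E (E g) + 3 * T (T g) = 0) ∧
    (-3 * ε (E g) - τ * T (E g) + T (E (E (E g))) + E g + 6 * E (E g) * T (E g) = 0) ∧
    (6 * ε (T g) - 2 * ε (E (E g))
      + (2 * T (T g) + 2 * T (E (E g)) - 4 * E (E (E (E g))) - 8 * (E (E g)) ^ 2) * τ
      + 4 * E (E g) + 16 * (E (E g)) ^ 3 + 4 * E (T g) * E (E (E g)) + 10 * (E (E (E g))) ^ 2
      + 16 * E (E (E (E g))) * E (E g) + E (E (E (E (E (E g))))) - 2 * T (T (T g))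
      + T (T (E (E g))) - 6 * (E (T g)) ^ 2 - 4 * T (E (E g)) * E (E g) - 4 * T g = 0) := by
  have hρ' : (1 - M) * ρ = 1 := mul_eq_one_comm.mp hρ
  -- Here `ρ.det` plays the role of the inverse of the determinant of 1 - M. With Jacobi's formula
  -- this yields δg = -tr(ρ δM).
  have hadj : ρ.det • (1 - M).adjugate = ρ := by
    calc ρ.det • (1 - M).adjugate = ρ.det • ((1 - M).adjugate * ((1 - M) * ρ)) := by
          rw [hρ', mul_one]
      _ = (ρ.det * (1 - M).det) • ρ := by
          rw [← mul_assoc, adjugate_mul, smul_mul_assoc, one_mul, smul_smul]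
      _ = ρ := by rw [← det_mul, hρ, det_one, one_smul]
  have hlog : ∀ δ ∈ ({E, T, ε} : Set (Derivation ℂ R R)), δ g = -(ρ * M.map δ).trace := by
    intro δ hδ
    have h4 : (1 - M).map δ = -M.map δ := by
      ext i j
      by_cases hij : i = j <;> simp [hij, one_apply]
    calc δ g = (ρ.det * (1 - M).det) * δ g := by rw [← det_mul, hρ, det_one, one_mul]
      _ = ρ.det * δ (1 - M).det := by rw [mul_assoc, hg δ hδ]
      _ = ((ρ.det • (1 - M).adjugate) * (1 - M).map δ).trace := by
          rw [Derivation.map_det, smul_mul_assoc, trace_smul, smul_eq_mul]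
      _ = _ := by rw [hadj, h4, mul_neg, trace_neg]
  have hE := hlog E (by simp)
  have hT := hlog T (by simp)
  have hε := hlog ε (by simp)
  refine pearcey_equations_of_riccati E T ε (fun i j => b j ⬝ᵥ ρ *ᵥ p i) g τ ?_ ?_ hEτ hTτ
    ?_ ?_ ?_ hEε hEEε hTε ?_ ?_
  · intro i j
    rw [Derivation.map_dotProduct_mulVec, Derivation.map_resolvent E hρ, hEM,
      dotProduct_vecMulVec_mulVec]
    simp only [hEp, hEb]
    ring
  · intro i j
    rw [Derivation.map_dotProduct_mulVec, Derivation.map_resolvent T hρ, hTM, mul_sub, sub_mul,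
      sub_mulVec, dotProduct_sub, dotProduct_vecMulVec_mulVec, dotProduct_vecMulVec_mulVec]
    simp only [hTp, hTb]
    rw [show (fun k => -p (i + 2) k) = -p (i + 2) from rfl, mulVec_neg, dotProduct_neg]
    ring
  · rw [hE, hEM, trace_mul_vecMulVec]
  · rw [hT, hTM, mul_sub, trace_sub, trace_mul_vecMulVec, trace_mul_vecMulVec]
    ring
  · rw [hε, hT, hεM, mul_sub, mul_add, mul_sub, mul_add, mul_neg, mul_smul_comm]
    simp only [trace_sub, trace_add, trace_neg, trace_smul, trace_mul_vecMulVec, smul_eq_mul]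
    ring
  -- Since ρ commutes with M, the trace of ρ against a commutator with M vanishes; expanding the
  -- commutator in rank-one terms gives `c0`.
  · have h1 : (ρ * (diagonal x * M - M * diagonal x)).trace = 0 := by
      have h2 : ρ * M = M * ρ := by
        have : ρ * (1 - M) = (1 - M) * ρ := hρ.trans hρ'.symm
        simpa [mul_sub, sub_mul] using this
      rw [mul_sub, trace_sub, ← mul_assoc ρ M, h2, mul_assoc M, trace_mul_comm M, mul_assoc,
        sub_self]
    rw [hxM] at h1
    simp only [mul_sub, mul_add, mul_smul_comm, trace_sub, trace_add, trace_smul,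
      trace_mul_vecMulVec, smul_eq_mul] at h1
    linear_combination h1
  -- Between b_2 and p_0 the left side becomes a sum of products of u's. On the right X acts on b_2
  -- or on p_0, where the differential equations `hb5` and `hp3` eliminate it.
  · have h1 : ρ * (diagonal x * M - M * diagonal x) * ρ = diagonal x * ρ - ρ * diagonal x := by
      have e1 : M * ρ = ρ - 1 := by rw [← hρ']; noncomm_ring
      have e2 : ρ * M = ρ - 1 := by rw [← hρ]; noncomm_ring
      calc _ = ρ * diagonal x * (M * ρ) - (ρ * M) * diagonal x * ρ := by noncomm_ring
        _ = _ := by rw [e1, e2]; noncomm_ring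
    rw [hxM] at h1
    have h2 := congrArg (fun A => b 2 ⬝ᵥ A *ᵥ p 0) h1
    simp only [mul_sub, mul_add, sub_mul, add_mul, mul_smul_comm, smul_mul_assoc, sub_mulVec,
      add_mulVec, smul_mulVec, dotProduct_sub, dotProduct_add, dotProduct_smul,
      dotProduct_vecMulVec_mulVec, smul_eq_mul] at h2
    have h3 : b 2 ⬝ᵥ (diagonal x * ρ) *ᵥ p 0
        = b 5 ⬝ᵥ ρ *ᵥ p 0 - τ * (b 3 ⬝ᵥ ρ *ᵥ p 0) - 2 * (b 1 ⬝ᵥ ρ *ᵥ p 0) := by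
      have : b 2 ᵥ* diagonal x = b 5 - τ • b 3 - (2 : R) • b 1 := by
        ext k
        rw [vecMul_diagonal]
        simp only [Pi.sub_apply, Pi.smul_apply, smul_eq_mul]
        linear_combination hb5 k
      rw [← mulVec_mulVec, dotProduct_mulVec, this]
      simp [sub_dotProduct, smul_dotProduct]
    have h4 : b 2 ⬝ᵥ (ρ * diagonal x) *ᵥ p 0
        = τ * (b 2 ⬝ᵥ ρ *ᵥ p 1) - b 2 ⬝ᵥ ρ *ᵥ p 3 := by
      have : diagonal x *ᵥ p 0 = τ • p 1 - p 3 := by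
        ext k
        rw [mulVec_diagonal]
        simp only [Pi.sub_apply, Pi.smul_apply, smul_eq_mul, hp3 k]
      rw [← mulVec_mulVec, this]
      simp [mulVec_sub, mulVec_smul]
    rw [h3, h4] at h2
    linear_combination -h2

end MatrixDerivation

noncomputable section

/-! ### Locally uniform limits of holomorphic maps in several variables. -/

section LocallyUniformLimits

open Filter Topology Metric

variable {E G : Type} [NormedAddCommGroup E] [NormedSpace ℂ E]
  [NormedAddCommGroup G] [NormedSpace ℂ G]

theorem norm_fderiv_le_of_forall_ball_le {f : E → G} {x : E} {r M : ℝ} (hr : 0 < r)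
    (hf : DifferentiableOn ℂ f (ball x r)) (hM : ∀ y ∈ ball x r, ‖f y‖ ≤ M) :
    ‖fderiv ℂ f x‖ ≤ 2 * M / r := by
  refine Complex.norm_fderiv_le_div_of_mapsTo_ball hf (fun y hy => ?_) hr
  rw [mem_closedBall, dist_eq_norm]
  calc ‖f y - f x‖ ≤ ‖f y‖ + ‖f x‖ := norm_sub_le _ _
    _ ≤ 2 * M := by linarith [hM y hy, hM x (mem_ball_self hr)]

variable [ProperSpace E] [CompleteSpace G]

/-- Cauchy's estimate makes the derivatives locally uniformly Cauchy. That their limit is the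
derivative of f can only be said afterwards, since that step presupposes the uniform convergence
proved here. -/
theorem TendstoLocallyUniformlyOn.exists_fderiv {F : ℕ → E → G} {f : E → G} {V : Set E}
    (hV : IsOpen V) (hF : ∀ n, DifferentiableOn ℂ (F n) V)
    (h : TendstoLocallyUniformlyOn F f atTop V) :
    ∃ f', TendstoLocallyUniformlyOn (fun n => fderiv ℂ (F n)) f' atTop V := by
  have key : ∀ x ∈ V, ∃ r > 0, ball x r ⊆ V ∧
      UniformCauchySeqOn (fun n => fderiv ℂ (F n)) atTop (ball x r) := by
    intro x hx
    obtain ⟨R, hR, hRV⟩ := Metric.nhds_basis_closedBall.mem_iff.mp (hV.mem_nhds hx)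
    have hu := (tendstoLocallyUniformlyOn_iff_forall_isCompact hV).mp h _ hRV
      (isCompact_closedBall x R)
    refine ⟨R / 2, by positivity, (ball_subset_closedBall.trans
      (closedBall_subset_closedBall (by linarith))).trans hRV, ?_⟩
    rw [Metric.uniformCauchySeqOn_iff]
    intro ε hε
    -- Balls of radius R/2 turn this tolerance into 2(εR/8)/(R/2) = ε/2 for the derivatives.
    obtain ⟨N, hN⟩ := Metric.uniformCauchySeqOn_iff.mp hu.uniformCauchySeqOn (ε * R / 8)
      (by positivity)
    refine ⟨N, fun m hm n hn y hy => ?_⟩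
    have hsub : ball y (R / 2) ⊆ closedBall x R := fun z hz => by
      rw [mem_closedBall]
      rw [mem_ball] at hz hy
      linarith [dist_triangle z y x]
    have hd : ∀ k, DifferentiableAt ℂ (F k) y := fun k =>
      (hF k).differentiableAt (hV.mem_nhds (hRV (hsub (mem_ball_self (by positivity)))))
    rw [dist_eq_norm, ← fderiv_fun_sub (hd m) (hd n)]
    refine lt_of_le_of_lt (norm_fderiv_le_of_forall_ball_le (r := R / 2) (M := ε * R / 8)
      (by positivity) (((hF m).sub (hF n)).mono (hsub.trans hRV)) fun z hz => ?_) ?_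
    · rw [← dist_eq_norm]
      exact (hN m hm n hn z (hsub hz)).le
    · field_simp
      linarith
  have hlim : ∀ x, ∃ g, x ∈ V → Tendsto (fun n => fderiv ℂ (F n) x) atTop (𝓝 g) := by
    intro x
    by_cases hx : x ∈ V
    · obtain ⟨r, hr, -, hc⟩ := key x hx
      obtain ⟨g, hg⟩ := cauchySeq_tendsto_of_complete (hc.cauchySeq (mem_ball_self hr))
      exact ⟨g, fun _ => hg⟩
    · exact ⟨0, fun h => absurd h hx⟩
  choose f' hf' using hlim
  refine ⟨f', fun u hu x hx => ?_⟩
  obtain ⟨r, hr, hrV, hc⟩ := key x hx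
  exact ⟨ball x r, mem_nhdsWithin_of_mem_nhds (ball_mem_nhds x hr),
    hc.tendstoUniformlyOn_of_tendsto (fun y hy => hf' y (hrV hy)) u hu⟩

theorem TendstoLocallyUniformlyOn.fderiv_of_differentiableOn {F : ℕ → E → G} {f : E → G} {V : Set E}
    (hV : IsOpen V) (hF : ∀ n, DifferentiableOn ℂ (F n) V)
    (h : TendstoLocallyUniformlyOn F f atTop V) :
    DifferentiableOn ℂ f V ∧
      TendstoLocallyUniformlyOn (fun n => fderiv ℂ (F n)) (fderiv ℂ f) atTop V := by
  obtain ⟨f', hf'⟩ := h.exists_fderiv hV hF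
  have hd : ∀ x ∈ V, HasFDerivAt f (f' x) x := fun x hx =>
    hasFDerivAt_of_tendstoLocallyUniformlyOn hV hf'
      (fun n y hy => ((hF n).differentiableAt (hV.mem_nhds hy)).hasFDerivAt)
      (fun y hy => h.tendsto_at hy) hx
  exact ⟨fun x hx => (hd x hx).differentiableAt.differentiableWithinAt,
    hf'.congr_right fun x hx => (hd x hx).fderiv.symm⟩

end LocallyUniformLimits

section

open Filter Topology Metric

variable {E : Type} [NormedAddCommGroup E] [NormedSpace ℂ E] [ProperSpace E]

/-- The target G varies in the induction because the step applies the hypothesis to the derivatives,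
whose values are continuous linear maps. -/
theorem TendstoLocallyUniformlyOn.contDiffOn_nat (k : ℕ) {V : Set E} (hV : IsOpen V) :
    ∀ {G : Type} [NormedAddCommGroup G] [NormedSpace ℂ G] [CompleteSpace G]
      {F : ℕ → E → G} {f : E → G}, (∀ n, ContDiffOn ℂ ∞ (F n) V) →
      TendstoLocallyUniformlyOn F f atTop V → ContDiffOn ℂ k f V := by
  induction k with
  | zero =>
    intro G _ _ _ F f hF h
    have := (h.fderiv_of_differentiableOn hV fun n => (hF n).differentiableOn (by simp)).1
    exact contDiffOn_zero.mpr this.continuousOn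
  | succ k ih =>
    intro G _ _ _ F f hF h
    have h1 := h.fderiv_of_differentiableOn hV fun n => (hF n).differentiableOn (by simp)
    rw [Nat.cast_succ, contDiffOn_succ_iff_fderiv_of_isOpen hV]
    exact ⟨h1.1, by simp, ih (fun n => (hF n).fderiv_of_isOpen hV (by simp)) h1.2⟩

theorem TendstoLocallyUniformlyOn.contDiffOn_top {G : Type} [NormedAddCommGroup G]
    [NormedSpace ℂ G] [CompleteSpace G] {V : Set E} (hV : IsOpen V)
    {F : ℕ → E → G} {f : E → G} (hF : ∀ n, ContDiffOn ℂ ∞ (F n) V)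
    (h : TendstoLocallyUniformlyOn F f atTop V) : ContDiffOn ℂ ∞ f V :=
  contDiffOn_infty.mpr fun k => h.contDiffOn_nat k hV hF

/-- A pointwise convergent, locally uniformly bounded sequence of entire functions converges
locally uniformly. -/
theorem tendstoLocallyUniformly_of_locally_bounded {G : Type} [NormedAddCommGroup G]
    [NormedSpace ℂ G] {F : ℕ → E → G} {f : E → G} (hF : ∀ n, Differentiable ℂ (F n))
    (hb : ∀ x, ∃ r > 0, ∃ M, ∀ n, ∀ y ∈ ball x r, ‖F n y‖ ≤ M)
    (h : ∀ x, Tendsto (fun n => F n x) atTop (𝓝 (f x))) :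
    TendstoLocallyUniformlyOn F f atTop Set.univ := by
  -- A Schwarz-type estimate turns local boundedness into equicontinuity, and pointwise convergence
  -- of an equicontinuous sequence is uniform on compact sets.
  have heq : Equicontinuous F := by
    intro x
    obtain ⟨r, hr, M, hM⟩ := hb x
    refine Metric.equicontinuousAt_of_continuity_modulus (fun y => 2 * M / r * dist y x) ?_ F ?_
    · have : Continuous fun y => 2 * M / r * dist y x := by fun_prop
      simpa using this.tendsto x
    · filter_upwards [ball_mem_nhds x hr] with y hy n
      rw [dist_comm]
      refine Complex.dist_le_div_mul_dist_of_mapsTo_ball (hF n).differentiableOn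
        (fun z hz => ?_) hy
      rw [mem_closedBall, dist_eq_norm]
      calc ‖F n z - F n x‖ ≤ ‖F n z‖ + ‖F n x‖ := norm_sub_le _ _
        _ ≤ 2 * M := by linarith [hM n z hz, hM n x (mem_ball_self hr)]
  rw [tendstoLocallyUniformlyOn_iff_forall_isCompact isOpen_univ]
  intro K _ hK
  have := (EquicontinuousOn.tendsto_uniformOnFun_iff_pi (𝔖 := {K : Set E | IsCompact K})
    (fun K hK => hK) (by
      rw [Set.sUnion_eq_univ_iff]
      exact fun x => ⟨{x}, isCompact_singleton, rfl⟩)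
    (fun K _ => heq.equicontinuousOn K) atTop f).mpr (tendsto_pi_nhds.mpr h)
  exact UniformOnFun.tendsto_iff_tendstoUniformlyOn.mp this K hK

end

/-! ### Smooth functions on an open set as an algebra with derivations. -/

section SmoothAlgebra

open Filter Topology Metric TopologicalSpace

variable {E : Type} [NormedAddCommGroup E]

/-- The extension by zero of a function on `V`. -/
def zeroExt (V : Opens E) (f : V → ℂ) : E → ℂ := Function.extend Subtype.val f 0

variable {V : Opens E}

@[simp]
theorem zeroExt_coe (f : V → ℂ) (x : V) : zeroExt V f x = f x :=
  Subtype.val_injective.extend_apply f 0 x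

theorem eqOn_zeroExt_restrict (f : E → ℂ) : Set.EqOn (zeroExt V fun x => f x) f V :=
  fun x hx => zeroExt_coe (fun x : V => f x) ⟨x, hx⟩

theorem eventuallyEq_of_eqOn_opens {G : Type} {f g : E → G} (h : Set.EqOn f g V) (x : V) :
    f =ᶠ[𝓝 x.1] g := h.eventuallyEq_of_mem (V.isOpen.mem_nhds x.2)

variable [NormedSpace ℂ E]

variable (V) in
/-- The algebra of smooth functions on `V`. -/
def smoothAlg : Subalgebra ℂ (V → ℂ) where
  -- Functions on the subtype make equality in the algebra mean equality on V. The extension by zero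
  -- only provides something to differentiate.
  carrier := {f | ContDiffOn ℂ ∞ (zeroExt V f) V}
  mul_mem' {f g} hf hg := (ContDiffOn.mul hf hg).congr fun x hx => by
    lift x to V using hx
    simp
  add_mem' {f g} hf hg := (ContDiffOn.add hf hg).congr fun x hx => by
    lift x to V using hx
    simp
  algebraMap_mem' c := (contDiffOn_const (c := c)).congr fun x hx => by
    lift x to V using hx
    simp

/-- The restriction of a function to an element of `smoothAlg V`. -/
def smoothAlg.mk (f : E → ℂ) (hf : ContDiffOn ℂ ∞ f V) : smoothAlg V :=
  ⟨fun x => f x, hf.congr (eqOn_zeroExt_restrict f)⟩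

@[simp]
theorem smoothAlg.mk_apply (f : E → ℂ) (hf : ContDiffOn ℂ ∞ f V) (x : V) :
    (smoothAlg.mk f hf).1 x = f x := rfl

theorem smoothAlg_differentiableAt (f : smoothAlg V) (x : V) :
    DifferentiableAt ℂ (zeroExt V f.1) x :=
  (ContDiffOn.differentiableOn f.2 (by simp)).differentiableAt (V.isOpen.mem_nhds x.2)

variable (V) in
/-- The directional derivative, as a derivation of the algebra of smooth functions on `V`. -/
def dirDer (v : E) : Derivation ℂ (smoothAlg V) (smoothAlg V) :=
  Derivation.mk'
    { toFun := fun f => smoothAlg.mk (fun x => fderiv ℂ (zeroExt V f.1) x v)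
        ((ContDiffOn.fderiv_of_isOpen f.2 V.isOpen (by simp)).clm_apply contDiffOn_const)
      map_add' := fun f g => by
        ext x
        have h : zeroExt V (f.1 + g.1) =ᶠ[𝓝 x.1] zeroExt V f.1 + zeroExt V g.1 :=
          eventuallyEq_of_eqOn_opens (fun y hy => by lift y to V using hy; simp) x
        simp [h.fderiv_eq,
          fderiv_add (smoothAlg_differentiableAt f x) (smoothAlg_differentiableAt g x)]
      map_smul' := fun c f => by
        ext x
        have h : zeroExt V (c • f.1) =ᶠ[𝓝 x.1] c • zeroExt V f.1 :=
          eventuallyEq_of_eqOn_opens (fun y hy => by lift y to V using hy; simp) x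
        simp [h.fderiv_eq, fderiv_const_smul (smoothAlg_differentiableAt f x)] }
    (fun f g => by
      ext x
      have h : zeroExt V (f.1 * g.1) =ᶠ[𝓝 x.1] zeroExt V f.1 * zeroExt V g.1 :=
        eventuallyEq_of_eqOn_opens (fun y hy => by lift y to V using hy; simp) x
      simp [h.fderiv_eq,
          fderiv_mul (smoothAlg_differentiableAt f x) (smoothAlg_differentiableAt g x)])

theorem dirDer_apply (v : E) (f : smoothAlg V) (x : V) :
    (dirDer V v f).1 x = fderiv ℂ (zeroExt V f.1) x v := rfl

theorem dirDer_mk_apply (v : E) (f : E → ℂ) (hf : ContDiffOn ℂ ∞ f V) (x : V) :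
    (dirDer V v (smoothAlg.mk f hf)).1 x = fderiv ℂ f x v := by
  rw [dirDer_apply]
  exact congrArg (fun L : E →L[ℂ] ℂ => L v) (eventuallyEq_of_eqOn_opens (eqOn_zeroExt_restrict f) x).fderiv_eq

/-- Both sides are the second derivative at v and w, which is symmetric. -/
theorem dirDer_comm (v w : E) (f : smoothAlg V) :
    dirDer V v (dirDer V w f) = dirDer V w (dirDer V v f) := by
  have key : ∀ v w : E, ∀ x : V, (dirDer V v (dirDer V w f)).1 x
      = fderiv ℂ (fderiv ℂ (zeroExt V f.1)) x v w := by
    intro v w x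
    have h := ContDiffOn.fderiv_of_isOpen (m := ∞) f.2 V.isOpen (by simp)
    refine (dirDer_mk_apply v _ (h.clm_apply contDiffOn_const) x).trans ?_
    rw [fderiv_clm_apply ((h.differentiableOn (by simp)).differentiableAt
      (V.isOpen.mem_nhds x.2)) (differentiableAt_const _)]
    simp
  ext x
  rw [key v w x, key w v x]
  have : ContDiffAt ℂ ∞ (zeroExt V f.1) x := ContDiffOn.contDiffAt f.2 (V.isOpen.mem_nhds x.2)
  exact (this.isSymmSndFDerivAt (by simpa using ENat.LEInfty.out)) v w

theorem dirDer_add (v w : E) (f : smoothAlg V) :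
    dirDer V (v + w) f = dirDer V v f + dirDer V w f := by
  ext x
  simp [dirDer_apply]

theorem tendstoLocallyUniformlyOn_dirDer [ProperSpace E] (v : E) {F : ℕ → smoothAlg V}
    {f : smoothAlg V}
    (h : TendstoLocallyUniformlyOn (fun n => zeroExt V (F n).1) (zeroExt V f.1) atTop V) :
    TendstoLocallyUniformlyOn (fun n => zeroExt V (dirDer V v (F n)).1)
      (zeroExt V (dirDer V v f).1) atTop V := by
  have h1 := (h.fderiv_of_differentiableOn V.isOpen fun n =>
    ContDiffOn.differentiableOn (F n).2 (by simp)).2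
  have h2 : TendstoLocallyUniformlyOn (fun n x => fderiv ℂ (zeroExt V (F n).1) x v)
      (fun x => fderiv ℂ (zeroExt V f.1) x v) atTop V :=
    (ContinuousLinearMap.apply ℂ ℂ v).uniformContinuous.comp_tendstoLocallyUniformlyOn h1
  exact (h2.congr fun n => (eqOn_zeroExt_restrict _).symm).congr_right
    (eqOn_zeroExt_restrict _).symm

end SmoothAlgebra

end

noncomputable section

/-! ### Hadamard's bound and the Fredholm series of a matrix. -/

section DeterminantBound

open Matrix
open scoped ComplexOrder

/-- A weak form of Hadamard's inequality. -/
theorem norm_det_le_sqrt_mul_pow {k : ℕ} (M : Matrix (Fin k) (Fin k) ℂ) {C : ℝ}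
    (hM : ∀ i j, ‖M i j‖ ≤ C) : ‖M.det‖ ≤ (√k * C) ^ k := by
  rcases Nat.eq_zero_or_pos k with rfl | hk
  · simp
  have hC : 0 ≤ C := (norm_nonneg _).trans (hM ⟨0, hk⟩ ⟨0, hk⟩)
  have hps := posSemidef_self_mul_conjTranspose M
  have hH : (M * Mᴴ).IsHermitian := isHermitian_mul_conjTranspose_self M
  obtain ⟨x, hxe⟩ : ∃ x, x = hH.eigenvalues := ⟨_, rfl⟩
  have hx : ∀ i, 0 ≤ x i := fun i => hxe ▸ hps.eigenvalues_nonneg i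
  -- The product of the eigenvalues of M Mᴴ is |det M|² and their sum is the squared Frobenius norm;
  -- the inequality of arithmetic and geometric means compares the two.
  have hdet : ‖M.det‖ ^ 2 = ∏ i, x i := by
    have h1 := hH.det_eq_prod_eigenvalues
    rw [← hxe] at h1
    rw [det_mul, det_conjTranspose, Complex.star_def, Complex.mul_conj,
      Complex.normSq_eq_norm_sq] at h1
    exact Complex.ofReal_injective (by simpa using h1)
  have htr : ∑ i, x i ≤ k * (k * C ^ 2) := by
    have h1 := hH.trace_eq_sum_eigenvalues
    rw [← hxe] at h1
    have h2 : (M * Mᴴ).trace = ((∑ i, ∑ j, ‖M i j‖ ^ 2 : ℝ) : ℂ) := by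
      simp [trace, mul_apply, Complex.mul_conj, Complex.normSq_eq_norm_sq]
    rw [h2] at h1
    have h3 : ∑ i, x i = ∑ i, ∑ j, ‖M i j‖ ^ 2 := 
      Complex.ofReal_injective (by simpa using h1.symm)
    rw [h3]
    calc ∑ i, ∑ j, ‖M i j‖ ^ 2 ≤ ∑ _i : Fin k, ∑ _j : Fin k, C ^ 2 := by
          gcongr with i _ j _
          exact hM i j
      _ = _ := by simp
  have hk' : (0 : ℝ) < k := by exact_mod_cast hk
  have hamgm : ∏ i, x i ≤ (k * C ^ 2) ^ k := by
    have h1 := Real.geom_mean_le_arith_mean Finset.univ (fun _ => (1 : ℝ)) x (by simp)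
      (by simpa using hk) (fun i _ => hx i)
    simp only [Real.rpow_one, Finset.sum_const, Finset.card_univ, Fintype.card_fin, nsmul_eq_mul,
      mul_one, one_mul] at h1
    have hp : 0 ≤ ∏ i, x i := Finset.prod_nonneg fun i _ => hx i
    have h2 : (∑ i, x i) / k ≤ k * C ^ 2 := by
      rw [div_le_iff₀ hk']
      linarith
    calc ∏ i, x i = ((∏ i, x i) ^ ((k : ℝ)⁻¹)) ^ k := by
          rw [← Real.rpow_natCast, ← Real.rpow_mul hp, inv_mul_cancel₀ hk'.ne', Real.rpow_one]
      _ ≤ _ := by gcongr; exact h1.trans h2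
  refine le_of_sq_le_sq ?_ (by positivity)
  calc ‖M.det‖ ^ 2 ≤ (k * C ^ 2) ^ k := hdet ▸ hamgm
    _ = _ := by rw [← pow_mul, mul_comm k 2, pow_mul, mul_pow (√(k : ℝ)) C 2, Real.sq_sqrt hk'.le]

/-- Since k^k/k! ≤ e^k, the k-th term is at most (e|C|/√k)^k in modulus, hence below 2^{-k} once √k
≥ 2e|C|. This is the common majorant of all Fredholm series below. -/
theorem summable_sqrt_mul_pow_div_factorial (C : ℝ) :
    Summable fun k : ℕ => (√k * C) ^ k / (k ! : ℝ) := by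
  obtain ⟨N, hN⟩ := exists_nat_gt ((2 * |C| * Real.exp 1) ^ 2)
  refine Summable.of_norm_bounded_eventually_nat
    (g := fun k : ℕ => (1 / 2 : ℝ) ^ k) (summable_geometric_of_lt_one (by norm_num) (by norm_num)) ?_
  filter_upwards [Filter.eventually_ge_atTop (max N 1)] with k hk
  have hk1 : (1 : ℝ) ≤ k := by exact_mod_cast (le_max_right _ _).trans hk
  have hkN : (N : ℝ) ≤ k := by exact_mod_cast (le_max_left _ _).trans hk
  have hs : 2 * |C| * Real.exp 1 ≤ √k := Real.le_sqrt_of_sq_le (hN.le.trans hkN)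
  have hs0 : 0 < √(k : ℝ) := Real.sqrt_pos.mpr (by linarith)
  have hf : (k : ℝ) ^ k / (k ! : ℝ) ≤ Real.exp 1 ^ k := by
    rw [← Real.exp_nat_mul, mul_one]
    exact Real.pow_div_factorial_le_exp (k : ℝ) (by positivity) k
  have hsk : √(k : ℝ) * |C| = (|C| / √k) * k := by
    field_simp
    rw [Real.sq_sqrt (by linarith), mul_comm]
  calc ‖(√k * C) ^ k / (k ! : ℝ)‖ = (√k * |C|) ^ k / (k ! : ℝ) := by
        rw [norm_div, norm_pow, norm_mul, Real.norm_eq_abs, Real.norm_eq_abs, abs_of_pos hs0]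
        simp
    _ = (|C| / √k) ^ k * ((k : ℝ) ^ k / (k ! : ℝ)) := by rw [hsk, mul_pow, mul_div_assoc]
    _ ≤ (|C| / √k) ^ k * Real.exp 1 ^ k := by gcongr
    _ = (|C| / √k * Real.exp 1) ^ k := by rw [mul_pow]
    _ ≤ (1 / 2) ^ k := by
        gcongr
        rw [div_mul_eq_mul_div, div_le_iff₀ hs0]
        linarith

/-- Non-injective index maps repeat a row and contribute nothing. Each set of j indices is the image
of j! injective maps, and all of them give the same principal minor. -/
theorem sum_det_submatrix_eq {n j : ℕ} (M : Matrix (Fin n) (Fin n) ℂ) :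
    ∑ f : Fin j → Fin n, (M.submatrix f f).det
      = (j ! : ℂ) * ∑ s ∈ Finset.univ.powersetCard j,
        (M.submatrix (Subtype.val : s → Fin n) (Subtype.val : s → Fin n)).det := by
  have h0 : ∀ f : Fin j → Fin n, ¬ Function.Injective f → (M.submatrix f f).det = 0 := by
    intro f hf
    simp only [Function.Injective, not_forall] at hf
    obtain ⟨a, b, hab, hne⟩ := hf
    exact det_zero_of_row_eq hne (by ext; simp [hab])
  have h1 : ∑ f : Fin j → Fin n, (M.submatrix f f).det
      = ∑ f ∈ Finset.univ.filter fun f : Fin j → Fin n => Function.Injective f,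
        (M.submatrix f f).det := by
    rw [Finset.sum_filter]
    refine Finset.sum_congr rfl fun f _ => ?_
    split_ifs with h
    · rfl
    · exact h0 f h
  rw [h1, ← Finset.sum_fiberwise_of_maps_to
    (g := fun f : Fin j → Fin n => Finset.univ.image f) (t := Finset.univ.powersetCard j)]
  · rw [Finset.mul_sum]
    refine Finset.sum_congr rfl fun s hs => ?_
    have hs' : s.card = j := (Finset.mem_powersetCard.mp hs).2
    have h2 : ∀ f : Fin j → Fin n, f ∈ (Finset.univ.filter fun f : Fin j → Fin n =>
        Function.Injective f).filter (fun f => Finset.univ.image f = s) →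
        (M.submatrix f f).det =
          (M.submatrix (Subtype.val : s → Fin n) (Subtype.val : s → Fin n)).det := by
      intro f hf
      rw [Finset.mem_filter, Finset.mem_filter] at hf
      have hb : Function.Bijective (fun a => (⟨f a, by
          rw [← hf.2]; exact Finset.mem_image_of_mem f (Finset.mem_univ a)⟩ : s)) := by
        refine ⟨fun a b hab => hf.1.2 (congrArg Subtype.val hab), fun ⟨y, hy⟩ => ?_⟩
        rw [← hf.2] at hy
        obtain ⟨a, -, ha⟩ := Finset.mem_image.mp hy
        exact ⟨a, Subtype.ext ha⟩
      rw [← det_submatrix_equiv_self (Equiv.ofBijective _ hb)]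
      rfl
    rw [Finset.sum_congr rfl h2, Finset.sum_const, nsmul_eq_mul]
    congr 2
    have e : {f : Fin j → Fin n // f ∈ (Finset.univ.filter fun f : Fin j → Fin n =>
        Function.Injective f).filter (fun f => Finset.univ.image f = s)} ≃ (Fin j ≃ s) :=
      { toFun := fun f => Equiv.ofBijective (fun a => (⟨f.1 a, by
            exact (Finset.mem_filter.mp f.2).2.subset
              (Finset.mem_image_of_mem f.1 (Finset.mem_univ a))⟩ : s)) (by
          have hf := f.2
          rw [Finset.mem_filter, Finset.mem_filter] at hf
          refine ⟨fun a b hab => hf.1.2 (congrArg Subtype.val hab), fun ⟨y, hy⟩ => ?_⟩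
          rw [← hf.2] at hy
          obtain ⟨a, -, ha⟩ := Finset.mem_image.mp hy
          exact ⟨a, Subtype.ext ha⟩)
        invFun := fun e => ⟨fun a => (e a).1, by
          rw [Finset.mem_filter, Finset.mem_filter]
          refine ⟨⟨Finset.mem_univ _, fun a b hab => e.injective (Subtype.ext hab)⟩, ?_⟩
          ext y
          simp only [Finset.mem_image, Finset.mem_univ, true_and]
          exact ⟨fun ⟨a, ha⟩ => ha ▸ (e a).2, fun hy => ⟨e.symm ⟨y, hy⟩, by simp⟩⟩⟩
        left_inv := fun f => rfl
        right_inv := fun e => by ext; rfl }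
    have hc := Fintype.card_congr e
    rw [Fintype.card_coe, Fintype.card_equiv ((Fintype.equivFinOfCardEq (by simp [hs'])).symm),
      Fintype.card_fin] at hc
    exact hc
  · intro f hf
    rw [Finset.mem_powersetCard]
    refine ⟨Finset.subset_univ _, ?_⟩
    rw [Finset.card_image_of_injective _ (Finset.mem_filter.mp hf).2, Finset.card_univ,
      Fintype.card_fin]

/-- The discrete analogue of the Fredholm series. -/
theorem hasSum_det_one_sub {n : ℕ} (M : Matrix (Fin n) (Fin n) ℂ) :
    HasSum (fun j : ℕ => (-1 : ℂ) ^ j / (j ! : ℂ) * ∑ f : Fin j → Fin n, (M.submatrix f f).det)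
      (1 - M).det := by
  -- The coefficients of det(1 + X M) are sums of principal minors, so the series is this polynomial
  -- evaluated at -1.
  have h1 : ∀ j, (-1 : ℂ) ^ j / (j ! : ℂ) * ∑ f : Fin j → Fin n, (M.submatrix f f).det
      = (det (1 + (Polynomial.X : Polynomial ℂ) • M.map Polynomial.C)).coeff j * (-1) ^ j := by
    intro j
    rw [coeff_det_one_add_X_smul_eq_sum_minors, sum_det_submatrix_eq]
    have : (j ! : ℂ) ≠ 0 := by exact_mod_cast j.factorial_ne_zero
    field_simp
  simp_rw [h1]
  have h2 : (1 - M).det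
      = (det (1 + (Polynomial.X : Polynomial ℂ) • M.map Polynomial.C)).eval (-1) := by
    rw [← Polynomial.coe_evalRingHom, RingHom.map_det]
    congr 1
    ext i k
    by_cases hik : i = k <;> simp [hik, one_apply, sub_eq_add_neg]
  rw [h2, Polynomial.eval_eq_sum, Polynomial.sum]
  refine hasSum_sum_of_ne_finset_zero fun j hj => ?_
  rw [Polynomial.notMem_support_iff.mp hj, zero_mul]

end DeterminantBound

end

noncomputable section

/-! ### Discretization and continuity of Fredholm determinants. -/

section FredholmLimits

open Matrix Filter Topology MeasureTheory
open scoped Pointwise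

/-- Matches the index maps with the lattice points of the half-open cube, over which the Riemann
sums with a known limit are taken. -/
theorem range_div_eq_inter_smul_span {j n : ℕ} [NeZero n] :
    Set.range (fun (f : Fin j → Fin n) (i : Fin j) => ((f i : ℕ) : ℝ) / n)
      = (Set.univ.pi fun _ => Set.Ico (0 : ℝ) 1) ∩
        ((n : ℝ)⁻¹ • (Submodule.span ℤ (Set.range (Pi.basisFun ℝ (Fin j))) : Set (Fin j → ℝ))) := by
  have hn : (0 : ℝ) < n := by exact_mod_cast Nat.pos_of_neZero n
  ext x
  constructor
  · rintro ⟨f, rfl⟩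
    refine ⟨fun i _ => ⟨by positivity, ?_⟩, ?_⟩
    · rw [div_lt_one hn]
      exact_mod_cast (f i).2
    · refine (BoxIntegral.unitPartition.mem_smul_span_iff (n := n)).mpr fun i => ⟨(f i : ℕ), ?_⟩
      simp only [algebraMap_int_eq, eq_intCast, Int.cast_natCast]
      field_simp
  · rintro ⟨h1, h2⟩
    have h2' := (BoxIntegral.unitPartition.mem_smul_span_iff (n := n)).mp h2
    choose a ha using h2'
    have ha' : ∀ i, (a i : ℝ) = n * x i := fun i => by simpa using ha i
    have h0 : ∀ i, 0 ≤ a i := fun i => by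
      have : (0 : ℝ) ≤ a i := by
        rw [ha' i]; exact mul_nonneg hn.le (h1 i trivial).1
      exact_mod_cast this
    have hlt : ∀ i, (a i).toNat < n := fun i => by
      have : (a i : ℝ) < n := by
        rw [ha' i]
        have := (h1 i trivial).2
        nlinarith
      have h3 : a i < n := by exact_mod_cast this
      have := h0 i
      omega
    refine ⟨fun i => ⟨(a i).toNat, hlt i⟩, ?_⟩
    ext i
    have h4 : ((a i).toNat : ℝ) = (a i : ℝ) := by
      exact_mod_cast congrArg (Int.cast : ℤ → ℝ) (Int.toNat_of_nonneg (h0 i))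
    simp only [h4, ha' i]
    field_simp

theorem frontier_cube_null (j : ℕ) :
    volume (frontier (Set.univ.pi fun _ : Fin j => Set.Ico (0 : ℝ) 1)) = 0 :=
  (convex_pi fun _ _ => convex_Ico 0 1).addHaar_frontier volume

theorem tendsto_riemann_sum_cube {j : ℕ} {F : (Fin j → ℝ) → ℂ} (hF : Continuous F) :
    Tendsto (fun n : ℕ => (∑ f : Fin j → Fin n, F fun i => ((f i : ℕ) : ℝ) / n) / (n : ℂ) ^ j)
      atTop (𝓝 (∫ x in Set.univ.pi fun _ : Fin j => Set.Icc (0 : ℝ) 1, F x)) := by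
  have hreal : ∀ {G : (Fin j → ℝ) → ℝ}, Continuous G →
      Tendsto (fun n : ℕ => (∑ f : Fin j → Fin n, G fun i => ((f i : ℕ) : ℝ) / n) / (n : ℝ) ^ j)
        atTop (𝓝 (∫ x in Set.univ.pi fun _ : Fin j => Set.Icc (0 : ℝ) 1, G x)) := by
    intro G hG
    have h1 := tendsto_tsum_div_pow_atTop_integral
      (Set.univ.pi fun _ : Fin j => Set.Ico (0 : ℝ) 1) G hG
      (Bornology.IsBounded.pi fun _ => Metric.isBounded_Ico 0 1)
      (MeasurableSet.univ_pi fun _ => measurableSet_Ico) (frontier_cube_null j)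
    have h2 : ∫ x in Set.univ.pi fun _ : Fin j => Set.Ico (0 : ℝ) 1, G x
        = ∫ x in Set.univ.pi fun _ : Fin j => Set.Icc (0 : ℝ) 1, G x := by
      refine setIntegral_congr_set ?_
      exact Measure.univ_pi_Ico_ae_eq_Icc.trans (by rw [Set.pi_univ_Icc]; rfl)
    rw [h2] at h1
    refine h1.congr' ?_
    filter_upwards [eventually_gt_atTop 0] with n hn
    have : NeZero n := ⟨hn.ne'⟩
    rw [Fintype.card_fin]
    congr 1
    rw [← range_div_eq_inter_smul_span, tsum_range G, tsum_fintype]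
    intro f g hfg
    ext i
    have := congrFun hfg i
    have hn' : (n : ℝ) ≠ 0 := by exact_mod_cast hn.ne'
    simp only at this
    field_simp at this
    exact_mod_cast this
  have hint : IntegrableOn F (Set.univ.pi fun _ : Fin j => Set.Icc (0 : ℝ) 1) :=
    hF.continuousOn.integrableOn_compact (isCompact_univ_pi fun _ => isCompact_Icc)
  have hre := hreal (Complex.continuous_re.comp hF)
  have him := hreal (Complex.continuous_im.comp hF)
  have h := ((Complex.continuous_ofReal.tendsto _).comp hre).add
    (((Complex.continuous_ofReal.tendsto _).comp him).mul_const Complex.I)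
  have hlim : ∫ x in Set.univ.pi fun _ : Fin j => Set.Icc (0 : ℝ) 1, F x
      = ((∫ x in Set.univ.pi fun _ : Fin j => Set.Icc (0 : ℝ) 1, (Complex.re ∘ F) x : ℝ) : ℂ)
        + ((∫ x in Set.univ.pi fun _ : Fin j => Set.Icc (0 : ℝ) 1, (Complex.im ∘ F) x : ℝ) : ℂ)
          * Complex.I := (integral_re_add_im hint).symm
  rw [hlim]
  refine h.congr fun n => ?_
  simp only [Function.comp, Complex.ofReal_div, Complex.ofReal_pow, Complex.ofReal_natCast,
    Complex.ofReal_sum]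
  rw [div_mul_eq_mul_div, ← add_div, Finset.sum_mul, ← Finset.sum_add_distrib]
  congr 1
  exact Finset.sum_congr rfl fun f _ => Complex.re_add_im _

/-- The n^j index maps are compensated by entries of size C/n, so the bound does not depend on n. -/
theorem norm_sum_det_le {n j : ℕ} (M : Matrix (Fin n) (Fin n) ℂ) {C : ℝ} (hC : 0 ≤ C)
    (hM : ∀ i k, ‖M i k‖ ≤ C / n) :
    ‖(-1 : ℂ) ^ j / (j ! : ℂ) * ∑ f : Fin j → Fin n, (M.submatrix f f).det‖
      ≤ (√j * C) ^ j / (j ! : ℝ) := by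
  have hf : (0 : ℝ) < (j ! : ℝ) := by exact_mod_cast j.factorial_pos
  rw [norm_mul, norm_div, norm_pow, norm_neg, norm_one, one_pow, Complex.norm_natCast,
    one_div_mul_eq_div]
  gcongr
  rcases Nat.eq_zero_or_pos n with rfl | hn
  · rcases Nat.eq_zero_or_pos j with rfl | hj
    · simp
    · have : IsEmpty (Fin j → Fin 0) := ⟨fun f => (f ⟨0, hj⟩).elim0⟩
      simp only [Finset.univ_eq_empty, Finset.sum_empty, norm_zero]
      positivity
  have hn' : (0 : ℝ) < n := by exact_mod_cast hn
  calc ‖∑ f : Fin j → Fin n, (M.submatrix f f).det‖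
      ≤ ∑ _f : Fin j → Fin n, (√j * (C / n)) ^ j :=
        norm_sum_le_of_le _ fun f _ => norm_det_le_sqrt_mul_pow _ fun a b => hM _ _
    _ = (√j * C) ^ j := by
        rw [Finset.sum_const, Finset.card_univ, Fintype.card_fun, Fintype.card_fin,
          Fintype.card_fin, nsmul_eq_mul, Nat.cast_pow, ← mul_pow]
        congr 1
        field_simp

theorem norm_det_one_sub_le {n : ℕ} (M : Matrix (Fin n) (Fin n) ℂ) {C : ℝ} (hC : 0 ≤ C)
    (hM : ∀ i k, ‖M i k‖ ≤ C / n) :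
    ‖(1 - M).det‖ ≤ ∑' j : ℕ, (√j * C) ^ j / (j ! : ℝ) := by
  rw [← (hasSum_det_one_sub M).tsum_eq]
  exact tsum_of_norm_bounded (summable_sqrt_mul_pow_div_factorial C).hasSum
    fun j => norm_sum_det_le M hC hM

/-- The cube `[a, b]^j`. -/
abbrev cube (a b : ℝ) (j : ℕ) : Set (Fin j → ℝ) := Set.univ.pi fun _ => Set.Icc a b

theorem isCompact_cube (a b : ℝ) (j : ℕ) : IsCompact (cube a b j) :=
  isCompact_univ_pi fun _ => isCompact_Icc

theorem measureReal_cube {a b : ℝ} (hab : a ≤ b) (j : ℕ) :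
    volume.real (cube a b j) = (b - a) ^ j := by
  rw [measureReal_def, volume_pi_pi]
  simp [Real.volume_Icc, ENNReal.toReal_ofReal (sub_nonneg.mpr hab)]

theorem norm_fredholm_term_le {K : ℝ → ℝ → ℂ} {a b C : ℝ} (hab : a ≤ b)
    (hK : ∀ x ∈ Set.Icc a b, ∀ y ∈ Set.Icc a b, ‖K x y‖ ≤ C) (j : ℕ) :
    ‖(-1 : ℂ) ^ j / (j ! : ℂ) * ∫ x in cube a b j, (Matrix.of fun i k : Fin j => K (x i) (x k)).det‖
      ≤ (√j * ((b - a) * C)) ^ j / (j ! : ℝ) := by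
  have hf : (0 : ℝ) < (j ! : ℝ) := by exact_mod_cast j.factorial_pos
  rw [norm_mul, norm_div, norm_pow, norm_neg, norm_one, one_pow, Complex.norm_natCast,
    one_div_mul_eq_div]
  gcongr
  calc ‖∫ x in cube a b j, (Matrix.of fun i k : Fin j => K (x i) (x k)).det‖
      ≤ (√j * C) ^ j * volume.real (cube a b j) :=
        norm_setIntegral_le_of_norm_le_const (isCompact_cube a b j).measure_lt_top
          fun x hx => norm_det_le_sqrt_mul_pow _ fun i k => hK _ (hx i trivial) _ (hx k trivial)
    _ = _ := by rw [measureReal_cube hab, ← mul_pow]; ring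

/-- The Fredholm determinant is the limit of its discretizations. -/
theorem tendsto_det_one_sub_fredholmDet {k : ℝ → ℝ → ℂ} (hk : Continuous fun p : ℝ × ℝ => k p.1 p.2) :
    Tendsto (fun n : ℕ => (1 - Matrix.of fun i l : Fin n =>
      k (((i : ℕ) : ℝ) / n) (((l : ℕ) : ℝ) / n) / n).det) atTop (𝓝 (fredholmDet k 0 1)) := by
  obtain ⟨C, hC⟩ := (isCompact_Icc.prod isCompact_Icc).exists_bound_of_continuousOn
    (s := Set.Icc (0 : ℝ) 1 ×ˢ Set.Icc (0 : ℝ) 1) hk.continuousOn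
  have hC0 : 0 ≤ C := (norm_nonneg _).trans (hC (0, 0) (by simp))
  have hdet : ∀ j, Continuous fun x : Fin j → ℝ =>
      (Matrix.of fun i l : Fin j => k (x i) (x l)).det := fun j => by
    refine Continuous.matrix_det (continuous_matrix fun i l => ?_)
    have h : Continuous fun x : Fin j → ℝ => (x i, x l) := by fun_prop
    exact hk.comp h
  have key : Tendsto (fun n : ℕ => ∑' j : ℕ, (-1 : ℂ) ^ j / (j ! : ℂ) * ∑ f : Fin j → Fin n,
      ((Matrix.of fun i l : Fin n =>
        k (((i : ℕ) : ℝ) / n) (((l : ℕ) : ℝ) / n) / n).submatrix f f).det) atTop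
      (𝓝 (fredholmDet k 0 1)) := by
    -- Each term is a Riemann sum, and the bound that is uniform in n permits the limit under the
    -- sum.
    refine tendsto_tsum_of_dominated_convergence (summable_sqrt_mul_pow_div_factorial C) ?_ ?_
    · intro j
      refine Tendsto.const_mul _ ?_
      refine (tendsto_riemann_sum_cube (hdet j)).congr fun n => ?_
      rw [Finset.sum_div]
      refine Finset.sum_congr rfl fun f _ => ?_
      rw [div_eq_inv_mul, ← inv_pow]
      have := Matrix.det_smul (Matrix.of fun i l : Fin j =>
        k (((f i : ℕ) : ℝ) / n) (((f l : ℕ) : ℝ) / n)) ((n : ℂ)⁻¹)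
      rw [Fintype.card_fin] at this
      rw [← this]
      congr 1
      ext i l
      simp [div_eq_inv_mul]
    · refine Filter.Eventually.of_forall fun n j => norm_sum_det_le _ hC0 fun i l => ?_
      have hb : ∀ i : Fin n, ((i : ℕ) : ℝ) / n ∈ Set.Icc (0 : ℝ) 1 := fun i =>
        ⟨by positivity, div_le_one_of_le₀ (by exact_mod_cast i.2.le) (by positivity)⟩
      simp only [Matrix.of_apply, norm_div, Complex.norm_natCast]
      gcongr
      exact hC (_, _) ⟨hb i, hb l⟩
  exact key.congr fun n => (hasSum_det_one_sub _).tsum_eq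

theorem setIntegral_cube_comp_affine {a b : ℝ} (hab : a < b) (j : ℕ) (F : (Fin j → ℝ) → ℂ) :
    ∫ x in cube a b j, F x
      = ((b - a : ℝ) : ℂ) ^ j * ∫ s in cube 0 1 j, F fun i => a + (b - a) * s i := by
  have hpos : 0 < b - a := sub_pos.mpr hab
  have h1 := Measure.setIntegral_comp_smul_of_pos volume
    (fun y : Fin j → ℝ => F fun i => a + y i) (cube 0 1 j) hpos
  have h2 : (b - a) • cube 0 1 j = (fun y : Fin j → ℝ => (fun _ => a) + y) ⁻¹' cube a b j := by
    ext y
    simp only [Set.mem_smul_set_iff_inv_smul_mem₀ hpos.ne', cube, Set.mem_univ_pi, Set.mem_Icc,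
      Set.mem_preimage, Pi.add_apply, Pi.smul_apply, smul_eq_mul]
    refine forall_congr' fun i => ?_
    rw [inv_mul_le_iff₀ hpos, mul_one]
    constructor
    · rintro ⟨h, h'⟩
      have : 0 ≤ y i := by
        have := mul_nonneg hpos.le h
        rwa [mul_inv_cancel_left₀ hpos.ne'] at this
      constructor <;> linarith
    · rintro ⟨h, h'⟩
      exact ⟨mul_nonneg (inv_nonneg.mpr hpos.le) (by linarith), by linarith⟩
  have h3 : ∫ y in (b - a) • cube 0 1 j, F (fun i => a + y i) = ∫ x in cube a b j, F x := by
    rw [h2]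
    exact MeasurePreserving.setIntegral_preimage_emb
      (measurePreserving_add_left volume (fun _ : Fin j => a))
      (measurableEmbedding_addLeft (fun _ : Fin j => a)) F _
  rw [h3, Module.finrank_fintype_fun_eq_card, Fintype.card_fin] at h1
  simp only [Pi.smul_apply, smul_eq_mul] at h1
  rw [h1, Complex.real_smul, ← mul_assoc]
  push_cast
  rw [mul_inv_cancel₀, one_mul]
  exact pow_ne_zero _ (by exact_mod_cast hpos.ne')

/-- Moving a and b from the domain into the kernel makes them parameters that may become complex. -/
theorem fredholmDet_eq_unit_interval (K : ℝ → ℝ → ℂ) {a b : ℝ} (hab : a < b) :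
    fredholmDet K a b
      = fredholmDet (fun s t => ((b - a : ℝ) : ℂ) * K (a + (b - a) * s) (a + (b - a) * t)) 0 1 := by
  unfold fredholmDet
  refine tsum_congr fun j => ?_
  congr 1
  refine (setIntegral_cube_comp_affine hab j _).trans ?_
  rw [← integral_const_mul]
  congr 1
  ext s
  have := Matrix.det_smul (Matrix.of fun i l : Fin j =>
    K (a + (b - a) * s i) (a + (b - a) * s l)) ((b - a : ℝ) : ℂ)
  rw [Fintype.card_fin] at this
  rw [← this]
  rfl

/-- Continuity of the Fredholm determinant in the kernel. -/
theorem tendsto_fredholmDet {K : ℕ → ℝ → ℝ → ℂ} {k : ℝ → ℝ → ℂ} {a b C : ℝ} (hab : a ≤ b)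
    (hK : ∀ n, Continuous fun p : ℝ × ℝ => K n p.1 p.2)
    (hC : ∀ n, ∀ x ∈ Set.Icc a b, ∀ y ∈ Set.Icc a b, ‖K n x y‖ ≤ C)
    (h : ∀ x ∈ Set.Icc a b, ∀ y ∈ Set.Icc a b, Tendsto (fun n => K n x y) atTop (𝓝 (k x y))) :
    Tendsto (fun n => fredholmDet (K n) a b) atTop (𝓝 (fredholmDet k a b)) := by
  refine tendsto_tsum_of_dominated_convergence
    (summable_sqrt_mul_pow_div_factorial ((b - a) * C)) ?_
    (Filter.Eventually.of_forall fun n j => norm_fredholm_term_le hab (hC n) j)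
  intro j
  refine Tendsto.const_mul _ ?_
  refine tendsto_integral_of_dominated_convergence (fun _ => (√j * C) ^ j) ?_ ?_ ?_ ?_
  · intro n
    refine Continuous.aestronglyMeasurable (Continuous.matrix_det (continuous_matrix fun i l => ?_))
    have h : Continuous fun x : Fin j → ℝ => (x i, x l) := by fun_prop
    exact (hK n).comp h
  · exact integrableOn_const (isCompact_cube a b j).measure_lt_top.ne
  · intro n
    refine (ae_restrict_iff' (isCompact_cube a b j).measurableSet).mpr (.of_forall fun x hx => ?_)
    exact norm_det_le_sqrt_mul_pow _ fun i l => hC n _ (hx i trivial) _ (hx l trivial)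
  · refine (ae_restrict_iff' (isCompact_cube a b j).measurableSet).mpr (.of_forall fun x hx => ?_)
    have : Tendsto (fun n => Matrix.of fun i l : Fin j => K n (x i) (x l)) atTop
        (𝓝 (Matrix.of fun i l : Fin j => k (x i) (x l))) :=
      tendsto_pi_nhds.mpr fun i => tendsto_pi_nhds.mpr fun l =>
        h _ (hx i trivial) _ (hx l trivial)
    exact ((Continuous.matrix_det continuous_id).tendsto _).comp this

end FredholmLimits

end

noncomputable section

/-! ### Integrals of exponentials as entire functions of three parameters. -/

section ExponentialIntegrals

open MeasureTheory

/-- The bilinear pairing on `ℂ³`. -/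
def pair3 (l : ℂ × ℂ × ℂ) : ℂ × ℂ × ℂ →L[ℂ] ℂ :=
  l.1 • ContinuousLinearMap.fst ℂ ℂ (ℂ × ℂ)
    + l.2.1 • (ContinuousLinearMap.fst ℂ ℂ ℂ).comp (ContinuousLinearMap.snd ℂ ℂ (ℂ × ℂ))
    + l.2.2 • (ContinuousLinearMap.snd ℂ ℂ ℂ).comp (ContinuousLinearMap.snd ℂ ℂ (ℂ × ℂ))

theorem pair3_apply (l p : ℂ × ℂ × ℂ) : pair3 l p = l.1 * p.1 + l.2.1 * p.2.1 + l.2.2 * p.2.2 := by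
  simp [pair3]

theorem norm_pair3_apply_le (l p : ℂ × ℂ × ℂ) : ‖pair3 l p‖ ≤ 3 * ‖l‖ * ‖p‖ := by
  have hl1 := norm_fst_le l
  have hl2 := norm_snd_le l
  have hp1 := norm_fst_le p
  have hp2 := norm_snd_le p
  have h1 : ‖l.1 * p.1‖ ≤ ‖l‖ * ‖p‖ := by
    rw [norm_mul]; gcongr
  have h2 : ‖l.2.1 * p.2.1‖ ≤ ‖l‖ * ‖p‖ := by
    rw [norm_mul]
    gcongr
    exacts [(norm_fst_le l.2).trans hl2, (norm_fst_le p.2).trans hp2]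
  have h3 : ‖l.2.2 * p.2.2‖ ≤ ‖l‖ * ‖p‖ := by
    rw [norm_mul]
    gcongr
    exacts [(norm_snd_le l.2).trans hl2, (norm_snd_le p.2).trans hp2]
  rw [pair3_apply]
  linarith [norm_add₃_le (a := l.1 * p.1) (b := l.2.1 * p.2.1) (c := l.2.2 * p.2.2)]

theorem norm_pair3_le (l : ℂ × ℂ × ℂ) : ‖pair3 l‖ ≤ 3 * ‖l‖ :=
  ContinuousLinearMap.opNorm_le_bound _ (by positivity) (norm_pair3_apply_le l)

theorem continuous_pair3 : Continuous pair3 := by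
  unfold pair3
  fun_prop

variable {Ω : Type} [MeasurableSpace Ω] {m : Measure Ω}

/-- The Laplace-type transform of the density `h`, with frequencies `l`. -/
def expInt (m : Measure Ω) (h : Ω → ℂ) (l : Ω → ℂ × ℂ × ℂ) (p : ℂ × ℂ × ℂ) : ℂ :=
  ∫ w, h w * Complex.exp (pair3 (l w) p) ∂m

/-- The density `h` is integrable against all exponentials of the frequencies. -/
structure ExpIntegrable (m : Measure Ω) (h : Ω → ℂ) (l : Ω → ℂ × ℂ × ℂ) : Prop where
  meas : AEStronglyMeasurable h m
  meas_freq : AEStronglyMeasurable l m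
  integrable : ∀ C : ℝ, Integrable (fun w => ‖h w‖ * Real.exp (C * ‖l w‖)) m

theorem ExpIntegrable.mul_bounded {h : Ω → ℂ} {l : Ω → ℂ × ℂ × ℂ} (H : ExpIntegrable m h l)
    {g : Ω → ℂ} (hg : AEStronglyMeasurable g m) (A c : ℝ)
    (hb : ∀ w, ‖g w‖ ≤ A * Real.exp (c * ‖l w‖)) : ExpIntegrable m (fun w => h w * g w) l where
  meas := H.meas.mul hg
  meas_freq := H.meas_freq
  integrable C := by
    refine ((H.integrable (c + C)).const_mul A).mono'
      ((H.meas.mul hg).norm.mul (Real.continuous_exp.comp_aestronglyMeasurable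
        (H.meas_freq.norm.const_mul C))) (.of_forall fun w => ?_)
    rw [Real.norm_of_nonneg (by positivity), norm_mul]
    calc ‖h w‖ * ‖g w‖ * Real.exp (C * ‖l w‖)
        ≤ ‖h w‖ * (A * Real.exp (c * ‖l w‖)) * Real.exp (C * ‖l w‖) := by
          gcongr; exact hb w
      _ = A * (‖h w‖ * Real.exp ((c + C) * ‖l w‖)) := by rw [add_mul, Real.exp_add]; ring

/-- A derivative of `expInt` multiplies the density by a linear form in the frequency. Integrability
against every exponential survives this, which gives smoothness by induction. -/
theorem ExpIntegrable.mul_pair3 {h : Ω → ℂ} {l : Ω → ℂ × ℂ × ℂ} (H : ExpIntegrable m h l)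
    (v : ℂ × ℂ × ℂ) : ExpIntegrable m (fun w => h w * pair3 (l w) v) l := by
  refine H.mul_bounded ?_ (3 * ‖v‖) 1 fun w => ?_
  · exact (ContinuousLinearMap.apply ℂ ℂ v).continuous.comp_aestronglyMeasurable
      (continuous_pair3.comp_aestronglyMeasurable H.meas_freq)
  · have := Real.add_one_le_exp (1 * ‖l w‖)
    calc _ ≤ 3 * ‖l w‖ * ‖v‖ := norm_pair3_apply_le _ _
      _ = 3 * ‖v‖ * ‖l w‖ := by ring
      _ ≤ _ := by gcongr; linarith

theorem ExpIntegrable.aestronglyMeasurable_mul_exp {h : Ω → ℂ} {l : Ω → ℂ × ℂ × ℂ}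
    (H : ExpIntegrable m h l) (p : ℂ × ℂ × ℂ) :
    AEStronglyMeasurable (fun w => h w * Complex.exp (pair3 (l w) p)) m :=
  H.meas.mul (Complex.continuous_exp.comp_aestronglyMeasurable
    ((ContinuousLinearMap.apply ℂ ℂ p).continuous.comp_aestronglyMeasurable
      (continuous_pair3.comp_aestronglyMeasurable H.meas_freq)))

theorem norm_mul_exp_pair3_le (z : ℂ) (l p : ℂ × ℂ × ℂ) {C : ℝ} (hp : ‖p‖ ≤ C) :
    ‖z * Complex.exp (pair3 l p)‖ ≤ ‖z‖ * Real.exp (3 * C * ‖l‖) := by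
  rw [norm_mul, Complex.norm_exp]
  gcongr
  calc (pair3 l p).re ≤ ‖pair3 l p‖ := Complex.re_le_norm _
    _ ≤ 3 * ‖l‖ * ‖p‖ := norm_pair3_apply_le _ _
    _ ≤ 3 * ‖l‖ * C := by gcongr
    _ = _ := by ring

theorem ExpIntegrable.integrable_mul_exp {h : Ω → ℂ} {l : Ω → ℂ × ℂ × ℂ}
    (H : ExpIntegrable m h l) (p : ℂ × ℂ × ℂ) :
    Integrable (fun w => h w * Complex.exp (pair3 (l w) p)) m :=
  (H.integrable (3 * ‖p‖)).mono' (H.aestronglyMeasurable_mul_exp p)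
    (.of_forall fun _ => norm_mul_exp_pair3_le _ _ _ le_rfl)

theorem ExpIntegrable.hasFDerivAt {h : Ω → ℂ} {l : Ω → ℂ × ℂ × ℂ} (H : ExpIntegrable m h l)
    (p : ℂ × ℂ × ℂ) : HasFDerivAt (expInt m h l)
      (∫ w, (h w * Complex.exp (pair3 (l w) p)) • pair3 (l w) ∂m) p := by
  -- In the bound, 3(‖p‖ + 1) covers the unit ball around p, and the additional 1 in the exponent
  -- pays for the frequency brought down by the derivative.
  refine hasFDerivAt_integral_of_dominated_of_fderiv_le
    (F := fun p w => h w * Complex.exp (pair3 (l w) p))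
    (F' := fun p w => (h w * Complex.exp (pair3 (l w) p)) • pair3 (l w))
    (bound := fun w => 3 * (‖h w‖ * Real.exp ((3 * (‖p‖ + 1) + 1) * ‖l w‖)))
    (Metric.ball_mem_nhds p one_pos) (.of_forall fun x => H.aestronglyMeasurable_mul_exp x)
    (H.integrable_mul_exp p) ?_ ?_ ?_ ?_
  · exact (H.aestronglyMeasurable_mul_exp p).smul
      (continuous_pair3.comp_aestronglyMeasurable H.meas_freq)
  · refine .of_forall fun w x hx => ?_
    have hx' : ‖x‖ ≤ ‖p‖ + 1 := by
      have := norm_sub_norm_le x p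
      rw [Metric.mem_ball, dist_eq_norm] at hx
      linarith
    rw [norm_smul]
    have h2 := Real.add_one_le_exp ‖l w‖
    calc ‖h w * Complex.exp (pair3 (l w) x)‖ * ‖pair3 (l w)‖
        ≤ (‖h w‖ * Real.exp (3 * (‖p‖ + 1) * ‖l w‖)) * (3 * Real.exp ‖l w‖) := by
          gcongr
          · exact norm_mul_exp_pair3_le _ _ _ hx'
          · exact (norm_pair3_le _).trans (by linarith)
      _ = _ := by rw [add_mul, Real.exp_add, one_mul]; ring
  · exact (H.integrable _).const_mul 3
  · refine .of_forall fun w x _ => ?_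
    have := ((pair3 (l w)).hasFDerivAt (x := x)).cexp.const_mul (h w)
    rwa [smul_smul] at this

theorem ExpIntegrable.fderiv_apply {h : Ω → ℂ} {l : Ω → ℂ × ℂ × ℂ} (H : ExpIntegrable m h l)
    (p v : ℂ × ℂ × ℂ) :
    fderiv ℂ (expInt m h l) p v = expInt m (fun w => h w * pair3 (l w) v) l p := by
  rw [(H.hasFDerivAt p).fderiv, ContinuousLinearMap.integral_apply]
  · refine integral_congr_ae (.of_forall fun w => ?_)
    simp only [_root_.smul_apply, smul_eq_mul]
    ring
  · refine ((H.integrable (3 * ‖p‖ + 1)).const_mul 3).mono'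
      ((H.aestronglyMeasurable_mul_exp p).smul
        (continuous_pair3.comp_aestronglyMeasurable H.meas_freq)) (.of_forall fun w => ?_)
    have h2 := Real.add_one_le_exp ‖l w‖
    rw [norm_smul]
    calc ‖h w * Complex.exp (pair3 (l w) p)‖ * ‖pair3 (l w)‖
        ≤ (‖h w‖ * Real.exp (3 * ‖p‖ * ‖l w‖)) * (3 * Real.exp ‖l w‖) := by
          gcongr
          · exact norm_mul_exp_pair3_le _ _ _ le_rfl
          · exact (norm_pair3_le _).trans (by linarith)
      _ = _ := by rw [add_mul, Real.exp_add, one_mul]; ring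

theorem ExpIntegrable.contDiff {h : Ω → ℂ} {l : Ω → ℂ × ℂ × ℂ} (H : ExpIntegrable m h l) :
    ContDiff ℂ ∞ (expInt m h l) := by
  rw [contDiff_infty]
  intro n
  induction n generalizing h with
  | zero =>
    exact contDiff_zero.mpr
      (continuous_iff_continuousAt.mpr fun p => (H.hasFDerivAt p).continuousAt)
  | succ n ih =>
    rw [Nat.cast_succ, contDiff_succ_iff_fderiv_apply]
    refine ⟨fun p => (H.hasFDerivAt p).differentiableAt, by simp, fun v => ?_⟩
    simp_rw [H.fderiv_apply]
    exact ih (H.mul_pair3 v)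

theorem expInt_prod {Ω' : Type} [MeasurableSpace Ω'] {m' : Measure Ω'} [SFinite m] [SFinite m']
    (f : Ω → ℂ) (g : Ω' → ℂ) (l : Ω → ℂ × ℂ × ℂ) (l' : Ω' → ℂ × ℂ × ℂ) (p : ℂ × ℂ × ℂ) :
    expInt (m.prod m') (fun w => f w.1 * g w.2) (fun w => l w.1 + l' w.2) p
      = expInt m f l p * expInt m' g l' p := by
  unfold expInt
  rw [← integral_prod_mul]
  congr 1
  ext w
  rw [show pair3 (l w.1 + l' w.2) p = pair3 (l w.1) p + pair3 (l' w.2) p by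
    simp only [pair3_apply, Prod.fst_add, Prod.snd_add]; ring, Complex.exp_add]
  ring

theorem expInt_add {h h' : Ω → ℂ} {l : Ω → ℂ × ℂ × ℂ} (H : ExpIntegrable m h l)
    (H' : ExpIntegrable m h' l) (p : ℂ × ℂ × ℂ) :
    expInt m (fun w => h w + h' w) l p = expInt m h l p + expInt m h' l p := by
  unfold expInt
  rw [← integral_add (H.integrable_mul_exp p) (H'.integrable_mul_exp p)]
  simp only [add_mul]

theorem expInt_const_mul (c : ℂ) (h : Ω → ℂ) (l : Ω → ℂ × ℂ × ℂ) (p : ℂ × ℂ × ℂ) :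
    expInt m (fun w => c * h w) l p = c * expInt m h l p := by
  unfold expInt
  rw [← integral_const_mul]
  simp only [mul_assoc]

theorem ExpIntegrable.const_mul {h : Ω → ℂ} {l : Ω → ℂ × ℂ × ℂ} (H : ExpIntegrable m h l)
    (c : ℂ) : ExpIntegrable m (fun w => c * h w) l where
  meas := H.meas.const_mul c
  meas_freq := H.meas_freq
  integrable C := by simpa only [norm_mul, mul_assoc] using (H.integrable C).const_mul ‖c‖

theorem ExpIntegrable.add {h h' : Ω → ℂ} {l : Ω → ℂ × ℂ × ℂ} (H : ExpIntegrable m h l)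
    (H' : ExpIntegrable m h' l) : ExpIntegrable m (fun w => h w + h' w) l where
  meas := H.meas.add H'.meas
  meas_freq := H.meas_freq
  integrable C := by
    refine ((H.integrable C).add (H'.integrable C)).mono'
      ((H.meas.add H'.meas).norm.mul (Real.continuous_exp.comp_aestronglyMeasurable
        (H.meas_freq.norm.const_mul C))) (.of_forall fun w => ?_)
    rw [Real.norm_of_nonneg (by positivity), Pi.add_apply, ← add_mul]
    gcongr
    exact norm_add_le _ _

theorem ExpIntegrable.sub {h h' : Ω → ℂ} {l : Ω → ℂ × ℂ × ℂ} (H : ExpIntegrable m h l)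
    (H' : ExpIntegrable m h' l) : ExpIntegrable m (fun w => h w - h' w) l := by
  convert H.add (H'.const_mul (-1)) using 2
  ring

theorem ExpIntegrable.prod {Ω' : Type} [MeasurableSpace Ω'] {m' : Measure Ω'} [SFinite m]
    [SFinite m'] {f : Ω → ℂ} {g : Ω' → ℂ} {l : Ω → ℂ × ℂ × ℂ} {l' : Ω' → ℂ × ℂ × ℂ}
    (H : ExpIntegrable m f l) (H' : ExpIntegrable m' g l') :
    ExpIntegrable (m.prod m') (fun w => f w.1 * g w.2) (fun w => l w.1 + l' w.2) where
  meas := H.meas.comp_fst.mul H'.meas.comp_snd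
  meas_freq := H.meas_freq.comp_fst.add H'.meas_freq.comp_snd
  integrable C := by
    refine ((H.integrable |C|).mul_prod (H'.integrable |C|)).mono'
      ((H.meas.comp_fst.mul H'.meas.comp_snd).norm.mul
        (Real.continuous_exp.comp_aestronglyMeasurable
          ((H.meas_freq.comp_fst.add H'.meas_freq.comp_snd).norm.const_mul C)))
      (.of_forall fun w => ?_)
    rw [Real.norm_of_nonneg (by positivity), norm_mul]
    calc ‖f w.1‖ * ‖g w.2‖ * Real.exp (C * ‖l w.1 + l' w.2‖)
        ≤ ‖f w.1‖ * ‖g w.2‖ * Real.exp (|C| * (‖l w.1‖ + ‖l' w.2‖)) := by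
          gcongr
          · exact le_abs_self C
          · exact norm_add_le _ _
      _ = _ := by rw [mul_add, Real.exp_add]; ring

theorem expIntegrable_of_continuous {h : ℝ → ℂ} {l : ℝ → ℂ × ℂ × ℂ} (hh : Continuous h)
    (hl : Continuous l)
    (hb : ∀ C : ℝ, ∃ A, ∀ t, ‖h t‖ * Real.exp (C * ‖l t‖) ≤ A * Real.exp (-1 * t ^ 2)) :
    ExpIntegrable volume h l where
  meas := hh.aestronglyMeasurable
  meas_freq := hl.aestronglyMeasurable
  integrable C := by
    obtain ⟨A, hA⟩ := hb C
    refine ((integrable_exp_neg_mul_sq one_pos).const_mul A).mono'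
      (Continuous.aestronglyMeasurable (by fun_prop)) (.of_forall fun t => ?_)
    rw [Real.norm_of_nonneg (by positivity)]
    exact hA t

end ExponentialIntegrals

end

noncomputable section

/-! ### The single integrals P_i and B_j and their differential equations. -/

section PearceyIntegrals

open MeasureTheory Complex

/-- The derivative of the parametrization `gammaR`. -/
def dgammaR (t : ℝ) : ℂ := ((t / √(1 + t ^ 2) : ℝ) : ℂ) - I

theorem hasDerivAt_gammaR (t : ℝ) : HasDerivAt gammaR (dgammaR t) t := by
  have h1 : HasDerivAt (fun t : ℝ => √(1 + t ^ 2)) (t / √(1 + t ^ 2)) t := by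
    have := ((hasDerivAt_pow 2 t).const_add 1).sqrt (by positivity)
    refine this.congr_deriv ?_
    rw [Nat.cast_ofNat, show (2 - 1 : ℕ) = 1 from rfl, pow_one, mul_div_mul_left _ _ two_ne_zero]
  have h2 := (h1.ofReal_comp).fun_sub (((hasDerivAt_id t).ofReal_comp).mul_const I)
  exact h2.congr_deriv (by simp [dgammaR])

theorem continuous_gammaR : Continuous gammaR :=
  continuous_iff_continuousAt.mpr fun t => (hasDerivAt_gammaR t).continuousAt

theorem continuous_dgammaR : Continuous dgammaR := by
  unfold dgammaR
  have : ∀ t : ℝ, √(1 + t ^ 2) ≠ 0 := fun t => (Real.sqrt_pos.mpr (by positivity)).ne'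
  fun_prop (disch := assumption)

theorem gammaR_re (t : ℝ) : (gammaR t).re = √(1 + t ^ 2) := by simp [gammaR]

theorem gammaR_im (t : ℝ) : (gammaR t).im = -t := by simp [gammaR]

theorem norm_gammaR_sq (t : ℝ) : ‖gammaR t‖ ^ 2 = 1 + 2 * t ^ 2 := by
  rw [← normSq_eq_norm_sq, normSq_apply, gammaR_re, gammaR_im,
    Real.mul_self_sqrt (by positivity)]
  ring

theorem one_le_gammaR_re (t : ℝ) : 1 ≤ (gammaR t).re := by
  rw [gammaR_re]
  exact Real.one_le_sqrt.mpr (by nlinarith [sq_nonneg t])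

/-- The hyperbola is Re z² = 1, so Re z⁴ = 1 - (Im z²)²; hence the quartic decay in t. -/
theorem gammaR_pow_four_re (t : ℝ) : (gammaR t ^ 4).re = 1 - 4 * t ^ 2 * (1 + t ^ 2) := by
  have h : √(1 + t ^ 2) ^ 2 = 1 + t ^ 2 := Real.sq_sqrt (by positivity)
  have h2 : gammaR t ^ 2 = 1 - 2 * t * √(1 + t ^ 2) * I := by
    unfold gammaR
    have h' : ((√(1 + t ^ 2) : ℝ) : ℂ) ^ 2 = 1 + t ^ 2 := by exact_mod_cast h
    linear_combination h' + (t : ℂ) ^ 2 * I_sq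
  rw [show gammaR t ^ 4 = (gammaR t ^ 2) ^ 2 by ring, h2, sq (1 - 2 * (t : ℂ) * _ * I)]
  simp
  nlinarith

theorem norm_dgammaR_le (t : ℝ) : ‖dgammaR t‖ ≤ 2 := by
  have h1 : ‖((t / √(1 + t ^ 2) : ℝ) : ℂ)‖ ≤ 1 := by
    rw [norm_real, Real.norm_eq_abs, abs_div, abs_of_nonneg (Real.sqrt_nonneg _)]
    refine div_le_one_of_le₀ ?_ (Real.sqrt_nonneg _)
    exact Real.abs_le_sqrt (by linarith)
  calc ‖dgammaR t‖ ≤ ‖((t / √(1 + t ^ 2) : ℝ) : ℂ)‖ + ‖I‖ := norm_sub_le _ _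
    _ ≤ 2 := by rw [norm_I]; linarith

/-- The signs that distinguish the two branches of the contour. -/
abbrev IsSign (σ : ℂ) : Prop := σ = 1 ∨ σ = -1

theorem IsSign.norm {σ : ℂ} (h : IsSign σ) : ‖σ‖ = 1 := by
  rcases h with rfl | rfl <;> simp

theorem IsSign.sq {σ : ℂ} (h : IsSign σ) : σ ^ 2 = 1 := by
  rcases h with rfl | rfl <;> simp

/-- The frequencies for the variable `μ = σ γ_R(t)`. -/
def pFreq (σ : ℂ) (t : ℝ) : ℂ × ℂ × ℂ := (-(σ * gammaR t), 0, -(σ * gammaR t) ^ 2 / 2)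

/-- The frequencies for the variable `λ = i s`. -/
def bFreq (s : ℝ) : ℂ × ℂ × ℂ := (0, s * I, (s * I) ^ 2 / 2)

/-- The constant `1/(2πi)`. -/
def cTwoPiI : ℂ := 1 / (2 * (Real.pi : ℂ) * I)

/-- The density `e^{μ⁴/4}/(2πi)`. -/
def pDens₀ (σ : ℂ) (t : ℝ) : ℂ := cTwoPiI * exp ((σ * gammaR t) ^ 4 / 4)

/-- The density `e^{-λ⁴/4}/(2πi)`. -/
def bDens₀ (s : ℝ) : ℂ := cTwoPiI * exp (-(s * I) ^ 4 / 4)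

theorem continuous_pFreq (σ : ℂ) : Continuous (pFreq σ) := by
  have := continuous_gammaR
  unfold pFreq
  fun_prop

theorem continuous_bFreq : Continuous bFreq := by
  unfold bFreq
  fun_prop

theorem norm_pFreq_le {σ : ℂ} (hσ : IsSign σ) (t : ℝ) : ‖pFreq σ t‖ ≤ 2 + 2 * t ^ 2 := by
  have h := norm_gammaR_sq t
  have h0 := norm_nonneg (gammaR t)
  simp only [pFreq, Prod.norm_def, norm_neg, norm_mul, norm_div, norm_pow, hσ.norm, norm_zero,
    one_mul, h]
  refine max_le (by nlinarith) (max_le (by positivity) ?_)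
  norm_num
  nlinarith [sq_nonneg t]

theorem norm_bFreq_le (s : ℝ) : ‖bFreq s‖ ≤ 1 + s ^ 2 := by
  simp only [bFreq, Prod.norm_def, norm_mul, norm_div, norm_pow, norm_zero, norm_I, mul_one,
    norm_real, Real.norm_eq_abs, sq_abs]
  refine max_le (by positivity) (max_le ?_ ?_)
  · nlinarith [sq_abs s, sq_nonneg (|s| - 1)]
  · norm_num
    nlinarith [sq_nonneg s]

/-- Frequencies grow like t² while the density decays like e^{-t⁴-t²}. Completing the square in t²
absorbs any exponential of the frequency and leaves a Gaussian. -/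
theorem expIntegrable_pDens₀ {σ : ℂ} (hσ : IsSign σ) : ExpIntegrable volume (pDens₀ σ) (pFreq σ) := by
  refine expIntegrable_of_continuous ?_ (continuous_pFreq σ) fun C => ?_
  · have := continuous_gammaR
    unfold pDens₀
    fun_prop
  · refine ⟨‖cTwoPiI‖ * Real.exp (1 / 4 + 2 * |C| + |C| ^ 2), fun t => ?_⟩
    have h4 : σ ^ 4 = 1 := by rw [show σ ^ 4 = (σ ^ 2) ^ 2 by ring, hσ.sq, one_pow]
    have hre : (gammaR t ^ 4 / 4).re = (gammaR t ^ 4).re / 4 := by simp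
    rw [pDens₀, norm_mul, norm_exp, mul_assoc, mul_assoc, ← Real.exp_add, ← Real.exp_add, mul_pow,
      h4, one_mul, hre, gammaR_pow_four_re]
    refine mul_le_mul_of_nonneg_left (Real.exp_le_exp.mpr ?_) (norm_nonneg _)
    have h1 : C * ‖pFreq σ t‖ ≤ |C| * (2 + 2 * t ^ 2) :=
      mul_le_mul (le_abs_self C) (norm_pFreq_le hσ t) (norm_nonneg _) (abs_nonneg C)
    nlinarith [sq_nonneg (t ^ 2 - |C|)]

theorem expIntegrable_bDens₀ : ExpIntegrable volume bDens₀ bFreq := by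
  refine expIntegrable_of_continuous ?_ continuous_bFreq fun C => ?_
  · unfold bDens₀
    fun_prop
  · refine ⟨‖cTwoPiI‖ * Real.exp (|C| + (|C| + 1) ^ 2), fun s => ?_⟩
    have h4 : (-(s * I) ^ 4 / 4 : ℂ) = ((-s ^ 4 / 4 : ℝ) : ℂ) := by
      rw [mul_pow, I_pow_four]
      push_cast
      ring
    rw [bDens₀, norm_mul, norm_exp, mul_assoc, mul_assoc, ← Real.exp_add, ← Real.exp_add, h4,
      ofReal_re]
    refine mul_le_mul_of_nonneg_left (Real.exp_le_exp.mpr ?_) (norm_nonneg _)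
    have h1 : C * ‖bFreq s‖ ≤ |C| * (1 + s ^ 2) :=
      mul_le_mul (le_abs_self C) (norm_bFreq_le s) (norm_nonneg _) (abs_nonneg C)
    nlinarith [sq_nonneg (s ^ 2 / 2 - (|C| + 1))]

/-- The density of `P_i`. -/
def pDens (σ : ℂ) (i : ℕ) (t : ℝ) : ℂ := pDens₀ σ t * (σ * dgammaR t) * (-(σ * gammaR t)) ^ i

/-- The density of `B_j`. -/
def bDens (j : ℕ) (s : ℝ) : ℂ := bDens₀ s * I * (s * I) ^ j

theorem expIntegrable_pDens {σ : ℂ} (hσ : IsSign σ) (i : ℕ) :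
    ExpIntegrable volume (pDens σ i) (pFreq σ) := by
  induction i with
  | zero =>
    have h := (expIntegrable_pDens₀ hσ).mul_bounded (g := fun t => σ * dgammaR t)
      (continuous_const.mul continuous_dgammaR).aestronglyMeasurable 2 0 fun t => by
        simpa [hσ.norm] using norm_dgammaR_le t
    convert h using 2
    simp [pDens]
  | succ i ih =>
    convert ih.mul_pair3 (1, 0, 0) using 2
    simp [pDens, pair3_apply, pFreq, pow_succ, mul_assoc]

theorem expIntegrable_bDens (j : ℕ) : ExpIntegrable volume (bDens j) bFreq := by
  induction j with
  | zero =>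
    have h := expIntegrable_bDens₀.const_mul I
    convert h using 2
    simp [bDens, mul_comm]
  | succ i ih =>
    convert ih.mul_pair3 (0, 1, 0) using 2
    simp [bDens, pair3_apply, bFreq, pow_succ, mul_assoc]

/-- The function `P_i(x, τ) = (2πi)⁻¹ ∫ (-μ)^i e^{Θ_x(μ)} dμ` for one branch of the contour. -/
def pInt (σ : ℂ) (i : ℕ) : ℂ × ℂ × ℂ → ℂ := expInt volume (pDens σ i) (pFreq σ)

/-- The function `B_j(y, τ) = (2πi)⁻¹ ∫ λ^j e^{-Θ_y(λ)} dλ`. -/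
def bInt (j : ℕ) : ℂ × ℂ × ℂ → ℂ := expInt volume (bDens j) bFreq

theorem expInt_sub {Ω : Type} [MeasurableSpace Ω] {m : Measure Ω} {h h' : Ω → ℂ}
    {l : Ω → ℂ × ℂ × ℂ} (H : ExpIntegrable m h l)
    (H' : ExpIntegrable m h' l) (p : ℂ × ℂ × ℂ) :
    expInt m (fun w => h w - h' w) l p = expInt m h l p - expInt m h' l p := by
  unfold expInt
  rw [← integral_sub (H.integrable_mul_exp p) (H'.integrable_mul_exp p)]
  simp only [sub_mul]

/-- The direction (0, 0, 2) is 2∂_τ, chosen to remove the factor 1/2 in front of τμ². -/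
theorem fderiv_pInt {σ : ℂ} (hσ : IsSign σ) (i : ℕ) (p : ℂ × ℂ × ℂ) :
    fderiv ℂ (pInt σ i) p (1, 0, 0) = pInt σ (i + 1) p ∧
    fderiv ℂ (pInt σ i) p (0, 1, 0) = 0 ∧
    fderiv ℂ (pInt σ i) p (0, 0, 2) = -pInt σ (i + 2) p := by
  unfold pInt
  simp only [(expIntegrable_pDens hσ i).fderiv_apply]
  refine ⟨?_, ?_, ?_⟩
  · congr 1
    ext t
    simp [pDens, pair3_apply, pFreq, pow_succ, mul_assoc]
  · simp [pair3_apply, pFreq, expInt]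
  · rw [show -expInt volume (pDens σ (i + 2)) (pFreq σ) p
      = -1 * expInt volume (pDens σ (i + 2)) (pFreq σ) p by ring, ← expInt_const_mul]
    congr 1
    ext t
    simp only [pDens, pair3_apply, pFreq]
    ring

theorem fderiv_bInt (j : ℕ) (p : ℂ × ℂ × ℂ) :
    fderiv ℂ (bInt j) p (1, 0, 0) = 0 ∧
    fderiv ℂ (bInt j) p (0, 1, 0) = bInt (j + 1) p ∧
    fderiv ℂ (bInt j) p (0, 0, 2) = bInt (j + 2) p := by
  unfold bInt
  simp only [(expIntegrable_bDens j).fderiv_apply]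
  refine ⟨?_, ?_, ?_⟩
  · simp [pair3_apply, bFreq, expInt]
  · congr 1
    ext t
    simp [bDens, pair3_apply, bFreq, pow_succ, mul_assoc]
  · congr 1
    ext t
    simp only [bDens, pair3_apply, bFreq]
    ring

theorem hasDerivAt_mu (σ : ℂ) (t : ℝ) :
    HasDerivAt (fun t => σ * gammaR t) (σ * dgammaR t) t :=
  (hasDerivAt_gammaR t).const_mul σ

theorem hasDerivAt_lam (s : ℝ) : HasDerivAt (fun s : ℝ => (s : ℂ) * I) I s := by
  simpa using ((hasDerivAt_id s).ofReal_comp).mul_const I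

/-- Along the contour the exponential e^{Θ_x(μ)} produces Θ_x'(μ) = μ³ - τμ - x. The integral of
this exact derivative vanishes, which is `pInt_ode`. -/
theorem hasDerivAt_pDens₀_mul_exp (σ : ℂ) (p : ℂ × ℂ × ℂ) (t : ℝ) :
    HasDerivAt (fun t => pDens₀ σ t * exp (pair3 (pFreq σ t) p))
      ((p.2.2 * pDens σ 1 t - pDens σ 3 t - p.1 * pDens σ 0 t) * exp (pair3 (pFreq σ t) p)) t := by
  have hmu := hasDerivAt_mu σ t
  have h1 := ((hmu.fun_pow 4).div_const 4).cexp.const_mul cTwoPiI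
  have h2 := ((hmu.fun_neg.mul_const p.1).fun_add (((hmu.fun_pow 2).fun_neg.div_const 2).mul_const p.2.2)).cexp
  have h3 := h1.fun_mul h2
  have e : (fun t => pDens₀ σ t * exp (pair3 (pFreq σ t) p)) = fun t =>
      cTwoPiI * exp ((σ * gammaR t) ^ 4 / 4) *
        exp (-(σ * gammaR t) * p.1 + -(σ * gammaR t) ^ 2 / 2 * p.2.2) := by
    ext t
    simp [pDens₀, pair3_apply, pFreq]
  rw [e]
  refine h3.congr_deriv ?_
  simp only [pDens, pDens₀, pair3_apply, pFreq, zero_mul, add_zero]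
  push_cast
  ring

theorem pInt_ode {σ : ℂ} (hσ : IsSign σ) (p : ℂ × ℂ × ℂ) :
    p.1 * pInt σ 0 p = p.2.2 * pInt σ 1 p - pInt σ 3 p := by
  have H1 := (expIntegrable_pDens hσ 1).const_mul p.2.2
  have H3 := expIntegrable_pDens hσ 3
  have H0 := (expIntegrable_pDens hσ 0).const_mul p.1
  have H13 := H1.add (H3.const_mul (-1))
  have H := H13.add (H0.const_mul (-1))
  have hz := integral_eq_zero_of_hasDerivAt_of_integrable (hasDerivAt_pDens₀_mul_exp σ p)
    ((H.integrable_mul_exp p).congr (.of_forall fun t => by ring))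
    ((expIntegrable_pDens₀ hσ).integrable_mul_exp p)
  have hs : expInt volume (fun t => p.2.2 * pDens σ 1 t + -1 * pDens σ 3 t
      + -1 * (p.1 * pDens σ 0 t)) (pFreq σ) p = 0 := by
    rw [← hz]
    refine integral_congr_ae (.of_forall fun t => ?_)
    simp only
    ring
  rw [expInt_add H13 (H0.const_mul (-1)), expInt_add H1 (H3.const_mul (-1))] at hs
  simp only [expInt_const_mul] at hs
  unfold pInt
  linear_combination -hs

theorem hasDerivAt_bDens₀_mul_exp (p : ℂ × ℂ × ℂ) (s : ℝ) :
    HasDerivAt (fun s => bDens₀ s * exp (pair3 (bFreq s) p))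
      ((p.2.2 * bDens 1 s - bDens 3 s + p.2.1 * bDens 0 s) * exp (pair3 (bFreq s) p)) s := by
  have hmu := hasDerivAt_lam s
  have h1 := ((hmu.fun_pow 4).fun_neg.div_const 4).cexp.const_mul cTwoPiI
  have h2 := ((hmu.mul_const p.2.1).fun_add (((hmu.fun_pow 2).div_const 2).mul_const p.2.2)).cexp
  have h3 := h1.fun_mul h2
  have e : (fun s => bDens₀ s * exp (pair3 (bFreq s) p)) = fun s : ℝ =>
      cTwoPiI * exp (-(s * I) ^ 4 / 4) *
        exp ((s * I) * p.2.1 + (s * I) ^ 2 / 2 * p.2.2) := by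
    ext t
    simp [bDens₀, pair3_apply, bFreq]
  rw [e]
  refine h3.congr_deriv ?_
  simp only [bDens, bDens₀, pair3_apply, bFreq, zero_mul, zero_add]
  push_cast
  ring

theorem bInt_ode (p : ℂ × ℂ × ℂ) :
    p.2.1 * bInt 0 p = bInt 3 p - p.2.2 * bInt 1 p := by
  have H1 := (expIntegrable_bDens 1).const_mul p.2.2
  have H3 := expIntegrable_bDens 3
  have H0 := (expIntegrable_bDens 0).const_mul p.2.1
  have H13 := H1.add (H3.const_mul (-1))
  have H := H13.add H0
  have hz := integral_eq_zero_of_hasDerivAt_of_integrable (hasDerivAt_bDens₀_mul_exp p)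
    ((H.integrable_mul_exp p).congr (.of_forall fun t => by ring))
    (expIntegrable_bDens₀.integrable_mul_exp p)
  have hs : expInt volume (fun t => p.2.2 * bDens 1 t + -1 * bDens 3 t
      + p.2.1 * bDens 0 t) bFreq p = 0 := by
    rw [← hz]
    refine integral_congr_ae (.of_forall fun t => ?_)
    simp only
    ring
  rw [expInt_add H13 H0, expInt_add H1 (H3.const_mul (-1))] at hs
  simp only [expInt_const_mul] at hs
  unfold bInt
  linear_combination hs

end PearceyIntegrals

end

noncomputable section

/-! ### One branch of the kernel and its finite-rank identities. -/

section PearceyKernelIntegral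

open MeasureTheory Complex

/-- The frequencies for the pair `(μ, λ)`. -/
def kFreq (σ : ℂ) (w : ℝ × ℝ) : ℂ × ℂ × ℂ := pFreq σ w.1 + bFreq w.2

/-- The Cauchy kernel `1/(λ - μ)`. -/
def cauchyKer (σ : ℂ) (w : ℝ × ℝ) : ℂ := (w.2 * I - σ * gammaR w.1)⁻¹

/-- The contours stay at distance at least 1 from each other, so the Cauchy kernel is bounded by 1
and harmless for integrability. -/
theorem lam_sub_mu_re {σ : ℂ} (hσ : IsSign σ) (t s : ℝ) :
    1 ≤ |((s : ℂ) * I - σ * gammaR t).re| := by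
  have h := one_le_gammaR_re t
  rcases hσ with rfl | rfl
  · simp only [one_mul, sub_re, mul_I_re, ofReal_im, neg_zero, zero_sub, abs_neg]
    exact h.trans (le_abs_self _)
  · simp only [neg_mul, one_mul, sub_re, mul_I_re, ofReal_im, neg_zero, neg_re, zero_sub, neg_neg]
    exact h.trans (le_abs_self _)

theorem lam_sub_mu_ne {σ : ℂ} (hσ : IsSign σ) (t s : ℝ) : (s : ℂ) * I - σ * gammaR t ≠ 0 := by
  intro h
  have := lam_sub_mu_re hσ t s
  rw [h] at this
  norm_num at this

theorem norm_cauchyKer_le {σ : ℂ} (hσ : IsSign σ) (w : ℝ × ℝ) : ‖cauchyKer σ w‖ ≤ 1 := by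
  rw [cauchyKer, norm_inv]
  exact inv_le_one_of_one_le₀ ((lam_sub_mu_re hσ w.1 w.2).trans (abs_re_le_norm _))

theorem continuous_cauchyKer {σ : ℂ} (hσ : IsSign σ) : Continuous (cauchyKer σ) := by
  have h := continuous_gammaR
  unfold cauchyKer
  refine Continuous.inv₀ (by fun_prop) fun w => lam_sub_mu_ne hσ w.1 w.2

theorem ExpIntegrable.mul_cauchyKer {σ : ℂ} (hσ : IsSign σ) {m : Measure (ℝ × ℝ)} {h : ℝ × ℝ → ℂ}
    {l : ℝ × ℝ → ℂ × ℂ × ℂ} (H : ExpIntegrable m h l) :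
    ExpIntegrable m (fun w => h w * cauchyKer σ w) l :=
  H.mul_bounded (continuous_cauchyKer hσ).aestronglyMeasurable 1 0 fun w => by
    simpa using norm_cauchyKer_le hσ w

theorem cauchyKer_mul {σ : ℂ} (hσ : IsSign σ) (w : ℝ × ℝ) :
    cauchyKer σ w * (w.2 * I - σ * gammaR w.1) = 1 :=
  inv_mul_cancel₀ (lam_sub_mu_ne hσ w.1 w.2)

theorem expIntegrable_pDens_mul_bDens {σ : ℂ} (hσ : IsSign σ) (i j : ℕ) :
    ExpIntegrable (volume.prod volume) (fun w : ℝ × ℝ => pDens σ i w.1 * bDens j w.2) (kFreq σ) :=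
  (expIntegrable_pDens hσ i).prod (expIntegrable_bDens j)

/-- The density of the Pearcey kernel. -/
def kDens (σ : ℂ) (w : ℝ × ℝ) : ℂ := pDens σ 0 w.1 * bDens 0 w.2 * cauchyKer σ w

theorem expIntegrable_kDens {σ : ℂ} (hσ : IsSign σ) :
    ExpIntegrable (volume.prod volume) (kDens σ) (kFreq σ) :=
  (expIntegrable_pDens_mul_bDens hσ 0 0).mul_cauchyKer hσ

/-- One branch of the Pearcey kernel, as an entire function of `(x, y, τ)`. -/
def kInt (σ : ℂ) : ℂ × ℂ × ℂ → ℂ := expInt (volume.prod volume) (kDens σ) (kFreq σ)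

theorem expInt_pDens_mul_bDens (σ : ℂ) (i j : ℕ) (p : ℂ × ℂ × ℂ) :
    expInt (volume.prod volume) (fun w : ℝ × ℝ => pDens σ i w.1 * bDens j w.2) (kFreq σ) p
      = pInt σ i p * bInt j p :=
  expInt_prod _ _ _ _ _

theorem pair3_kFreq (σ : ℂ) (w : ℝ × ℝ) (p : ℂ × ℂ × ℂ) :
    pair3 (kFreq σ w) p = pair3 (pFreq σ w.1) p + pair3 (bFreq w.2) p := by
  simp only [kFreq, pair3_apply, Prod.fst_add, Prod.snd_add]
  ring

/-- The factor λ - μ brought down by the translation cancels the Cauchy kernel, and the double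
integral splits. -/
theorem fderiv_kInt_translation {σ : ℂ} (hσ : IsSign σ) (p : ℂ × ℂ × ℂ) :
    fderiv ℂ (kInt σ) p (1, 1, 0) = pInt σ 0 p * bInt 0 p := by
  rw [kInt, (expIntegrable_kDens hσ).fderiv_apply, ← expInt_pDens_mul_bDens]
  congr 1
  ext w
  have h := cauchyKer_mul hσ w
  rw [pair3_kFreq]
  simp only [kDens, pair3_apply, pFreq, bFreq]
  linear_combination (pDens σ 0 w.1 * bDens 0 w.2) * h

/-- The factor brought down is λ² - μ² = (λ - μ)(λ + μ). -/
theorem fderiv_kInt_tau {σ : ℂ} (hσ : IsSign σ) (p : ℂ × ℂ × ℂ) :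
    fderiv ℂ (kInt σ) p (0, 0, 2) = pInt σ 0 p * bInt 1 p - pInt σ 1 p * bInt 0 p := by
  rw [kInt, (expIntegrable_kDens hσ).fderiv_apply, ← expInt_pDens_mul_bDens,
    ← expInt_pDens_mul_bDens, ← expInt_sub (expIntegrable_pDens_mul_bDens hσ 0 1)
      (expIntegrable_pDens_mul_bDens hσ 1 0)]
  congr 1
  ext w
  have h := cauchyKer_mul hσ w
  rw [pair3_kFreq]
  simp only [kDens, pair3_apply, pFreq, bFreq]
  have e1 : pDens σ 1 w.1 = pDens σ 0 w.1 * -(σ * gammaR w.1) := by simp [pDens]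
  have e2 : bDens 1 w.2 = bDens 0 w.2 * (w.2 * I) := by simp [bDens]
  rw [e1, e2]
  linear_combination (pDens σ 0 w.1 * bDens 0 w.2) * (w.2 * I + σ * gammaR w.1) * h

theorem integral_prod_eq_zero_of_hasDerivAt_fst {F F' : ℝ × ℝ → ℂ}
    (hd : ∀ s t, HasDerivAt (fun t => F (t, s)) (F' (t, s)) t)
    (hF' : Integrable F' (volume.prod volume)) (hF : Integrable F (volume.prod volume)) :
    ∫ w, F' w ∂(volume.prod volume) = 0 := by
  rw [integral_prod_symm _ hF']
  refine integral_eq_zero_of_ae ?_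
  filter_upwards [hF'.prod_left_ae, hF.prod_left_ae] with s h1 h2
  exact integral_eq_zero_of_hasDerivAt_of_integrable (hd s) h1 h2

theorem integral_prod_eq_zero_of_hasDerivAt_snd {F F' : ℝ × ℝ → ℂ}
    (hd : ∀ t s, HasDerivAt (fun s => F (t, s)) (F' (t, s)) s)
    (hF' : Integrable F' (volume.prod volume)) (hF : Integrable F (volume.prod volume)) :
    ∫ w, F' w ∂(volume.prod volume) = 0 := by
  rw [integral_prod _ hF']
  refine integral_eq_zero_of_ae ?_
  filter_upwards [hF'.prod_right_ae, hF.prod_right_ae] with s h1 h2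
  exact integral_eq_zero_of_hasDerivAt_of_integrable (hd s) h1 h2

/-- Integrate ∂_μ + ∂_λ of e^{Θ_x(μ)-Θ_y(λ)}/(λ - μ). The double poles cancel, and what remains is
(μ³ - λ³) - τ(μ - λ) - (x - y) over λ - μ, in which all but the last difference is divisible by λ -
μ. -/
theorem kInt_sub_mul {σ : ℂ} (hσ : IsSign σ) (p : ℂ × ℂ × ℂ) :
    (p.1 - p.2.1) * kInt σ p = p.2.2 * (pInt σ 0 p * bInt 0 p)
      - (pInt σ 2 p * bInt 0 p - pInt σ 1 p * bInt 1 p + pInt σ 0 p * bInt 2 p) := by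
  have HR : ∀ i j, ExpIntegrable (volume.prod volume)
      (fun w : ℝ × ℝ => pDens σ i w.1 * bDens j w.2 * cauchyKer σ w) (kFreq σ) := fun i j =>
    (expIntegrable_pDens_mul_bDens hσ i j).mul_cauchyKer hσ
  have HRR := (HR 0 0).mul_cauchyKer hσ
  have Hq : ExpIntegrable (volume.prod volume)
      (fun w : ℝ × ℝ => pDens₀ σ w.1 * bDens 0 w.2 * cauchyKer σ w) (kFreq σ) :=
    ((expIntegrable_pDens₀ hσ).prod (expIntegrable_bDens 0)).mul_cauchyKer hσ
  have Hr : ExpIntegrable (volume.prod volume)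
      (fun w : ℝ × ℝ => pDens σ 0 w.1 * bDens₀ w.2 * cauchyKer σ w) (kFreq σ) :=
    ((expIntegrable_pDens hσ 0).prod expIntegrable_bDens₀).mul_cauchyKer hσ
  have Hf1 := ((((HR 1 0).const_mul p.2.2).add ((HR 3 0).const_mul (-1))).add
    ((HR 0 0).const_mul (-p.1))).add HRR
  have Hf2 := ((((HR 0 1).const_mul p.2.2).add ((HR 0 3).const_mul (-1))).add
    ((HR 0 0).const_mul p.2.1)).add (HRR.const_mul (-1))
  have hz1 := integral_prod_eq_zero_of_hasDerivAt_fst (fun s t => by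
    have h1 := hasDerivAt_pDens₀_mul_exp σ p t
    have h2 := (((hasDerivAt_mu σ t).const_sub ((s : ℂ) * I)).fun_inv (lam_sub_mu_ne hσ t s))
    have h3 := (h1.fun_mul h2).mul_const (bDens 0 s * exp (pair3 (bFreq s) p))
    have e : (fun t => (fun w : ℝ × ℝ => pDens₀ σ w.1 * bDens 0 w.2 * cauchyKer σ w
        * exp (pair3 (kFreq σ w) p)) (t, s)) = fun t => pDens₀ σ t * exp (pair3 (pFreq σ t) p) *
        ((s : ℂ) * I - σ * gammaR t)⁻¹ * (bDens 0 s * exp (pair3 (bFreq s) p)) := by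
      ext t
      simp only [pair3_kFreq, exp_add, cauchyKer]
      ring
    rw [e]
    refine h3.congr_deriv (g' := (fun w => ((((p.2.2 * (pDens σ 1 w.1 * bDens 0 w.2 * cauchyKer σ w)
      + -1 * (pDens σ 3 w.1 * bDens 0 w.2 * cauchyKer σ w))
      + -p.1 * (pDens σ 0 w.1 * bDens 0 w.2 * cauchyKer σ w))
      + pDens σ 0 w.1 * bDens 0 w.2 * cauchyKer σ w * cauchyKer σ w))
      * exp (pair3 (kFreq σ w) p)) (t, s)) ?_
    have e0 : pDens σ 0 t = pDens₀ σ t * (σ * dgammaR t) := by simp [pDens]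
    simp only [pair3_kFreq, exp_add, cauchyKer, e0]
    generalize (s : ℂ) * I - σ * gammaR t = d
    rw [div_eq_mul_inv, ← inv_pow]
    ring) (Hf1.integrable_mul_exp p) (Hq.integrable_mul_exp p)
  have hz2 := integral_prod_eq_zero_of_hasDerivAt_snd (fun t s => by
    have h1 := hasDerivAt_bDens₀_mul_exp p s
    have h2 := (((hasDerivAt_lam s).sub_const (σ * gammaR t)).fun_inv (lam_sub_mu_ne hσ t s))
    have h3 := (h1.fun_mul h2).mul_const (pDens σ 0 t * exp (pair3 (pFreq σ t) p))
    have e : (fun s => (fun w : ℝ × ℝ => pDens σ 0 w.1 * bDens₀ w.2 * cauchyKer σ w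
        * exp (pair3 (kFreq σ w) p)) (t, s)) = fun s : ℝ => bDens₀ s * exp (pair3 (bFreq s) p) *
        ((s : ℂ) * I - σ * gammaR t)⁻¹ * (pDens σ 0 t * exp (pair3 (pFreq σ t) p)) := by
      ext s
      simp only [pair3_kFreq, exp_add, cauchyKer]
      ring
    rw [e]
    refine h3.congr_deriv (g' := (fun w => ((((p.2.2 * (pDens σ 0 w.1 * bDens 1 w.2 * cauchyKer σ w)
      + -1 * (pDens σ 0 w.1 * bDens 3 w.2 * cauchyKer σ w))
      + p.2.1 * (pDens σ 0 w.1 * bDens 0 w.2 * cauchyKer σ w))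
      + -1 * (pDens σ 0 w.1 * bDens 0 w.2 * cauchyKer σ w * cauchyKer σ w)))
      * exp (pair3 (kFreq σ w) p)) (t, s)) ?_
    have e0 : bDens 0 s = bDens₀ s * I := by simp [bDens]
    simp only [pair3_kFreq, exp_add, cauchyKer, e0]
    generalize (s : ℂ) * I - σ * gammaR t = d
    rw [div_eq_mul_inv, ← inv_pow]
    ring) (Hf2.integrable_mul_exp p) (Hr.integrable_mul_exp p)
  have hz := congrArg₂ (· + ·) hz1 hz2
  simp only [add_zero] at hz
  rw [← integral_add (Hf1.integrable_mul_exp p) (Hf2.integrable_mul_exp p)] at hz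
  have HP := expIntegrable_pDens_mul_bDens hσ
  have hs : expInt (volume.prod volume) (fun w : ℝ × ℝ =>
      ((p.2.2 * (pDens σ 0 w.1 * bDens 0 w.2) - pDens σ 2 w.1 * bDens 0 w.2)
        + pDens σ 1 w.1 * bDens 1 w.2 - pDens σ 0 w.1 * bDens 2 w.2)
        - (p.1 - p.2.1) * kDens σ w) (kFreq σ) p = 0 := by
    rw [← hz]
    refine integral_congr_ae (.of_forall fun w => ?_)
    have h := cauchyKer_mul hσ w
    have e1 : pDens σ 1 w.1 = pDens σ 0 w.1 * -(σ * gammaR w.1) := by simp [pDens]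
    have e2 : pDens σ 2 w.1 = pDens σ 0 w.1 * (σ * gammaR w.1) ^ 2 := by simp [pDens]
    have e3 : pDens σ 3 w.1 = pDens σ 0 w.1 * -(σ * gammaR w.1) ^ 3 := by simp [pDens]; ring
    have f1 : bDens 1 w.2 = bDens 0 w.2 * (w.2 * I) := by simp [bDens]
    have f2 : bDens 2 w.2 = bDens 0 w.2 * (w.2 * I) ^ 2 := by simp [bDens]
    have f3 : bDens 3 w.2 = bDens 0 w.2 * (w.2 * I) ^ 3 := by simp [bDens]
    simp only [kDens, e1, e2, e3, f1, f2, f3]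
    generalize pDens σ 0 w.1 = P
    generalize bDens 0 w.2 = B
    generalize σ * gammaR w.1 = u at *
    generalize (w.2 : ℂ) * I = v at *
    linear_combination (-(P * B) * (p.2.2 - (u ^ 2 + u * v + v ^ 2))
      * exp (pair3 (kFreq σ w) p)) * h
  rw [expInt_sub ((((((HP 0 0).const_mul p.2.2).sub (HP 2 0)).add (HP 1 1)).sub (HP 0 2)))
      ((expIntegrable_kDens hσ).const_mul _),
    expInt_sub (((((HP 0 0).const_mul p.2.2).sub (HP 2 0)).add (HP 1 1))) (HP 0 2),
    expInt_add ((((HP 0 0).const_mul p.2.2).sub (HP 2 0))) (HP 1 1),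
    expInt_sub ((HP 0 0).const_mul p.2.2) (HP 2 0), expInt_const_mul, expInt_const_mul] at hs
  simp only [expInt_pDens_mul_bDens] at hs
  unfold kInt
  linear_combination -hs

end PearceyKernelIntegral

end

noncomputable section

/-! ### Both branches together: the kernel as an entire function. -/

section PearceyKernelTotal

open MeasureTheory Complex

theorem contDiff_pInt {σ : ℂ} (hσ : IsSign σ) (i : ℕ) : ContDiff ℂ ∞ (pInt σ i) :=
  (expIntegrable_pDens hσ i).contDiff

theorem contDiff_bInt (j : ℕ) : ContDiff ℂ ∞ (bInt j) :=
  (expIntegrable_bDens j).contDiff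

theorem contDiff_kInt {σ : ℂ} (hσ : IsSign σ) : ContDiff ℂ ∞ (kInt σ) :=
  (expIntegrable_kDens hσ).contDiff

/-- The function `P_i` for the whole contour. -/
def pTot (i : ℕ) (p : ℂ × ℂ × ℂ) : ℂ := pInt 1 i p + pInt (-1) i p

/-- The Pearcey kernel as an entire function of `(x, y, τ)`. -/
def kTot (p : ℂ × ℂ × ℂ) : ℂ := kInt 1 p + kInt (-1) p

theorem isSign_one : IsSign 1 := Or.inl rfl

theorem isSign_neg_one : IsSign (-1) := Or.inr rfl

theorem contDiff_pTot (i : ℕ) : ContDiff ℂ ∞ (pTot i) :=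
  (contDiff_pInt isSign_one i).add (contDiff_pInt isSign_neg_one i)

theorem contDiff_kTot : ContDiff ℂ ∞ kTot :=
  (contDiff_kInt isSign_one).add (contDiff_kInt isSign_neg_one)

theorem fderiv_pTot_apply (i : ℕ) (p v : ℂ × ℂ × ℂ) :
    fderiv ℂ (pTot i) p v = fderiv ℂ (pInt 1 i) p v + fderiv ℂ (pInt (-1) i) p v := by
  rw [show pTot i = pInt 1 i + pInt (-1) i from rfl,
    fderiv_add ((contDiff_pInt isSign_one i).differentiable (by simp) p)
      ((contDiff_pInt isSign_neg_one i).differentiable (by simp) p)]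
  rfl

theorem fderiv_kTot_apply (p v : ℂ × ℂ × ℂ) :
    fderiv ℂ kTot p v = fderiv ℂ (kInt 1) p v + fderiv ℂ (kInt (-1)) p v := by
  rw [show kTot = kInt 1 + kInt (-1) from rfl,
    fderiv_add ((contDiff_kInt isSign_one).differentiable (by simp) p)
      ((contDiff_kInt isSign_neg_one).differentiable (by simp) p)]
  rfl

theorem fderiv_pTot (i : ℕ) (p : ℂ × ℂ × ℂ) :
    fderiv ℂ (pTot i) p (1, 0, 0) = pTot (i + 1) p ∧
    fderiv ℂ (pTot i) p (0, 1, 0) = 0 ∧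
    fderiv ℂ (pTot i) p (0, 0, 2) = -pTot (i + 2) p := by
  obtain ⟨h1, h2, h3⟩ := fderiv_pInt isSign_one i p
  obtain ⟨k1, k2, k3⟩ := fderiv_pInt isSign_neg_one i p
  simp only [fderiv_pTot_apply, h1, h2, h3, k1, k2, k3, pTot]
  exact ⟨trivial, by simp, by ring⟩

theorem pTot_ode (p : ℂ × ℂ × ℂ) : p.1 * pTot 0 p = p.2.2 * pTot 1 p - pTot 3 p := by
  simp only [pTot]
  linear_combination pInt_ode isSign_one p + pInt_ode isSign_neg_one p

theorem kTot_sub_mul (p : ℂ × ℂ × ℂ) :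
    (p.1 - p.2.1) * kTot p = p.2.2 * (pTot 0 p * bInt 0 p)
      - (pTot 2 p * bInt 0 p - pTot 1 p * bInt 1 p + pTot 0 p * bInt 2 p) := by
  simp only [pTot, kTot]
  linear_combination kInt_sub_mul isSign_one p + kInt_sub_mul isSign_neg_one p

theorem fderiv_kTot_translation (p : ℂ × ℂ × ℂ) :
    fderiv ℂ kTot p (1, 1, 0) = pTot 0 p * bInt 0 p := by
  rw [fderiv_kTot_apply, fderiv_kInt_translation isSign_one, fderiv_kInt_translation isSign_neg_one,
    pTot]
  ring

theorem fderiv_kTot_tau (p : ℂ × ℂ × ℂ) :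
    fderiv ℂ kTot p (0, 0, 2) = pTot 0 p * bInt 1 p - pTot 1 p * bInt 0 p := by
  rw [fderiv_kTot_apply, fderiv_kInt_tau isSign_one, fderiv_kInt_tau isSign_neg_one, pTot, pTot]
  ring

/-- Differentiating `kTot_sub_mul` in x gives K + (x - y)∂_x K, and x∂_x + y∂_y = (x - y)∂_x + y(∂_x
+ ∂_y). The product y p_0 b_0 that appears is removed by `bInt_ode`. The summand K is what the
dilation of the weight b - a contributes later. -/
theorem kTot_add_fderiv_euler (p : ℂ × ℂ × ℂ) :
    kTot p + fderiv ℂ kTot p (p.1, p.2.1, 0)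
      = -(pTot 3 p * bInt 0 p) + pTot 2 p * bInt 1 p - pTot 1 p * bInt 2 p + pTot 0 p * bInt 3 p
        - p.2.2 * (pTot 0 p * bInt 1 p - pTot 1 p * bInt 0 p) := by
  have hP : ∀ i, HasFDerivAt (pTot i) (fderiv ℂ (pTot i) p) p := fun i =>
    ((contDiff_pTot i).differentiable (by simp) p).hasFDerivAt
  have hB : ∀ i, HasFDerivAt (bInt i) (fderiv ℂ (bInt i) p) p := fun i =>
    ((contDiff_bInt i).differentiable (by simp) p).hasFDerivAt
  have hK : HasFDerivAt kTot (fderiv ℂ kTot p) p :=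
    (contDiff_kTot.differentiable (by simp) p).hasFDerivAt
  have h1 : HasFDerivAt (fun q : ℂ × ℂ × ℂ => q.1) (ContinuousLinearMap.fst ℂ ℂ (ℂ × ℂ)) p :=
    hasFDerivAt_fst
  have h23 : HasFDerivAt (fun q : ℂ × ℂ × ℂ => q.2) (ContinuousLinearMap.snd ℂ ℂ (ℂ × ℂ)) p :=
    hasFDerivAt_snd
  have h2 := h23.fst
  have h3 := h23.snd
  have hl := (h1.fun_sub h2).fun_mul hK
  have hr := (h3.fun_mul ((hP 0).fun_mul (hB 0))).fun_sub
    ((((hP 2).fun_mul (hB 0)).fun_sub ((hP 1).fun_mul (hB 1))).fun_add ((hP 0).fun_mul (hB 2)))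
  have he := congrArg (fun L => L (1, 0, 0)) ((hl.congr_of_eventuallyEq
    (.of_forall fun q => (kTot_sub_mul q).symm)).unique hr)
  have hT := fderiv_kTot_translation p
  have hode := bInt_ode p
  have e1 : fderiv ℂ kTot p (p.1, p.2.1, 0)
      = (p.1 - p.2.1) * fderiv ℂ kTot p (1, 0, 0) + p.2.1 * fderiv ℂ kTot p (1, 1, 0) := by
    rw [← smul_eq_mul, ← smul_eq_mul, ← map_smul, ← map_smul, ← map_add]
    congr 1
    ext <;> simp
  simp [(fderiv_pTot _ p).1, (fderiv_bInt _ p).1] at he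
  rw [e1, hT]
  linear_combination he + pTot 0 p * hode

theorem pearceyKernel_eq_kTot (τ x y : ℝ) :
    pearceyKernel τ x y = kTot ((x : ℂ), (y : ℂ), (τ : ℂ)) := by
  have hb : ∀ s, deriv imagAxis s = I := fun s => (hasDerivAt_lam s).deriv
  have key : ∀ σ : ℂ, IsSign σ → (∫ t, pearceyInner τ x y (σ * gammaR t) * (σ * dgammaR t))
      * cTwoPiI ^ 2 = kInt σ ((x : ℂ), (y : ℂ), (τ : ℂ)) := by
    intro σ hσ
    rw [kInt, expInt, integral_prod _ ((expIntegrable_kDens hσ).integrable_mul_exp _),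
      ← integral_mul_const]
    congr 1
    ext t
    rw [pearceyInner, contourIntegral, ← integral_mul_const, ← integral_mul_const]
    congr 1
    ext s
    rw [hb, pair3_kFreq]
    have he : exp (pearceyPhase τ x (σ * gammaR t) - pearceyPhase τ y (imagAxis s))
        = exp ((σ * gammaR t) ^ 4 / 4) * exp (-(s * I) ^ 4 / 4)
          * exp (pair3 (pFreq σ t) ((x : ℂ), (y : ℂ), (τ : ℂ))
            + pair3 (bFreq s) ((x : ℂ), (y : ℂ), (τ : ℂ))) := by
      rw [← exp_add, ← exp_add]
      congr 1
      simp only [pearceyPhase, imagAxis, pair3_apply, pFreq, bFreq]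
      ring
    simp only [kDens, pDens, bDens, pow_zero, mul_one, pDens₀, bDens₀, cauchyKer, he,
      div_eq_mul_inv]
    simp only [imagAxis]
    ring
  have hd : ∀ t, deriv gammaR t = dgammaR t := fun t => (hasDerivAt_gammaR t).deriv
  have hl : ∀ t, deriv gammaL t = -dgammaR t := fun t => (hasDerivAt_gammaR t).neg.deriv
  have k1 := key 1 isSign_one
  have k2 := key (-1) isSign_neg_one
  rw [pearceyKernel, kTot, ← k1, ← k2, contourIntegral, contourIntegral]
  simp only [hd, hl, one_mul, gammaL, neg_one_mul, cTwoPiI]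
  ring

end PearceyKernelTotal

end

noncomputable section

/-! ### Exponentials in the algebra of smooth functions. -/

section SmoothAlgebraExp

open TopologicalSpace Topology

variable {E : Type} [NormedAddCommGroup E] [NormedSpace ℂ E] {V : Opens E}

theorem smoothAlg_ext {f g : smoothAlg V} (h : ∀ x, f.1 x = g.1 x) : f = g :=
  Subtype.ext (funext h)

/-- The exponential of a smooth function. -/
def smoothExp (g : smoothAlg V) : smoothAlg V :=
  smoothAlg.mk (fun x => Complex.exp (zeroExt V g.1 x)) (ContDiffOn.cexp g.2)

theorem smoothExp_apply (g : smoothAlg V) (x : V) : (smoothExp g).1 x = Complex.exp (g.1 x) := by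
  simp [smoothExp]

theorem smoothExp_mul_neg (g : smoothAlg V) : smoothExp g * smoothExp (-g) = 1 := by
  ext x
  have : (smoothExp g).1 x * (smoothExp (-g)).1 x = 1 := by
    rw [smoothExp_apply, smoothExp_apply, ← Complex.exp_add]
    simp
  simpa using this

theorem dirDer_smoothExp (v : E) (g : smoothAlg V) :
    dirDer V v (smoothExp g) = smoothExp g * dirDer V v g := by
  ext x
  have h := (smoothAlg_differentiableAt g x).hasFDerivAt.cexp.fderiv
  have : (dirDer V v (smoothExp g)).1 x = (smoothExp g).1 x * (dirDer V v g).1 x := by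
    rw [smoothExp, dirDer_mk_apply, h]
    simp [dirDer_apply]
  simpa using this

theorem dirDer_eq_of_fderiv {v : E} {f f' : E → ℂ} (hf : ContDiffOn ℂ ∞ f V)
    (hf' : ContDiffOn ℂ ∞ f' V) (h : ∀ x ∈ V, fderiv ℂ f x v = f' x) :
    dirDer V v (smoothAlg.mk f hf) = smoothAlg.mk f' hf' := by
  ext x
  have := (dirDer_mk_apply v f hf x).trans (h x x.2)
  simpa using this

end SmoothAlgebraExp

/-! ### The discretized determinant satisfies the equations exactly. -/

section GridDeterminant

open Complex TopologicalSpace Matrix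

theorem fderiv_comp_clm {F : ℂ × ℂ × ℂ → ℂ} (hF : ContDiff ℂ ∞ F)
    (L : ℂ × ℂ × ℂ →L[ℂ] ℂ × ℂ × ℂ) (p v : ℂ × ℂ × ℂ) :
    fderiv ℂ (fun q => F (L q)) p v = fderiv ℂ F (L p) (L v) := by
  have h := (hF.differentiable (by simp) (L p)).hasFDerivAt.comp p L.hasFDerivAt
  exact congrArg (fun A : ℂ × ℂ × ℂ →L[ℂ] ℂ => A v) h.fderiv

/-- The point `a + s (b - a)`, as a function of `(a, b, τ)`. -/
def gridPt (s : ℂ) : ℂ × ℂ × ℂ →L[ℂ] ℂ := pair3 (1 - s, s, 0)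

/-- The triple `(a + s (b - a), a + t (b - a), τ)`, as a function of `(a, b, τ)`. -/
def gridMap (s t : ℂ) : ℂ × ℂ × ℂ →L[ℂ] ℂ × ℂ × ℂ :=
  (gridPt s).prod ((gridPt t).prod (pair3 (0, 0, 1)))

theorem gridPt_apply (s : ℂ) (p : ℂ × ℂ × ℂ) : gridPt s p = (1 - s) * p.1 + s * p.2.1 := by
  simp [gridPt, pair3_apply]

theorem gridMap_apply (s t : ℂ) (p : ℂ × ℂ × ℂ) :
    gridMap s t p = (gridPt s p, gridPt t p, p.2.2) := by
  simp [gridMap, pair3_apply]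

theorem gridMap_translation (s t : ℂ) : gridMap s t (1, 1, 0) = (1, 1, 0) := by
  simp [gridMap_apply, gridPt_apply]

theorem gridMap_tau (s t : ℂ) : gridMap s t (0, 0, 2) = (0, 0, 2) := by
  simp [gridMap_apply, gridPt_apply]

/-- Grid points are linear in (a, b), so the Euler field of (a, b) induces that of (x, y). -/
theorem gridMap_euler (s t : ℂ) (p : ℂ × ℂ × ℂ) :
    gridMap s t (p.1, p.2.1, 0) = ((gridMap s t p).1, (gridMap s t p).2.1, 0) := by
  simp [gridMap_apply, gridPt_apply]

theorem pTot_snd (i : ℕ) (x y y' t : ℂ) : pTot i (x, y, t) = pTot i (x, y', t) := by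
  simp [pTot, pInt, expInt, pair3_apply, pFreq]

theorem bInt_fst (j : ℕ) (x x' y t : ℂ) : bInt j (x, y, t) = bInt j (x', y, t) := by
  simp [bInt, expInt, pair3_apply, bFreq]

theorem contDiff_comp_gridMap {F : ℂ × ℂ × ℂ → ℂ} (hF : ContDiff ℂ ∞ F) (s t : ℂ) :
    ContDiff ℂ ∞ fun p => F (gridMap s t p) := hF.comp (gridMap s t).contDiff

/-- The kernel of the discretized operator. -/
def gridKer (n : ℕ) (s t : ℂ) (p : ℂ × ℂ × ℂ) : ℂ := (p.2.1 - p.1) / n * kTot (gridMap s t p)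

/-- The matrix of the discretized operator. -/
def gridMat (n : ℕ) (p : ℂ × ℂ × ℂ) : Matrix (Fin n) (Fin n) ℂ :=
  of fun k l => gridKer n (k / n) (l / n) p

theorem contDiff_gridKer (n : ℕ) (s t : ℂ) : ContDiff ℂ ∞ (gridKer n s t) := by
  have := contDiff_comp_gridMap contDiff_kTot s t
  unfold gridKer
  fun_prop

theorem contDiff_det_gridMat (n : ℕ) : ContDiff ℂ ∞ fun p => (1 - gridMat n p).det := by
  have h : ∀ i j, ContDiff ℂ ∞ fun p => (1 - gridMat n p) i j := fun i j =>
    contDiff_const.sub (contDiff_gridKer n _ _)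
  simp only [det_apply']
  exact ContDiff.sum fun σ _ => contDiff_const.mul (contDiff_prod fun i _ => h _ _)

theorem fderiv_gridKer (n : ℕ) (s t : ℂ) (p v : ℂ × ℂ × ℂ) :
    fderiv ℂ (gridKer n s t) p v = (v.2.1 - v.1) / n * kTot (gridMap s t p)
      + (p.2.1 - p.1) / n * fderiv ℂ kTot (gridMap s t p) (gridMap s t v) := by
  have h1 : HasFDerivAt (fun q : ℂ × ℂ × ℂ => (q.2.1 - q.1) / n)
      (pair3 (-(n : ℂ)⁻¹, (n : ℂ)⁻¹, 0)) p := by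
    have : (fun q : ℂ × ℂ × ℂ => (q.2.1 - q.1) / n) = pair3 (-(n : ℂ)⁻¹, (n : ℂ)⁻¹, 0) := by
      ext q
      rw [pair3_apply]
      ring
    rw [this]
    exact ContinuousLinearMap.hasFDerivAt _
  have h2 := ((contDiff_comp_gridMap contDiff_kTot s t).differentiable (by simp) p).hasFDerivAt
  have h := congrArg (fun A : ℂ × ℂ × ℂ →L[ℂ] ℂ => A v) (h1.fun_mul h2).fderiv
  refine h.trans ?_
  rw [_root_.add_apply, _root_.smul_apply, _root_.smul_apply,
    fderiv_comp_clm contDiff_kTot, pair3_apply, smul_eq_mul, smul_eq_mul]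
  ring

variable (V : Opens (ℂ × ℂ × ℂ))

/-- The restriction of a smooth function to an element of `smoothAlg V`. -/
def toAlg {f : ℂ × ℂ × ℂ → ℂ} (hf : ContDiff ℂ ∞ f) : smoothAlg V := smoothAlg.mk f hf.contDiffOn

/-- The coordinate `a`. -/
def coordA : smoothAlg V := toAlg V (f := fun p => p.1) contDiff_fst

/-- The coordinate `b`. -/
def coordB : smoothAlg V := toAlg V (f := fun p => p.2.1) (contDiff_fst.comp contDiff_snd)

/-- The coordinate `τ`. -/
def coordTau : smoothAlg V := toAlg V (f := fun p => p.2.2) (contDiff_snd.comp contDiff_snd)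

/-- The derivation `a ∂_a + b ∂_b`. -/
def eulerDer : Derivation ℂ (smoothAlg V) (smoothAlg V) :=
  coordA V • dirDer V (1, 0, 0) + coordB V • dirDer V (0, 1, 0)

variable {V}

theorem eulerDer_apply (f : smoothAlg V) :
    eulerDer V f = coordA V * dirDer V (1, 0, 0) f + coordB V * dirDer V (0, 1, 0) f := rfl

theorem dirDer_coordA (v : ℂ × ℂ × ℂ) : dirDer V v (coordA V) = algebraMap ℂ _ v.1 := by
  refine (dirDer_eq_of_fderiv (f := fun p : ℂ × ℂ × ℂ => p.1) (f' := fun _ => v.1)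
    contDiff_fst.contDiffOn contDiffOn_const fun p _ => ?_).trans rfl
  exact congrArg (fun A : ℂ × ℂ × ℂ →L[ℂ] ℂ => A v)
    (hasFDerivAt_fst (𝕜 := ℂ) (p := p)).fderiv

theorem dirDer_coordB (v : ℂ × ℂ × ℂ) : dirDer V v (coordB V) = algebraMap ℂ _ v.2.1 := by
  refine (dirDer_eq_of_fderiv (f' := fun _ => v.2.1) _ contDiffOn_const fun p _ => ?_).trans rfl
  exact congrArg (fun A : ℂ × ℂ × ℂ →L[ℂ] ℂ => A v)
    (hasFDerivAt_snd (𝕜 := ℂ) (p := p)).fst.fderiv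

theorem dirDer_coordTau (v : ℂ × ℂ × ℂ) : dirDer V v (coordTau V) = algebraMap ℂ _ v.2.2 := by
  refine (dirDer_eq_of_fderiv (f' := fun _ => v.2.2) _ contDiffOn_const fun p _ => ?_).trans rfl
  exact congrArg (fun A : ℂ × ℂ × ℂ →L[ℂ] ℂ => A v)
    (hasFDerivAt_snd (𝕜 := ℂ) (p := p)).snd.fderiv

theorem dirDer_eulerDer (f : smoothAlg V) :
    dirDer V (1, 1, 0) (eulerDer V f) = eulerDer V (dirDer V (1, 1, 0) f)
      + dirDer V (1, 1, 0) f := by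
  have h : dirDer V (1, 1, 0) f = dirDer V (1, 0, 0) f + dirDer V (0, 1, 0) f := by
    rw [← dirDer_add]
    simp
  rw [eulerDer_apply, eulerDer_apply, map_add, Derivation.leibniz, Derivation.leibniz,
    dirDer_coordA, dirDer_coordB, dirDer_comm _ (1, 0, 0), dirDer_comm _ (0, 1, 0)]
  simp only [map_one, smul_eq_mul, mul_one]
  linear_combination -h

theorem dirDer_tau_eulerDer (f : smoothAlg V) :
    dirDer V (0, 0, 2) (eulerDer V f) = eulerDer V (dirDer V (0, 0, 2) f) := by
  rw [eulerDer_apply, eulerDer_apply, map_add, Derivation.leibniz, Derivation.leibniz,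
    dirDer_coordA, dirDer_coordB, dirDer_comm _ (1, 0, 0), dirDer_comm _ (0, 1, 0)]
  simp

theorem eulerDer_eq_of_fderiv {f f' : ℂ × ℂ × ℂ → ℂ} (hf : ContDiff ℂ ∞ f) (hf' : ContDiff ℂ ∞ f')
    (h : ∀ p, fderiv ℂ f p (p.1, p.2.1, 0) = f' p) :
    eulerDer V (toAlg V hf) = toAlg V hf' := by
  refine smoothAlg_ext fun x => ?_
  have h1 : (eulerDer V (toAlg V hf)).1 x = x.1.1 * fderiv ℂ f x (1, 0, 0)
      + x.1.2.1 * fderiv ℂ f x (0, 1, 0) := by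
    rw [← dirDer_mk_apply _ f hf.contDiffOn x, ← dirDer_mk_apply _ f hf.contDiffOn x]
    rfl
  have h2 := h x
  have e : ((x.1.1, x.1.2.1, 0) : ℂ × ℂ × ℂ) = x.1.1 • (1, 0, 0) + x.1.2.1 • (0, 1, 0) := by
    ext <;> simp
  rw [e, map_add, map_smul, map_smul, smul_eq_mul, smul_eq_mul] at h2
  exact h1.trans h2

theorem eulerDer_smoothExp (g : smoothAlg V) :
    eulerDer V (smoothExp g) = smoothExp g * eulerDer V g := by
  rw [eulerDer_apply, eulerDer_apply, dirDer_smoothExp, dirDer_smoothExp]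
  ring

theorem dirDer_toAlg {v : ℂ × ℂ × ℂ} {f f' : ℂ × ℂ × ℂ → ℂ} (hf : ContDiff ℂ ∞ f)
    (hf' : ContDiff ℂ ∞ f') (h : ∀ p, fderiv ℂ f p v = f' p) :
    dirDer V v (toAlg V hf) = toAlg V hf' :=
  dirDer_eq_of_fderiv _ _ fun x _ => h x

/-- The discretized functions `P_i`. -/
def gridP (V : Opens (ℂ × ℂ × ℂ)) (i : ℕ) (s : ℂ) : smoothAlg V :=
  -- The second node 0 is a dummy, since P_i does not depend on y.
  toAlg V (contDiff_comp_gridMap (contDiff_pTot i) s 0)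

/-- The discretized functions `B_j`, without weight. -/
def gridB (V : Opens (ℂ × ℂ × ℂ)) (j : ℕ) (t : ℂ) : smoothAlg V :=
  toAlg V (contDiff_comp_gridMap (contDiff_bInt j) 0 t)

/-- The weight `(b - a)/n`. -/
def gridWeight (V : Opens (ℂ × ℂ × ℂ)) (n : ℕ) : smoothAlg V :=
  algebraMap ℂ _ (n : ℂ)⁻¹ * (coordB V - coordA V)

/-- The grid point as an element of the algebra. -/
def gridX (V : Opens (ℂ × ℂ × ℂ)) (s : ℂ) : smoothAlg V :=
  toAlg V (f := gridPt s) (gridPt s).contDiff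

theorem translation_gridP (i : ℕ) (s : ℂ) :
    dirDer V (1, 1, 0) (gridP V i s) = gridP V (i + 1) s := by
  refine dirDer_toAlg _ _ fun p => ?_
  obtain ⟨h1, h2, -⟩ := fderiv_pTot i (gridMap s 0 p)
  rw [fderiv_comp_clm (contDiff_pTot i), gridMap_translation,
    show ((1, 1, 0) : ℂ × ℂ × ℂ) = (1, 0, 0) + (0, 1, 0) by simp, map_add, h1, h2, add_zero]

theorem translation_gridB (j : ℕ) (t : ℂ) :
    dirDer V (1, 1, 0) (gridB V j t) = gridB V (j + 1) t := by
  refine dirDer_toAlg _ _ fun p => ?_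
  obtain ⟨h1, h2, -⟩ := fderiv_bInt j (gridMap 0 t p)
  rw [fderiv_comp_clm (contDiff_bInt j), gridMap_translation,
    show ((1, 1, 0) : ℂ × ℂ × ℂ) = (1, 0, 0) + (0, 1, 0) by simp, map_add, h1, h2, zero_add]

theorem tau_gridP (i : ℕ) (s : ℂ) : dirDer V (0, 0, 2) (gridP V i s) = -gridP V (i + 2) s := by
  refine dirDer_toAlg _ (contDiff_comp_gridMap (contDiff_pTot (i + 2)) s 0).neg fun p => ?_
  rw [fderiv_comp_clm (contDiff_pTot i), gridMap_tau, (fderiv_pTot i _).2.2]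

theorem tau_gridB (j : ℕ) (t : ℂ) : dirDer V (0, 0, 2) (gridB V j t) = gridB V (j + 2) t := by
  refine dirDer_toAlg _ _ fun p => ?_
  rw [fderiv_comp_clm (contDiff_bInt j), gridMap_tau, (fderiv_bInt j _).2.2]

theorem translation_gridWeight (n : ℕ) : dirDer V (1, 1, 0) (gridWeight V n) = 0 := by
  simp [gridWeight, Derivation.leibniz, dirDer_coordA, dirDer_coordB]

theorem tau_gridWeight (n : ℕ) : dirDer V (0, 0, 2) (gridWeight V n) = 0 := by
  simp [gridWeight, Derivation.leibniz, dirDer_coordA, dirDer_coordB]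

theorem translation_gridX (s : ℂ) : dirDer V (1, 1, 0) (gridX V s) = 1 := by
  refine (dirDer_toAlg (f' := fun _ => 1) _ contDiff_const fun p => ?_).trans rfl
  rw [ContinuousLinearMap.fderiv, gridPt_apply]
  ring

/-- The discretized kernel as a matrix over the algebra of smooth functions. -/
def gridMatAlg (V : Opens (ℂ × ℂ × ℂ)) (n : ℕ) : Matrix (Fin n) (Fin n) (smoothAlg V) :=
  of fun k l => toAlg V (contDiff_gridKer n (k / n) (l / n))

theorem gridX_mul_gridP (s : ℂ) :
    gridX V s * gridP V 0 s = coordTau V * gridP V 1 s - gridP V 3 s := by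
  refine smoothAlg_ext fun x => ?_
  have h := pTot_ode (gridMap s 0 x)
  rwa [show (gridMap s 0 x).1 = gridPt s x by rw [gridMap_apply],
    show (gridMap s 0 x).2.2 = x.1.2.2 by rw [gridMap_apply]] at h

theorem gridX_mul_gridB (t : ℂ) :
    gridX V t * gridB V 0 t = gridB V 3 t - coordTau V * gridB V 1 t := by
  refine smoothAlg_ext fun x => ?_
  have h := bInt_ode (gridMap 0 t x)
  rwa [show (gridMap 0 t x).2.1 = gridPt t x by rw [gridMap_apply],
    show (gridMap 0 t x).2.2 = x.1.2.2 by rw [gridMap_apply]] at h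

/-- Apply E twice to the equation of B_0. As E maps the grid point to 1, the product rule
contributes 2B_1. -/
theorem gridX_mul_gridB_two (t : ℂ) :
    gridX V t * gridB V 2 t = gridB V 5 t - coordTau V * gridB V 3 t - 2 * gridB V 1 t := by
  have h := congrArg (dirDer V (1, 1, 0)) (congrArg (dirDer V (1, 1, 0)) (gridX_mul_gridB (V := V) t))
  simp only [Derivation.leibniz, map_sub, map_add, translation_gridB, translation_gridX,
    dirDer_coordTau, smul_eq_mul, map_zero, mul_zero, add_zero, mul_one] at h
  linear_combination h

variable (n : ℕ) (k l : Fin n)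

theorem gridP_apply (i : ℕ) (s t : ℂ) (x : V) : (gridP V i s).1 x = pTot i (gridMap s t x) := by
  refine (show _ = pTot i (gridMap s 0 x) from rfl).trans ?_
  rw [gridMap_apply, gridMap_apply]
  exact pTot_snd _ _ _ _ _

theorem gridB_apply (j : ℕ) (s t : ℂ) (x : V) : (gridB V j t).1 x = bInt j (gridMap s t x) := by
  refine (show _ = bInt j (gridMap 0 t x) from rfl).trans ?_
  rw [gridMap_apply, gridMap_apply]
  exact bInt_fst _ _ _ _ _

theorem translation_gridKer (s t : ℂ) :
    dirDer V (1, 1, 0) (toAlg V (contDiff_gridKer n s t))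
      = gridP V 0 s * (gridWeight V n * gridB V 0 t) := by
  refine smoothAlg_ext fun x => ?_
  refine (dirDer_mk_apply _ _ _ x).trans ?_
  rw [fderiv_gridKer, gridMap_translation, fderiv_kTot_translation, ← gridP_apply,
    ← gridB_apply]
  change _ = (gridP V 0 s).1 x * ((n : ℂ)⁻¹ * (x.1.2.1 - x.1.1) * (gridB V 0 t).1 x)
  ring

theorem tau_gridKer (s t : ℂ) :
    dirDer V (0, 0, 2) (toAlg V (contDiff_gridKer n s t))
      = gridP V 0 s * (gridWeight V n * gridB V 1 t)
        - gridP V 1 s * (gridWeight V n * gridB V 0 t) := by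
  refine smoothAlg_ext fun x => ?_
  refine (dirDer_mk_apply _ _ _ x).trans ?_
  rw [fderiv_gridKer, gridMap_tau, fderiv_kTot_tau, ← gridP_apply, ← gridP_apply, ← gridB_apply,
    ← gridB_apply]
  change _ = (gridP V 0 s).1 x * ((n : ℂ)⁻¹ * (x.1.2.1 - x.1.1) * (gridB V 1 t).1 x)
    - (gridP V 1 s).1 x * ((n : ℂ)⁻¹ * (x.1.2.1 - x.1.1) * (gridB V 0 t).1 x)
  ring

/-- The weight is homogeneous of degree one, so the Euler field acts on the weighted kernel as 1 +
x∂_x + y∂_y. -/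
theorem eulerDer_gridKer (s t : ℂ) :
    eulerDer V (toAlg V (contDiff_gridKer n s t))
      = -(gridP V 3 s * (gridWeight V n * gridB V 0 t))
        + gridP V 2 s * (gridWeight V n * gridB V 1 t)
        - gridP V 1 s * (gridWeight V n * gridB V 2 t)
        + gridP V 0 s * (gridWeight V n * gridB V 3 t)
        - coordTau V * (gridP V 0 s * (gridWeight V n * gridB V 1 t)
        - gridP V 1 s * (gridWeight V n * gridB V 0 t)) := by
  refine smoothAlg_ext fun x => ?_
  have h := kTot_add_fderiv_euler (gridMap s t x)
  have h1 : (eulerDer V (toAlg V (contDiff_gridKer n s t))).1 x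
      = fderiv ℂ (gridKer n s t) x (x.1.1, x.1.2.1, 0) := by
    have hc : ContDiff ℂ ∞ fun p : ℂ × ℂ × ℂ => fderiv ℂ (gridKer n s t) p (p.1, p.2.1, 0) :=
      ((contDiff_gridKer n s t).fderiv_right (m := ∞) (by simp)).clm_apply (by fun_prop)
    rw [eulerDer_eq_of_fderiv _ hc fun p => rfl]
    rfl
  rw [h1, fderiv_gridKer, gridMap_euler]
  simp only [← gridP_apply, ← gridB_apply] at h
  rw [show (gridMap s t x).2.2 = x.1.2.2 by rw [gridMap_apply]] at h
  generalize fderiv ℂ kTot (gridMap s t x) _ = A at h ⊢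
  generalize kTot (gridMap s t x) = B at h ⊢
  have W : ∀ j, (gridWeight V n * gridB V j t).1 x
    = (n : ℂ)⁻¹ * (x.1.2.1 - x.1.1) * (gridB V j t).1 x := fun j => rfl
  change _ = -((gridP V 3 s).1 x * (gridWeight V n * gridB V 0 t).1 x)
        + (gridP V 2 s).1 x * (gridWeight V n * gridB V 1 t).1 x
        - (gridP V 1 s).1 x * (gridWeight V n * gridB V 2 t).1 x
        + (gridP V 0 s).1 x * (gridWeight V n * gridB V 3 t).1 x
        - x.1.2.2 * ((gridP V 0 s).1 x * (gridWeight V n * gridB V 1 t).1 x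
        - (gridP V 1 s).1 x * (gridWeight V n * gridB V 0 t).1 x)
  simp only [W]
  linear_combination (n : ℂ)⁻¹ * (x.1.2.1 - x.1.1) * h

theorem gridX_sub_mul_gridKer (s t : ℂ) :
    (gridX V s - gridX V t) * toAlg V (contDiff_gridKer n s t)
      = coordTau V * (gridP V 0 s * (gridWeight V n * gridB V 0 t))
        - gridP V 2 s * (gridWeight V n * gridB V 0 t)
        + gridP V 1 s * (gridWeight V n * gridB V 1 t)
        - gridP V 0 s * (gridWeight V n * gridB V 2 t) := by
  refine smoothAlg_ext fun x => ?_
  have h := kTot_sub_mul (gridMap s t x)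
  simp only [← gridP_apply, ← gridB_apply] at h
  rw [show (gridMap s t x).2.2 = x.1.2.2 by rw [gridMap_apply],
    show (gridMap s t x).1 = gridPt s x by rw [gridMap_apply],
    show (gridMap s t x).2.1 = gridPt t x by rw [gridMap_apply]] at h
  have W : ∀ j, (gridWeight V n * gridB V j t).1 x
    = (n : ℂ)⁻¹ * (x.1.2.1 - x.1.1) * (gridB V j t).1 x := fun j => rfl
  change (gridPt s x - gridPt t x) * ((x.1.2.1 - x.1.1) / n * kTot (gridMap s t x))
    = x.1.2.2 * ((gridP V 0 s).1 x * (gridWeight V n * gridB V 0 t).1 x)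
        - (gridP V 2 s).1 x * (gridWeight V n * gridB V 0 t).1 x
        + (gridP V 1 s).1 x * (gridWeight V n * gridB V 1 t).1 x
        - (gridP V 0 s).1 x * (gridWeight V n * gridB V 2 t).1 x
  simp only [W]
  linear_combination (n : ℂ)⁻¹ * (x.1.2.1 - x.1.1) * h

/-- The identities of the kernel hold at every pair of grid points, so no error term appears for any
n. The weight is attached to the vectors b_j; it is annihilated by E and T, so they still act on b_j
as shifts. -/
theorem pearcey_equations_of_grid {n : ℕ} {g : smoothAlg V}
    (hg : ∀ x : V, Complex.exp (g.1 x) = (1 - gridMat n x).det) :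
    let E := dirDer V (1, 1, 0)
    let T := dirDer V (0, 0, 2)
    let ε := eulerDer V
    let τ := coordTau V
    (E (E (E (E g))) + 6 * (E (E g)) ^ 2 - 4 * τ * E (E g) + 3 * T (T g) = 0) ∧
    (-3 * ε (E g) - τ * T (E g) + T (E (E (E g))) + E g + 6 * E (E g) * T (E g) = 0) ∧
    (6 * ε (T g) - 2 * ε (E (E g))
      + (2 * T (T g) + 2 * T (E (E g)) - 4 * E (E (E (E g))) - 8 * (E (E g)) ^ 2) * τ
      + 4 * E (E g) + 16 * (E (E g)) ^ 3 + 4 * E (T g) * E (E (E g)) + 10 * (E (E (E g))) ^ 2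
      + 16 * E (E (E (E g))) * E (E g) + E (E (E (E (E (E g))))) - 2 * T (T (T g))
      + T (T (E (E g))) - 6 * (E (T g)) ^ 2 - 4 * T (E (E g)) * E (E g) - 4 * T g = 0) := by
  intro E T ε τ
  have hdet : (1 - gridMatAlg V n).det = smoothExp g := by
    refine smoothAlg_ext fun x => ?_
    rw [smoothExp_apply, hg]
    let ev : smoothAlg V →+* ℂ := (Pi.evalRingHom (fun _ : V => ℂ) x).comp (smoothAlg V).val.toRingHom
    change ev _ = _
    rw [RingHom.map_det]
    congr 1
    ext i j
    by_cases h : i = j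
    · subst h
      simp [gridMatAlg, gridMat, ev, toAlg]
    · simp [gridMatAlg, gridMat, ev, h, toAlg]
  have hunit : IsUnit (1 - gridMatAlg V n).det := by
    rw [hdet]
    exact IsUnit.of_mul_eq_one _ (smoothExp_mul_neg g)
  refine pearcey_equations_of_matrix E T ε (M := gridMatAlg V n) (nonsing_inv_mul _ hunit)
    (fun i k => gridP V i (k / n)) (fun j k => gridWeight V n * gridB V j (k / n))
    (fun k => gridX V (k / n)) g τ ?_ ?_ ?_ ?_ ?_ ?_ ?_ ?_ ?_ ?_ ?_ ?_ ?_ ?_ ?_ ?_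
  · exact fun i k => translation_gridP _ _
  · intro i k
    simp [E, Derivation.leibniz, translation_gridB, translation_gridWeight]
  · exact fun i k => tau_gridP _ _
  · intro i k
    simp [T, Derivation.leibniz, tau_gridB, tau_gridWeight]
  · ext1 k l
    exact translation_gridKer n _ _
  · ext1 k l
    exact tau_gridKer n _ _
  · ext1 k l
    refine (eulerDer_gridKer n (k / n) (l / n)).trans ?_
    rw [← tau_gridKer]
    rfl
  · ext1 k l
    refine Eq.trans ?_ (gridX_sub_mul_gridKer n (k / n) (l / n))
    rw [Matrix.sub_apply, diagonal_mul, mul_diagonal, sub_mul]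
    congr 1
    exact mul_comm _ _
  · exact fun k => gridX_mul_gridP _
  · intro k
    linear_combination gridWeight V n * gridX_mul_gridB_two (V := V) (k / n)
  · simp [E, τ, dirDer_coordTau]
  · simp [T, τ, dirDer_coordTau, map_ofNat]
  · rw [hdet]
    rintro δ (rfl | rfl | rfl)
    · exact (dirDer_smoothExp _ g).symm
    · exact (dirDer_smoothExp _ g).symm
    · exact (eulerDer_smoothExp g).symm
  · exact dirDer_eulerDer g
  · exact dirDer_eulerDer (E g)
  · exact dirDer_tau_eulerDer g

end GridDeterminant

end

noncomputable section

/-! ### The limit determinant and the transfer of the equations. -/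

section PearceyDetComplex

open Complex TopologicalSpace Topology Filter Matrix

/-- The Fredholm determinant as a function of complex `(a, b, τ)`. -/
def pearceyDetC (p : ℂ × ℂ × ℂ) : ℂ :=
  fredholmDet (fun s t => (p.2.1 - p.1) * kTot (gridMap s t p)) 0 1

theorem continuous_gridMap : Continuous fun w : ℝ × ℝ × ℂ × ℂ × ℂ => gridMap w.1 w.2.1 w.2.2 := by
  simp only [gridMap_apply, gridPt_apply]
  fun_prop

theorem continuous_unit_kernel : Continuous fun w : ℝ × ℝ × ℂ × ℂ × ℂ =>
    (w.2.2.2.1 - w.2.2.1) * kTot (gridMap w.1 w.2.1 w.2.2) :=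
  Continuous.mul (by fun_prop) (contDiff_kTot.continuous.comp continuous_gridMap)

theorem tendsto_det_gridMat (p : ℂ × ℂ × ℂ) :
    Tendsto (fun n => (1 - gridMat n p).det) atTop (𝓝 (pearceyDetC p)) := by
  have hc : Continuous fun w : ℝ × ℝ => (p.2.1 - p.1) * kTot (gridMap w.1 w.2 p) :=
    continuous_unit_kernel.comp (by fun_prop : Continuous fun w : ℝ × ℝ => (w.1, w.2, p))
  refine (tendsto_det_one_sub_fredholmDet hc).congr fun n => ?_
  congr 2
  ext k l
  simp only [gridMat, gridKer, of_apply]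
  push_cast
  ring

/-- The scaled kernel is bounded for grid points in [0, 1] and parameters in a compact ball, so
Hadamard's bound is uniform in n there. Pointwise convergence then upgrades to locally uniform
convergence. -/
theorem tendstoLocallyUniformlyOn_det_gridMat :
    TendstoLocallyUniformlyOn (fun n p => (1 - gridMat n p).det) pearceyDetC atTop Set.univ := by
  refine tendstoLocallyUniformly_of_locally_bounded
    (fun n => (contDiff_det_gridMat n).differentiable (by simp)) (fun p => ?_) tendsto_det_gridMat
  obtain ⟨C, hC⟩ := (isCompact_Icc.prod (isCompact_Icc.prod (isCompact_closedBall p 1))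
    ).exists_bound_of_continuousOn (s := Set.Icc (0 : ℝ) 1 ×ˢ Set.Icc (0 : ℝ) 1 ×ˢ
      Metric.closedBall p 1) continuous_unit_kernel.continuousOn
  have hC0 : 0 ≤ C := (norm_nonneg _).trans (hC (0, 0, p) (by simp))
  refine ⟨1, one_pos, _, fun n q hq => norm_det_one_sub_le _ hC0 fun i k => ?_⟩
  have hb : ∀ i : Fin n, ((i : ℕ) : ℝ) / n ∈ Set.Icc (0 : ℝ) 1 := fun i =>
    ⟨by positivity, div_le_one_of_le₀ (by exact_mod_cast i.2.le) (by positivity)⟩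
  have h := hC (_, _, q) ⟨hb i, hb k, Metric.ball_subset_closedBall hq⟩
  simp only [gridMat, gridKer, of_apply]
  rw [div_mul_eq_mul_div, norm_div, Complex.norm_natCast]
  push_cast at h
  gcongr

theorem contDiff_pearceyDetC : ContDiff ℂ ∞ pearceyDetC := by
  rw [← contDiffOn_univ]
  exact tendstoLocallyUniformlyOn_det_gridMat.contDiffOn_top isOpen_univ
    fun n => (contDiff_det_gridMat n).contDiffOn

theorem pearceyDet_eq (a b τ : ℝ) (hab : a < b) :
    pearceyDet a b τ = pearceyDetC ((a : ℂ), (b : ℂ), (τ : ℂ)) := by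
  rw [pearceyDet, fredholmDet_eq_unit_interval _ hab, pearceyDetC]
  congr 1
  ext s t
  rw [pearceyKernel_eq_kTot, gridMap_apply, gridPt_apply, gridPt_apply]
  push_cast
  congr 3
  · ring
  · congr 1
    ring

theorem smoothOnIntervals_pearceyLogDet
    (hpos : ∀ a b τ : ℝ, a < b → (pearceyDet a b τ).im = 0 ∧ 0 < (pearceyDet a b τ).re) :
    SmoothOnIntervals pearceyLogDet := by
  have h1 : ContDiff ℝ ∞ fun p : ℝ × ℝ × ℝ =>
      (pearceyDetC ((p.1 : ℂ), (p.2.1 : ℂ), (p.2.2 : ℂ))).re := by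
    have h2 : ContDiff ℝ ∞ fun p : ℝ × ℝ × ℝ => ((p.1 : ℂ), (p.2.1 : ℂ), (p.2.2 : ℂ)) :=
      (ofRealCLM.contDiff.comp contDiff_fst).prodMk
        ((ofRealCLM.contDiff.comp (contDiff_fst.comp contDiff_snd)).prodMk
          (ofRealCLM.contDiff.comp (contDiff_snd.comp contDiff_snd)))
    exact reCLM.contDiff.comp ((contDiff_pearceyDetC.restrict_scalars ℝ).comp h2)
  have h3 : ∀ p ∈ {p : ℝ × ℝ × ℝ | p.1 < p.2.1},
      (pearceyDetC ((p.1 : ℂ), (p.2.1 : ℂ), (p.2.2 : ℂ))).re ≠ 0 := fun p hp => by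
    rw [← pearceyDet_eq _ _ _ hp]
    exact (hpos _ _ _ hp).2.ne'
  refine (h1.contDiffOn.log h3).congr fun p hp => ?_
  rw [pearceyLogDet, pearceyDet_eq _ _ _ hp]

/-! ### Complex directional derivatives against real partial derivatives. -/

section RealPoints

variable {V : Opens (ℂ × ℂ × ℂ)}

/-- The smooth function `f` on `V` agrees with `u` at the real points. -/
def AgreesAtReal (f : smoothAlg V) (u : ℝ → ℝ → ℝ → ℝ) : Prop :=
  ∀ (a b τ : ℝ) (h : ((a : ℂ), (b : ℂ), (τ : ℂ)) ∈ V), f.1 ⟨_, h⟩ = (u a b τ : ℂ)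

theorem ofReal_deriv_eq {f : ℝ → ℂ} {f' : ℂ} {v : ℝ → ℝ} {a : ℝ} (h : HasDerivAt f f' a)
    (hv : ∀ᶠ s in 𝓝 a, f s = v s) : ((deriv v a : ℝ) : ℂ) = f' := by
  have h1 : HasDerivAt v f'.re a :=
    (reCLM.hasFDerivAt.comp_hasDerivAt a h).congr_of_eventuallyEq
      (hv.mono fun s hs => by simp [hs])
  rw [h1.deriv]
  exact h1.ofReal_comp.unique (h.congr_of_eventuallyEq (hv.mono fun s hs => hs.symm))

/-- As V is open, agreement holds along short real segments in each coordinate and therefore passes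
to derivatives. Repeating this reaches every iterated derivative in the equations. -/
theorem AgreesAtReal.partials {f : smoothAlg V} {u : ℝ → ℝ → ℝ → ℝ} (H : AgreesAtReal f u)
    {a b τ : ℝ} (h : ((a : ℂ), (b : ℂ), (τ : ℂ)) ∈ V) :
    (dirDer V (1, 0, 0) f).1 ⟨_, h⟩ = (deriv (fun s => u s b τ) a : ℝ) ∧
    (dirDer V (0, 1, 0) f).1 ⟨_, h⟩ = (deriv (fun s => u a s τ) b : ℝ) ∧
    (dirDer V (0, 0, 1) f).1 ⟨_, h⟩ = (deriv (fun s => u a b s) τ : ℝ) := by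
  have hd : HasFDerivAt (zeroExt V f.1) (fderiv ℂ (zeroExt V f.1) ((a : ℂ), (b : ℂ), (τ : ℂ)))
      ((a : ℂ), (b : ℂ), (τ : ℂ)) := (smoothAlg_differentiableAt f ⟨_, h⟩).hasFDerivAt
  have key : ∀ {c : ℝ → ℂ × ℂ × ℂ} {v : ℂ × ℂ × ℂ} {w : ℝ → ℝ} {s₀ : ℝ}, HasDerivAt c v s₀ →
      c s₀ = ((a : ℂ), (b : ℂ), (τ : ℂ)) → (∀ s, c s ∈ V → zeroExt V f.1 (c s) = w s) →
      (dirDer V v f).1 ⟨_, h⟩ = (deriv w s₀ : ℝ) := by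
    intro c v w s₀ hc h0 hw
    change fderiv ℂ (zeroExt V f.1) ((a : ℂ), (b : ℂ), (τ : ℂ)) v = _
    rw [← h0] at hd ⊢
    have hcomp := HasFDerivAt.comp_hasDerivAt s₀ (hd.restrictScalars ℝ) hc
    refine (ofReal_deriv_eq hcomp ?_).symm
    filter_upwards [hc.continuousAt.preimage_mem_nhds
      (V.isOpen.mem_nhds (by rw [h0]; exact h))] with s hs using hw s hs
  have hof : ∀ s : ℝ, HasDerivAt (fun s : ℝ => (s : ℂ)) 1 s := fun s => by
    simpa using (hasDerivAt_id s).ofReal_comp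
  have hz : ∀ (s t : ℝ) {c : ℂ}, HasDerivAt (fun _ : ℝ => c) 0 s := fun s _ c => hasDerivAt_const s c
  refine ⟨?_, ?_, ?_⟩
  · refine key ((hof a).prodMk ((hz a 0).prodMk (hz a 0))) rfl fun s hs => ?_
    exact (zeroExt_coe f.1 ⟨_, hs⟩).trans (H _ _ _ hs)
  · refine key ((hz b 0).prodMk ((hof b).prodMk (hz b 0))) rfl fun s hs => ?_
    exact (zeroExt_coe f.1 ⟨_, hs⟩).trans (H _ _ _ hs)
  · refine key ((hz τ 0).prodMk ((hz τ 0).prodMk (hof τ))) rfl fun s hs => ?_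
    exact (zeroExt_coe f.1 ⟨_, hs⟩).trans (H _ _ _ hs)

theorem AgreesAtReal.dE {f : smoothAlg V} {u : ℝ → ℝ → ℝ → ℝ} (H : AgreesAtReal f u) :
    AgreesAtReal (dirDer V (1, 1, 0) f) (dE u) := by
  intro a b τ h
  obtain ⟨h1, h2, -⟩ := H.partials h
  have : dirDer V (1, 1, 0) f = dirDer V (1, 0, 0) f + dirDer V (0, 1, 0) f := by
    rw [← dirDer_add]
    simp
  rw [this, _root_.dE, ofReal_add, ← h1, ← h2]
  rfl

theorem AgreesAtReal.dTau {f : smoothAlg V} {u : ℝ → ℝ → ℝ → ℝ} (H : AgreesAtReal f u) :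
    AgreesAtReal (dirDer V (0, 0, 1) f) (dTau u) := fun _ _ _ h => (H.partials h).2.2

theorem AgreesAtReal.eulerOp {f : smoothAlg V} {u : ℝ → ℝ → ℝ → ℝ} (H : AgreesAtReal f u) :
    AgreesAtReal (eulerDer V f) (eulerOp u) := by
  intro a b τ h
  obtain ⟨h1, h2, -⟩ := H.partials h
  rw [_root_.eulerOp, ofReal_add, ofReal_mul, ofReal_mul, ← h1, ← h2]
  rfl

theorem dirDer_two_tau (f : smoothAlg V) :
    dirDer V (0, 0, 2) f = (2 : ℂ) • dirDer V (0, 0, 1) f := by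
  have : ((0, 0, 2) : ℂ × ℂ × ℂ) = (2 : ℂ) • (0, 0, 1) := by simp
  rw [this]
  refine smoothAlg_ext fun x => ?_
  exact (fderiv ℂ (zeroExt V f.1) x).map_smul 2 _

/-- Evaluation at a point. -/
def evalAt (x : V) : smoothAlg V →ₐ[ℂ] ℂ := (Pi.evalAlgHom ℂ (fun _ : V => ℂ) x).comp (smoothAlg V).val

theorem evalAt_apply (x : V) (f : smoothAlg V) : evalAt x f = f.1 x := rfl

/-- The left hand side of the first equation. -/
def pdeExpr₁ (g : smoothAlg V) : smoothAlg V :=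
  let E := dirDer V (1, 1, 0)
  let T := dirDer V (0, 0, 2)
  E (E (E (E g))) + 6 * (E (E g)) ^ 2 - 4 * coordTau V * E (E g) + 3 * T (T g)

/-- The left hand side of the second equation. -/
def pdeExpr₂ (g : smoothAlg V) : smoothAlg V :=
  let E := dirDer V (1, 1, 0)
  let T := dirDer V (0, 0, 2);
  (-3) * eulerDer V (E g) - coordTau V * T (E g) + T (E (E (E g))) + E g + 6 * E (E g) * T (E g)

/-- The left hand side of the third equation. -/
def pdeExpr₃ (g : smoothAlg V) : smoothAlg V :=
  let E := dirDer V (1, 1, 0)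
  let T := dirDer V (0, 0, 2)
  6 * eulerDer V (T g) - 2 * eulerDer V (E (E g))
    + (2 * T (T g) + 2 * T (E (E g)) - 4 * E (E (E (E g))) - 8 * (E (E g)) ^ 2) * coordTau V
    + 4 * E (E g) + 16 * (E (E g)) ^ 3 + 4 * E (T g) * E (E (E g)) + 10 * (E (E (E g))) ^ 2
    + 16 * E (E (E (E g))) * E (E g) + E (E (E (E (E (E g))))) - 2 * T (T (T g))
    + T (T (E (E g))) - 6 * (E (T g)) ^ 2 - 4 * T (E (E g)) * E (E g) - 4 * T g

theorem pdeExpr_eq_zero_of_grid {n : ℕ} {g : smoothAlg V}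
    (hg : ∀ x : V, Complex.exp (g.1 x) = (1 - gridMat n x).det) :
    pdeExpr₁ g = 0 ∧ pdeExpr₂ g = 0 ∧ pdeExpr₃ g = 0 :=
  pearcey_equations_of_grid hg

theorem AgreesAtReal.pearceyPDE1 {g : smoothAlg V} {u : ℝ → ℝ → ℝ → ℝ} (H : AgreesAtReal g u)
    {a b t : ℝ} (h : ((a : ℂ), (b : ℂ), (t : ℂ)) ∈ V) (hg : evalAt ⟨_, h⟩ (pdeExpr₁ g) = 0) :
    PearceyPDE1 u a b t := by
  have ev : ∀ {f : smoothAlg V} {w : ℝ → ℝ → ℝ → ℝ}, AgreesAtReal f w →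
      evalAt ⟨_, h⟩ f = (w a b t : ℂ) := fun hf => hf _ _ _ h
  have hτ : evalAt ⟨_, h⟩ (coordTau V) = (t : ℂ) := rfl
  simp only [pdeExpr₁, dirDer_two_tau, Derivation.map_smul, map_smul, map_add, map_mul, map_sub,
    map_pow, map_ofNat, smul_eq_mul, hτ] at hg
  rw [ev H.dE.dE.dE.dE, ev H.dE.dE, ev H.dTau.dTau] at hg
  norm_cast at hg
  simp only [PearceyPDE1, Function.iterate_succ, Function.comp, Function.iterate_zero, id]
  linarith

theorem AgreesAtReal.pearceyPDE2 {g : smoothAlg V} {u : ℝ → ℝ → ℝ → ℝ} (H : AgreesAtReal g u)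
    {a b t : ℝ} (h : ((a : ℂ), (b : ℂ), (t : ℂ)) ∈ V) (hg : evalAt ⟨_, h⟩ (pdeExpr₂ g) = 0) :
    PearceyPDE2 u a b t := by
  have ev : ∀ {f : smoothAlg V} {w : ℝ → ℝ → ℝ → ℝ}, AgreesAtReal f w →
      evalAt ⟨_, h⟩ f = (w a b t : ℂ) := fun hf => hf _ _ _ h
  have hτ : evalAt ⟨_, h⟩ (coordTau V) = (t : ℂ) := rfl
  simp only [pdeExpr₂, dirDer_two_tau, map_smul, map_add, map_mul, map_sub,
    map_neg, map_ofNat, smul_eq_mul, hτ] at hg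
  rw [ev H.dE.eulerOp, ev H.dE.dTau, ev H.dE.dE.dE.dTau, ev H.dE, ev H.dE.dE] at hg
  simp only [PearceyPDE2, Function.iterate_succ, Function.comp, Function.iterate_zero, id]
  rw [← Complex.ofReal_inj]
  push_cast
  linear_combination hg

theorem AgreesAtReal.pearceyPDE3 {g : smoothAlg V} {u : ℝ → ℝ → ℝ → ℝ} (H : AgreesAtReal g u)
    {a b t : ℝ} (h : ((a : ℂ), (b : ℂ), (t : ℂ)) ∈ V) (hg : evalAt ⟨_, h⟩ (pdeExpr₃ g) = 0) :
    PearceyPDE3 u a b t := by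
  have ev : ∀ {f : smoothAlg V} {w : ℝ → ℝ → ℝ → ℝ}, AgreesAtReal f w →
      evalAt ⟨_, h⟩ f = (w a b t : ℂ) := fun hf => hf _ _ _ h
  have hτ : evalAt ⟨_, h⟩ (coordTau V) = (t : ℂ) := rfl
  have H3 : AgreesAtReal ((12 : ℂ) • dirDer V (0, 0, 1) g
      - (2 : ℂ) • dirDer V (1, 1, 0) (dirDer V (1, 1, 0) g))
      (fun a b τ => 12 * _root_.dTau u a b τ - 2 * _root_.dE (_root_.dE u) a b τ) := by
    intro a b τ h
    have e1 := H.dTau a b τ h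
    have e2 := H.dE.dE a b τ h
    push_cast
    rw [← e1, ← e2]
    rfl
  have e3 := ev H3.eulerOp
  rw [map_sub, Derivation.map_smul, Derivation.map_smul, map_sub, map_smul, map_smul,
    smul_eq_mul, smul_eq_mul] at e3
  simp only [pdeExpr₃, dirDer_two_tau, Derivation.map_smul, map_smul, map_add, map_mul, map_sub,
    map_pow, map_ofNat, smul_eq_mul, hτ] at hg
  rw [ev H.dTau.dTau, ev H.dE.dE.dTau, ev H.dE.dE.dE.dE, ev H.dE.dE,
    ev H.dTau.dE, ev H.dE.dE.dE, ev H.dE.dE.dE.dE.dE.dE, ev H.dTau.dTau.dTau,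
    ev H.dE.dE.dTau.dTau, ev H.dTau] at hg
  simp only [PearceyPDE3, Function.iterate_succ, Function.comp, Function.iterate_zero, id]
  rw [← Complex.ofReal_inj]
  push_cast
  rw [← e3]
  linear_combination hg

/-! ### Passage to the limit in the differential expressions. -/

section Limits

variable {F : ℕ → smoothAlg V} {f : smoothAlg V}

/-- Locally uniform convergence on `V`. -/
def SmoothTendsto (F : ℕ → smoothAlg V) (f : smoothAlg V) : Prop :=
  TendstoLocallyUniformlyOn (fun n => zeroExt V (F n).1) (zeroExt V f.1) atTop V

theorem SmoothTendsto.dirDer (h : SmoothTendsto F f) (v : ℂ × ℂ × ℂ) :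
    SmoothTendsto (fun n => dirDer V v (F n)) (dirDer V v f) :=
  tendstoLocallyUniformlyOn_dirDer v h

theorem SmoothTendsto.evalAt (h : SmoothTendsto F f) (x : V) :
    Tendsto (fun n => evalAt x (F n)) atTop (𝓝 (evalAt x f)) := by
  simpa [evalAt_apply] using h.tendsto_at x.2

theorem SmoothTendsto.evalAt_eulerDer (h : SmoothTendsto F f) (x : V) :
    Tendsto (fun n => _root_.evalAt x (eulerDer V (F n))) atTop
      (𝓝 (_root_.evalAt x (eulerDer V f))) := by
  simp only [eulerDer_apply, map_add, map_mul]
  exact ((h.dirDer _).evalAt x |>.const_mul _).add ((h.dirDer _).evalAt x |>.const_mul _)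

theorem SmoothTendsto.pdeExpr (h : SmoothTendsto F f) (x : V) :
    Tendsto (fun n => _root_.evalAt x (pdeExpr₁ (F n))) atTop (𝓝 (_root_.evalAt x (pdeExpr₁ f))) ∧
    Tendsto (fun n => _root_.evalAt x (pdeExpr₂ (F n))) atTop (𝓝 (_root_.evalAt x (pdeExpr₂ f))) ∧
    Tendsto (fun n => _root_.evalAt x (pdeExpr₃ (F n))) atTop
      (𝓝 (_root_.evalAt x (pdeExpr₃ f))) := by
  have hE := h.dirDer (1, 1, 0)
  have hE2 := hE.dirDer (1, 1, 0)
  have hE3 := hE2.dirDer (1, 1, 0)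
  have hE4 := hE3.dirDer (1, 1, 0)
  have hE6 := (hE4.dirDer (1, 1, 0)).dirDer (1, 1, 0)
  have hT := h.dirDer (0, 0, 2)
  have hTT := hT.dirDer (0, 0, 2)
  have hTE2 := hE2.dirDer (0, 0, 2)
  have c : ∀ z : ℂ, Tendsto (fun _ : ℕ => z) atTop (𝓝 z) := fun z => tendsto_const_nhds
  refine ⟨?_, ?_, ?_⟩
  · simp only [pdeExpr₁, map_add, map_mul, map_sub, map_pow, map_ofNat]
    exact (((hE4.evalAt x).add ((c _).mul ((hE2.evalAt x).pow 2))).sub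
      ((c _).mul (hE2.evalAt x))).add ((c _).mul (hTT.evalAt x))
  · simp only [pdeExpr₂, map_add, map_mul, map_sub, map_neg, map_ofNat]
    exact (((((c _).mul (hE.evalAt_eulerDer x)).sub ((c _).mul ((hE.dirDer _).evalAt x))).add
      ((hE3.dirDer _).evalAt x)).add (hE.evalAt x)).add
      (((c _).mul (hE2.evalAt x)).mul ((hE.dirDer _).evalAt x))
  · simp only [pdeExpr₃, map_add, map_mul, map_sub, map_pow, map_ofNat]
    exact ((((((((((((((c _).mul (hT.evalAt_eulerDer x)).sub ((c _).mul (hE2.evalAt_eulerDer x))).add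
      ((((((c _).mul (hTT.evalAt x)).add ((c _).mul (hTE2.evalAt x))).sub
        ((c _).mul (hE4.evalAt x))).sub ((c _).mul ((hE2.evalAt x).pow 2))).mul (c _))).add
      ((c _).mul (hE2.evalAt x))).add ((c _).mul ((hE2.evalAt x).pow 3))).add
      (((c _).mul ((hT.dirDer _).evalAt x)).mul (hE3.evalAt x))).add
      ((c _).mul ((hE3.evalAt x).pow 2))).add (((c _).mul (hE4.evalAt x)).mul (hE2.evalAt x))).add
      (hE6.evalAt x)).sub ((c _).mul ((hTT.dirDer _).evalAt x))).add
      ((hTE2.dirDer _).evalAt x)).sub ((c _).mul (((hT.dirDer _).evalAt x).pow 2))).sub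
      (((c _).mul (hTE2.evalAt x)).mul (hE2.evalAt x))).sub ((c _).mul (hT.evalAt x))

end Limits

end RealPoints

theorem contDiffOn_clog_of_re_pos {g : ℂ × ℂ × ℂ → ℂ} (hg : ContDiff ℂ ∞ g) {s : Set (ℂ × ℂ × ℂ)}
    (h : ∀ p ∈ s, 0 < (g p).re) : ContDiffOn ℂ ∞ (fun p => log (g p)) s := fun p hp =>
  ((contDiffAt_log (Or.inl (h p hp))).comp p hg.contDiffAt).contDiffWithinAt

/-- The mean value inequality on the convex half plane re > δ, where |1/z| ≤ 1/δ. -/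
theorem norm_log_sub_log_le {δ : ℝ} (hδ : 0 < δ) {z w : ℂ} (hz : δ < z.re) (hw : δ < w.re) :
    ‖log z - log w‖ ≤ δ⁻¹ * ‖z - w‖ := by
  have hc : Convex ℝ {z : ℂ | δ < z.re} := convex_halfSpace_re_gt δ
  refine hc.norm_image_sub_le_of_norm_hasDerivWithin_le (f' := fun z => z⁻¹)
    (fun x hx => (hasDerivAt_log (Or.inl (hδ.trans hx))).hasDerivWithinAt) (fun x hx => ?_) hw hz
  rw [norm_inv]
  exact inv_anti₀ hδ ((le_of_lt hx).trans (re_le_norm x))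

/-- Work near one real point. On V the limit and all late approximants have real part above δ, so
principal logarithms are holomorphic and depend on the determinants in a uniformly Lipschitz way.
The equations hold for each approximant and survive the limit. -/
theorem pearceyLogDet_pdes
    (hpos : ∀ a b τ : ℝ, a < b → (pearceyDet a b τ).im = 0 ∧ 0 < (pearceyDet a b τ).re)
    {a b τ : ℝ} (hab : a < b) :
    PearceyPDE1 pearceyLogDet a b τ ∧ PearceyPDE2 pearceyLogDet a b τ ∧
      PearceyPDE3 pearceyLogDet a b τ := by
  set p₀ : ℂ × ℂ × ℂ := ((a : ℂ), (b : ℂ), (τ : ℂ)) with hp₀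
  have hD₀ : 0 < (pearceyDetC p₀).re := by
    rw [hp₀, ← pearceyDet_eq _ _ _ hab]
    exact (hpos _ _ _ hab).2
  -- Real part above 2δ for the limit and an error below δ leave real part above δ for the
  -- approximants.
  set δ : ℝ := (pearceyDetC p₀).re / 3 with hδ
  have hδ0 : 0 < δ := by positivity
  obtain ⟨t, ht, hN⟩ := Metric.tendstoLocallyUniformlyOn_iff.mp
    tendstoLocallyUniformlyOn_det_gridMat δ hδ0 p₀ trivial
  obtain ⟨N, hN⟩ := eventually_atTop.mp hN
  rw [nhdsWithin_univ] at ht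
  have hDc : Continuous fun p => (pearceyDetC p).re :=
    continuous_re.comp contDiff_pearceyDetC.continuous
  have hlt : Continuous fun p : ℂ × ℂ × ℂ => (p.2.1 - p.1).re := by fun_prop
  have hU : {p | 2 * δ < (pearceyDetC p).re} ∩ {p : ℂ × ℂ × ℂ | 0 < (p.2.1 - p.1).re} ∩ interior t
      ∈ 𝓝 p₀ := by
    refine inter_mem (inter_mem ?_ ?_) (interior_mem_nhds.mpr ht)
    · refine (isOpen_lt continuous_const hDc).mem_nhds ?_
      change 2 * δ < (pearceyDetC p₀).re
      linarith
    · refine (isOpen_lt continuous_const hlt).mem_nhds ?_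
      change 0 < ((b : ℂ) - a).re
      simpa using hab
  let V : Opens (ℂ × ℂ × ℂ) := ⟨{p | 2 * δ < (pearceyDetC p).re} ∩
    {p : ℂ × ℂ × ℂ | 0 < (p.2.1 - p.1).re} ∩ interior t, ((isOpen_lt continuous_const hDc).inter
    (isOpen_lt continuous_const hlt)).inter (isOpen_interior (s := t))⟩
  have hV : p₀ ∈ V := mem_of_mem_nhds hU
  have hV1 : ∀ p ∈ V, δ < (pearceyDetC p).re := fun p hp => by
    have : 2 * δ < (pearceyDetC p).re := hp.1.1
    linarith
  have hV2 : ∀ n, ∀ p ∈ V, δ < ((1 - gridMat (n + N) p).det).re := fun n p hp => by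
    have h1 : 2 * δ < (pearceyDetC p).re := hp.1.1
    have h2 := hN (n + N) (Nat.le_add_left _ _) p (interior_subset hp.2)
    rw [dist_eq_norm] at h2
    have h3 := (re_le_norm _).trans_lt h2
    rw [sub_re] at h3
    linarith
  let f : smoothAlg V := smoothAlg.mk (fun p => log (pearceyDetC p))
    (contDiffOn_clog_of_re_pos contDiff_pearceyDetC fun p hp => hδ0.trans (hV1 p hp))
  let F : ℕ → smoothAlg V := fun n => smoothAlg.mk (fun p => log (1 - gridMat (n + N) p).det)
    (contDiffOn_clog_of_re_pos (contDiff_det_gridMat _) fun p hp => hδ0.trans (hV2 n p hp))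
  have hF : SmoothTendsto F f := by
    suffices h : TendstoLocallyUniformlyOn (fun n p => log (1 - gridMat (n + N) p).det)
        (fun p => log (pearceyDetC p)) atTop (V : Set _) from
      (h.congr fun n => (eqOn_zeroExt_restrict _).symm).congr_right
        (eqOn_zeroExt_restrict _).symm
    have h0 := tendstoLocallyUniformlyOn_det_gridMat.mono (Set.subset_univ (V : Set _))
    rw [Metric.tendstoLocallyUniformlyOn_iff] at h0 ⊢
    intro ε hε x hx
    obtain ⟨s, hs, hs'⟩ := h0 (δ * ε) (by positivity) x hx
    refine ⟨s ∩ V, inter_mem hs self_mem_nhdsWithin, ?_⟩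
    filter_upwards [(tendsto_add_atTop_nat N).eventually hs'] with n hn y hy
    have h1 := hn y hy.1
    rw [dist_eq_norm] at h1 ⊢
    calc _ ≤ δ⁻¹ * _ := norm_log_sub_log_le hδ0 (hV1 y hy.2) (hV2 n y hy.2)
      _ < δ⁻¹ * (δ * ε) := by gcongr
      _ = ε := inv_mul_cancel_left₀ hδ0.ne' ε
  have hz : ∀ n, pdeExpr₁ (F n) = 0 ∧ pdeExpr₂ (F n) = 0 ∧ pdeExpr₃ (F n) = 0 := fun n =>
    pdeExpr_eq_zero_of_grid fun x => exp_log fun h0 => by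
      have := hV2 n x x.2
      rw [h0, zero_re] at this
      linarith
  obtain ⟨h1, h2, h3⟩ := hF.pdeExpr ⟨p₀, hV⟩
  simp only [(hz _).1, (hz _).2.1, (hz _).2.2, map_zero] at h1 h2 h3
  have hag : AgreesAtReal f pearceyLogDet := by
    intro a b τ h
    have hlt : a < b := by
      have : 0 < ((b : ℂ) - a).re := h.1.2
      simpa using this
    obtain ⟨him, hre⟩ := hpos a b τ hlt
    change log (pearceyDetC _) = _
    rw [← pearceyDet_eq _ _ _ hlt, pearceyLogDet, ofReal_log hre.le]
    congr 1
    exact Complex.ext rfl him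
  exact ⟨hag.pearceyPDE1 hV (tendsto_nhds_unique h1 tendsto_const_nhds),
    hag.pearceyPDE2 hV (tendsto_nhds_unique h2 tendsto_const_nhds),
    hag.pearceyPDE3 hV (tendsto_nhds_unique h3 tendsto_const_nhds)⟩

/-- The witness is τ itself. Every term of (1) and (2) contains ∂_E or ∂_τ², while the term -8∂_τ g
of (3) survives. -/
theorem exists_pearceyPDE1_pearceyPDE2_not_pearceyPDE3 :
    ∃ u : ℝ → ℝ → ℝ → ℝ, SmoothOnIntervals u ∧
      (∀ a b τ : ℝ, a < b → PearceyPDE1 u a b τ ∧ PearceyPDE2 u a b τ) ∧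
      ∃ a b τ : ℝ, a < b ∧ ¬ PearceyPDE3 u a b τ := by
  have hE : dE (fun _ _ τ => τ) = fun _ _ _ => 0 := by
    ext a b τ
    simp [dE]
  have hT : dTau (fun _ _ τ => τ) = fun _ _ _ => 1 := by
    ext a b τ
    simp [dTau]
  have hE0 : ∀ c : ℝ, dE (fun _ _ _ => c) = fun _ _ _ => 0 := fun c => by
    ext a b τ
    simp [dE]
  have hT0 : ∀ c : ℝ, dTau (fun _ _ _ => c) = fun _ _ _ => 0 := fun c => by
    ext a b τ
    simp [dTau]
  refine ⟨fun _ _ τ => τ, (contDiff_snd.comp contDiff_snd).contDiffOn, fun a b τ _ => ⟨?_, ?_⟩,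
    0, 1, 0, one_pos, ?_⟩
  · simp [PearceyPDE1, hE, hT, hE0, hT0]
  · simp [PearceyPDE2, hE, hE0, hT0, eulerOp]
  · simp [PearceyPDE3, hE, hT, hE0, hT0, eulerOp]

end PearceyDetComplex

end

noncomputable section

/-! ### Gap probabilities of biorthogonal ensembles. -/

section BiorthogonalEnsemble

open MeasureTheory Filter Topology Matrix

variable {N : ℕ}

/-- Andréief's identity: after expanding both determinants the integral factors over coordinates,
and each of the N! permutations in the second expansion contributes the same determinant. -/
theorem integral_det_mul_det {m : Measure ℝ} [SigmaFinite m] {u v : Fin N → ℝ → ℝ}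
    (h : ∀ k l, Integrable (fun x => u k x * v l x) m) :
    Integrable (fun x : Fin N → ℝ => (of fun k j => u k (x j)).det * (of fun k j => v k (x j)).det)
      (Measure.pi fun _ => m) ∧
    ∫ x : Fin N → ℝ, (of fun k j => u k (x j)).det * (of fun k j => v k (x j)).det
      ∂(Measure.pi fun _ => m) = (N ! : ℝ) * (of fun k l => ∫ x, u k x * v l x ∂m).det := by
  have hexp : (fun x : Fin N → ℝ => (of fun k j => u k (x j)).det * (of fun k j => v k (x j)).det)
      = fun x => ∑ τ : Equiv.Perm (Fin N), ∑ σ : Equiv.Perm (Fin N),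
        ((Equiv.Perm.sign σ : ℤ) : ℝ) * ((Equiv.Perm.sign τ : ℤ) : ℝ)
          * ∏ j, (u (σ j) (x j) * v (τ j) (x j)) := by
    ext x
    rw [det_apply', det_apply', Finset.sum_mul_sum, Finset.sum_comm]
    refine Finset.sum_congr rfl fun τ _ => Finset.sum_congr rfl fun σ _ => ?_
    rw [Finset.prod_mul_distrib]
    simp only [of_apply]
    ring
  have hint : ∀ τ σ : Equiv.Perm (Fin N), Integrable (fun x : Fin N → ℝ =>
      ((Equiv.Perm.sign σ : ℤ) : ℝ) * ((Equiv.Perm.sign τ : ℤ) : ℝ)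
        * ∏ j, (u (σ j) (x j) * v (τ j) (x j))) (Measure.pi fun _ => m) := fun τ σ =>
    (Integrable.fintype_prod (f := fun j x => u (σ j) x * v (τ j) x)
      fun j => h (σ j) (τ j)).const_mul _
  rw [hexp]
  refine ⟨integrable_finsetSum _ fun τ _ => integrable_finsetSum _ fun σ _ => hint τ σ, ?_⟩
  rw [integral_finsetSum _ fun τ _ => integrable_finsetSum _ fun σ _ => hint τ σ]
  have hτ : ∀ τ : Equiv.Perm (Fin N), ∫ x : Fin N → ℝ, ∑ σ : Equiv.Perm (Fin N),
      ((Equiv.Perm.sign σ : ℤ) : ℝ) * ((Equiv.Perm.sign τ : ℤ) : ℝ)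
        * ∏ j, (u (σ j) (x j) * v (τ j) (x j)) ∂(Measure.pi fun _ => m)
      = (of fun k l => ∫ x, u k x * v l x ∂m).det := fun τ => by
    rw [integral_finsetSum _ fun σ _ => hint τ σ]
    have h1 : ∀ σ : Equiv.Perm (Fin N), ∫ x : Fin N → ℝ,
        ((Equiv.Perm.sign σ : ℤ) : ℝ) * ((Equiv.Perm.sign τ : ℤ) : ℝ)
          * ∏ j, (u (σ j) (x j) * v (τ j) (x j)) ∂(Measure.pi fun _ => m)
        = ((Equiv.Perm.sign τ : ℤ) : ℝ) * (((Equiv.Perm.sign σ : ℤ) : ℝ)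
          * ∏ j, ((of fun k l => ∫ x, u k x * v l x ∂m).submatrix id τ) (σ j) j) := fun σ => by
      rw [integral_const_mul, integral_fintype_prod_eq_prod (fun j x => u (σ j) x * v (τ j) x)]
      simp only [submatrix_apply, of_apply, id]
      ring
    rw [Finset.sum_congr rfl fun σ _ => h1 σ, ← Finset.mul_sum, ← det_apply', det_permute',
      ← mul_assoc]
    rcases Int.units_eq_one_or (Equiv.Perm.sign τ) with h | h <;> simp [h]
  rw [Finset.sum_congr rfl fun τ _ => hτ τ, Finset.sum_const, Finset.card_univ,
    Fintype.card_perm, Fintype.card_fin, nsmul_eq_mul]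

theorem convex_setOf_strictMono : Convex ℝ {x : Fin N → ℝ | StrictMono x} := by
  intro x hx y hy s t hs ht hst i j hij
  have h1 := hx hij
  have h2 := hy hij
  simp only [Pi.add_apply, Pi.smul_apply, smul_eq_mul]
  rcases hs.eq_or_lt with rfl | hs
  · have : t = 1 := by linarith
    simpa [this] using h2
  · nlinarith [mul_lt_mul_of_pos_left h1 hs, mul_le_mul_of_nonneg_left h2.le ht]

theorem continuous_det_of_apply {u : Fin N → ℝ → ℝ} (hu : ∀ k, Continuous (u k)) :
    Continuous fun x : Fin N → ℝ => (of fun k j => u k (x j)).det :=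
  Continuous.matrix_det (continuous_matrix fun k j => (hu k).comp (continuous_apply j))

/-- The product is symmetric and vanishes at coinciding points, so only increasing configurations
matter. These form a convex set on which it has no zero. -/
theorem det_mul_det_const_sign {u v : Fin N → ℝ → ℝ} (hu : ∀ k, Continuous (u k))
    (hv : ∀ k, Continuous (v k))
    (hu0 : ∀ x : Fin N → ℝ, StrictMono x → (of fun k j => u k (x j)).det ≠ 0)
    (hv0 : ∀ x : Fin N → ℝ, StrictMono x → (of fun k j => v k (x j)).det ≠ 0) :
    (∀ x : Fin N → ℝ, 0 ≤ (of fun k j => u k (x j)).det * (of fun k j => v k (x j)).det) ∨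
    (∀ x : Fin N → ℝ, (of fun k j => u k (x j)).det * (of fun k j => v k (x j)).det ≤ 0) := by
  set g : (Fin N → ℝ) → ℝ := fun x =>
    (of fun k j => u k (x j)).det * (of fun k j => v k (x j)).det with hg
  have hgc : Continuous g := (continuous_det_of_apply hu).mul (continuous_det_of_apply hv)
  have hperm : ∀ (x : Fin N → ℝ) (σ : Equiv.Perm (Fin N)), g (x ∘ σ) = g x := fun x σ => by
    have h1 : ∀ f : Fin N → ℝ → ℝ, (of fun k j => f k ((x ∘ σ) j)).det
        = ((Equiv.Perm.sign σ : ℤ) : ℝ) * (of fun k j => f k (x j)).det := fun f => by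
      rw [← det_permute']
      rfl
    simp only [hg, h1]
    rcases Int.units_eq_one_or (Equiv.Perm.sign σ) with h | h <;> simp [h]
  have hsort : ∀ x : Fin N → ℝ, g x = 0 ∨ ∃ y : Fin N → ℝ, StrictMono y ∧ g x = g y := fun x => by
    by_cases hx : Function.Injective x
    · exact Or.inr ⟨x ∘ Tuple.sort x, (Tuple.monotone_sort x).strictMono_of_injective
        (hx.comp (Tuple.sort x).injective), (hperm _ _).symm⟩
    · left
      rw [Function.Injective] at hx
      push Not at hx
      obtain ⟨i, j, hij, hne⟩ := hx
      have : (of fun k j => u k (x j)).det = 0 := det_zero_of_column_eq hne fun k => by simp [hij]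
      simp [hg, this]
  by_contra! hcon
  obtain ⟨⟨x, hx⟩, y, hy⟩ := hcon
  obtain h0 | ⟨x', hx', hxx⟩ := hsort x
  · exact hx.ne h0
  obtain h0 | ⟨y', hy', hyy⟩ := hsort y
  · exact hy.ne' h0
  obtain ⟨z, hz, hz0⟩ := convex_setOf_strictMono.isPreconnected.intermediate_value hx' hy'
    hgc.continuousOn ⟨hxx.symm.trans_le hx.le, hy.le.trans_eq hyy⟩
  exact mul_ne_zero (hu0 z hz) (hv0 z hz) hz0

/-- The gap probability of a biorthogonal ensemble. -/
def gapDet (u v : Fin N → ℝ → ℝ) (a b : ℝ) : ℝ :=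
  (1 - of fun k l => ∫ x in Set.Icc a b, u k x * v l x).det

/-- By Andréief's identity, N! times the gap determinant is the integral of the product of
determinants over configurations avoiding [a, b]. Biorthogonality gives total mass N!, which decides
the sign of the product, and the domain shrinks as b grows. -/
theorem gapDet_nonneg_and_antitone {u v : Fin N → ℝ → ℝ} (hu : ∀ k, Continuous (u k))
    (hv : ∀ k, Continuous (v k)) (hint : ∀ k l, Integrable fun x => u k x * v l x)
    (hbi : ∀ k l, ∫ x, u k x * v l x = if k = l then 1 else 0)
    (hu0 : ∀ x : Fin N → ℝ, StrictMono x → (of fun k j => u k (x j)).det ≠ 0)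
    (hv0 : ∀ x : Fin N → ℝ, StrictMono x → (of fun k j => v k (x j)).det ≠ 0) (a : ℝ) :
    (∀ b, 0 ≤ gapDet u v a b) ∧ Antitone (gapDet u v a) := by
  have hf : (0 : ℝ) < (N ! : ℝ) := by exact_mod_cast N.factorial_pos
  have hgap : ∀ b, (N ! : ℝ) * gapDet u v a b = ∫ x in Set.univ.pi fun _ : Fin N => (Set.Icc a b)ᶜ,
      (of fun k j => u k (x j)).det * (of fun k j => v k (x j)).det := fun b => by
    rw [volume_pi, Measure.restrict_pi_pi, (integral_det_mul_det
      fun k l => (hint k l).integrableOn).2, gapDet]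
    congr 2
    ext k l
    have := integral_add_compl (measurableSet_Icc (a := a) (b := b)) (hint k l)
    rw [hbi] at this
    simp only [Matrix.sub_apply, of_apply, one_apply]
    linarith
  obtain ⟨hI, htot⟩ := integral_det_mul_det hint
  rw [← volume_pi] at hI htot
  have hone : (of fun k l => ∫ x, u k x * v l x) = (1 : Matrix (Fin N) (Fin N) ℝ) := by
    ext k l
    rw [of_apply, hbi, one_apply]
  rw [hone, det_one, mul_one] at htot
  have hpos : ∀ x : Fin N → ℝ,
      0 ≤ (of fun k j => u k (x j)).det * (of fun k j => v k (x j)).det := by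
    rcases det_mul_det_const_sign hu hv hu0 hv0 with h | h
    · exact h
    · have := integral_nonpos (μ := volume) h
      linarith
  refine ⟨fun b => ?_, fun b b' hbb => ?_⟩
  · refine nonneg_of_mul_nonneg_right (a := (N ! : ℝ)) ?_ hf
    rw [hgap]
    exact integral_nonneg hpos
  · refine le_of_mul_le_mul_left (a := (N ! : ℝ)) ?_ hf
    rw [hgap, hgap]
    refine setIntegral_mono_set hI.integrableOn (.of_forall hpos) (.of_forall fun x hx => ?_)
    exact fun i _ => Set.compl_subset_compl.mpr (Set.Icc_subset_Icc_right hbb) (hx i trivial)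

theorem tendsto_riemann_sum_Icc {f : ℝ → ℂ} (hf : Continuous f) :
    Tendsto (fun n : ℕ => (∑ i : Fin n, f (((i : ℕ) : ℝ) / n)) / n) atTop
      (𝓝 (∫ x in Set.Icc (0 : ℝ) 1, f x)) := by
  have h := tendsto_riemann_sum_cube (j := 1) (F := fun x => f (x 0))
    (hf.comp (continuous_apply 0))
  have e1 : ∫ x in Set.univ.pi fun _ : Fin 1 => Set.Icc (0 : ℝ) 1, f (x 0)
      = ∫ x in Set.Icc (0 : ℝ) 1, f x := by
    have hp := (volume_preserving_funUnique (Fin 1) ℝ).setIntegral_preimage_emb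
      (MeasurableEquiv.funUnique (Fin 1) ℝ).measurableEmbedding f (Set.Icc 0 1)
    rw [← hp]
    congr 2
    ext x
    simp only [Set.mem_univ_pi, Fin.forall_fin_one, Set.mem_preimage]
    rfl
  rw [e1] at h
  refine h.congr fun n => ?_
  rw [pow_one]
  congr 1
  exact Fintype.sum_equiv (Equiv.funUnique (Fin 1) (Fin n)) _ _ fun g => rfl

theorem setIntegral_Icc_affine {a b : ℝ} (hab : a < b) (f : ℝ → ℂ) :
    ∫ x in Set.Icc a b, f x
      = ((b - a : ℝ) : ℂ) * ∫ s in Set.Icc (0 : ℝ) 1, f (a + (b - a) * s) := by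
  have h := intervalIntegral.integral_comp_mul_add (a := 0) (b := 1) f (sub_pos.mpr hab).ne' a
  rw [mul_zero, zero_add, mul_one, sub_add_cancel, intervalIntegral.integral_of_le zero_le_one,
    intervalIntegral.integral_of_le hab.le, ← integral_Icc_eq_integral_Ioc,
    ← integral_Icc_eq_integral_Ioc] at h
  have hne : ((b - a : ℝ) : ℂ) ≠ 0 := by exact_mod_cast (sub_pos.mpr hab).ne'
  simp only [add_comm a]
  rw [h, Complex.real_smul, ← mul_assoc, Complex.ofReal_inv, mul_inv_cancel₀ hne, one_mul]

/-- The discretized kernel factors as AB through N dimensions. As det(1 - AB) = det(1 - BA), only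
the N × N matrix BA is left, and its entries are Riemann sums. -/
theorem fredholmDet_sum_mul {u v : Fin N → ℝ → ℝ} (hu : ∀ k, Continuous (u k))
    (hv : ∀ k, Continuous (v k)) {a b : ℝ} (hab : a < b) :
    fredholmDet (fun x y => ((∑ k, u k x * v k y : ℝ) : ℂ)) a b = (gapDet u v a b : ℂ) := by
  rw [fredholmDet_eq_unit_interval _ hab]
  have hc : Continuous fun p : ℝ × ℝ => ((b - a : ℝ) : ℂ) *
      ((∑ k, u k (a + (b - a) * p.1) * v k (a + (b - a) * p.2) : ℝ) : ℂ) := by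
    refine continuous_const.mul (Complex.continuous_ofReal.comp ?_)
    refine continuous_finsetSum _ fun k _ => ((hu k).comp ?_).mul ((hv k).comp ?_) <;> fun_prop
  refine tendsto_nhds_unique (tendsto_det_one_sub_fredholmDet hc) ?_
  let A : ∀ n : ℕ, Matrix (Fin n) (Fin N) ℂ := fun n =>
    of fun i k => ((u k (a + (b - a) * (((i : ℕ) : ℝ) / n)) : ℝ) : ℂ)
  let B : ∀ n : ℕ, Matrix (Fin N) (Fin n) ℂ := fun n =>
    of fun k i => ((b - a : ℝ) : ℂ) / n * ((v k (a + (b - a) * (((i : ℕ) : ℝ) / n)) : ℝ) : ℂ)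
  have hAB : ∀ n : ℕ, (of fun i l : Fin n => ((b - a : ℝ) : ℂ) *
      ((∑ k, u k (a + (b - a) * (((i : ℕ) : ℝ) / n)) * v k (a + (b - a) * (((l : ℕ) : ℝ) / n)) : ℝ)
        : ℂ) / n) = A n * B n := fun n => by
    ext i l
    simp only [of_apply, mul_apply, A, B]
    push_cast
    rw [Finset.mul_sum, Finset.sum_div]
    exact Finset.sum_congr rfl fun k _ => by ring
  have hBA : Tendsto (fun n => B n * A n) atTop
      (𝓝 (of fun k l => ((∫ x in Set.Icc a b, u l x * v k x : ℝ) : ℂ))) := by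
    refine tendsto_pi_nhds.mpr fun k => tendsto_pi_nhds.mpr fun l => ?_
    have h := (tendsto_riemann_sum_Icc (f := fun s =>
      ((u l (a + (b - a) * s) * v k (a + (b - a) * s) : ℝ) : ℂ)) (by
        refine Complex.continuous_ofReal.comp (((hu l).comp ?_).mul ((hv k).comp ?_)) <;>
        fun_prop)).const_mul ((b - a : ℝ) : ℂ)
    rw [← setIntegral_Icc_affine hab (fun x => ((u l x * v k x : ℝ) : ℂ)),
      show ∫ x in Set.Icc a b, ((u l x * v k x : ℝ) : ℂ) = _ from integral_ofReal] at h
    refine h.congr fun n => ?_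
    simp only [mul_apply, A, B, of_apply]
    push_cast
    rw [Finset.sum_div, Finset.mul_sum]
    exact Finset.sum_congr rfl fun i _ => by ring
  have hlim : Tendsto (fun n => (1 - B n * A n).det) atTop
      (𝓝 (1 - of fun k l => ((∫ x in Set.Icc a b, u l x * v k x : ℝ) : ℂ)).det) := by
    have hcont : Continuous fun M : Matrix (Fin N) (Fin N) ℂ => (1 - M).det :=
      Continuous.matrix_det (continuous_const.sub continuous_id)
    exact (hcont.tendsto _).comp hBA
  have hval : (1 - of fun k l => ((∫ x in Set.Icc a b, u l x * v k x : ℝ) : ℂ)).det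
      = (gapDet u v a b : ℂ) := by
    rw [gapDet, ← det_transpose]
    have := (Complex.ofRealHom).map_det (1 - of fun k l => ∫ x in Set.Icc a b, u k x * v l x)
    refine Eq.trans ?_ this.symm
    congr 1
    ext k l
    by_cases h : k = l
    · subst h
      simp
    · simp [h, Ne.symm h]
  rw [← hval]
  refine hlim.congr fun n => ?_
  rw [hAB, det_one_sub_mul_comm]

end BiorthogonalEnsemble

end

noncomputable section

/-! ### Chebyshev systems: exponentials and polynomials. -/

section ChebyshevSystems

open Matrix Polynomial

theorem StrictMono.exists_rolle {N : ℕ} {f f' : ℝ → ℝ} (hf : ∀ t, HasDerivAt f (f' t) t)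
    {x : Fin (N + 1) → ℝ} (hx : StrictMono x) (h0 : ∀ j, f (x j) = 0) :
    ∃ y : Fin N → ℝ, StrictMono y ∧ ∀ j, f' (y j) = 0 := by
  have h : ∀ j : Fin N, ∃ t ∈ Set.Ioo (x j.castSucc) (x j.succ), f' t = 0 := fun j =>
    exists_hasDerivAt_eq_zero (hx j.castSucc_lt_succ)
      (fun t _ => (hf t).continuousAt.continuousWithinAt) (by rw [h0, h0]) fun t _ => hf t
  choose y hy hy0 using h
  refine ⟨y, ?_, hy0⟩
  cases N with
  | zero => exact fun i => i.elim0
  | succ n =>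
    exact Fin.strictMono_iff_lt_succ.mpr fun i =>
      (hy i.castSucc).2.trans_le (hy i.succ).1.le

/-- An exponential sum with as many terms as distinct real zeros vanishes. -/
theorem eq_zero_of_exp_sum_eq_zero : ∀ {N : ℕ} {α c x : Fin N → ℝ}, Function.Injective α →
    StrictMono x → (∀ j, ∑ k, c k * Real.exp (α k * x j) = 0) → c = 0
  | 0, _, _, _, _, _, _ => Subsingleton.elim _ _
  | N + 1, α, c, x, hα, hx, h => by
    -- Dividing by one exponential makes its term constant; Rolle then leaves N zeros for a sum of N
    -- exponentials.
    let f : ℝ → ℝ := fun t => ∑ k, c k * Real.exp ((α k - α 0) * t)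
    let f' : ℝ → ℝ := fun t => ∑ k, c k * (Real.exp ((α k - α 0) * t) * (α k - α 0))
    have hf : ∀ t, HasDerivAt f (f' t) t := fun t =>
      HasDerivAt.fun_sum fun k _ => ((by simpa using ((hasDerivAt_id t).const_mul (α k - α 0)) :
        HasDerivAt (fun t => (α k - α 0) * t) (α k - α 0) t).exp).const_mul _
    have h0 : ∀ j, f (x j) = 0 := fun j => by
      have : f (x j) = (∑ k, c k * Real.exp (α k * x j)) * Real.exp (-(α 0 * x j)) := by
        rw [Finset.sum_mul]
        refine Finset.sum_congr rfl fun k _ => ?_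
        rw [mul_assoc, ← Real.exp_add]
        ring_nf
      rw [this, h, zero_mul]
    obtain ⟨y, hy, hy0⟩ := hx.exists_rolle hf h0
    have hs : (fun k : Fin N => c k.succ * (α k.succ - α 0)) = 0 := by
      refine eq_zero_of_exp_sum_eq_zero (α := fun k => α k.succ - α 0)
        (fun i j hij => Fin.succ_injective _ (hα (sub_left_injective hij))) hy fun j => ?_
      have := hy0 j
      simp only [f', Fin.sum_univ_succ, sub_self, mul_zero, zero_add] at this
      rw [← this]
      exact Finset.sum_congr rfl fun k _ => by ring
    have hsucc : ∀ k : Fin N, c k.succ = 0 := fun k => by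
      have h1 : c k.succ * (α k.succ - α 0) = 0 := congrFun hs k
      refine (mul_eq_zero.mp h1).resolve_right (sub_ne_zero.mpr fun h2 => ?_)
      exact Fin.succ_ne_zero k (hα h2)
    have hz := h 0
    rw [Fin.sum_univ_succ] at hz
    simp only [hsucc, zero_mul, Finset.sum_const_zero, add_zero] at hz
    ext k
    refine Fin.cases ?_ hsucc k
    exact (mul_eq_zero.mp hz).resolve_right (Real.exp_pos _).ne'

theorem det_exp_ne_zero {N : ℕ} {α : Fin N → ℝ} (hα : Function.Injective α) {x : Fin N → ℝ}
    (hx : StrictMono x) : (of fun k j => Real.exp (α k * x j)).det ≠ 0 := by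
  intro h
  obtain ⟨c, hc, h0⟩ := exists_vecMul_eq_zero_iff.mpr h
  exact hc (eq_zero_of_exp_sum_eq_zero hα hx fun j => congrFun h0 j)

/-- A row dependence would be a polynomial of degree below N with N distinct zeros. -/
theorem det_eval_mul_ne_zero {N : ℕ} {P : Fin N → ℝ[X]} {w : ℝ → ℝ} (hw : ∀ x, w x ≠ 0)
    (hP : ∀ k, P k ∈ degreeLT ℝ N) (hind : LinearIndependent ℝ P) {x : Fin N → ℝ}
    (hx : StrictMono x) : (of fun k j => (P k).eval (x j) * w (x j)).det ≠ 0 := by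
  intro h
  obtain ⟨c, hc, h0⟩ := exists_vecMul_eq_zero_iff.mpr h
  have hQ : ∑ k, c k • P k = 0 := by
    refine eq_zero_of_degree_lt_of_eval_finset_eq_zero (Finset.univ.image x) ?_ fun y hy => ?_
    · rw [Finset.card_image_of_injective _ hx.injective, Finset.card_univ, Fintype.card_fin,
        ← mem_degreeLT]
      exact sum_mem fun k _ => Submodule.smul_mem _ _ (hP k)
    · obtain ⟨j, -, rfl⟩ := Finset.mem_image.mp hy
      have : (∑ k, c k * (P k).eval (x j)) * w (x j) = 0 := by
        refine Eq.trans ?_ (congrFun h0 j)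
        rw [Finset.sum_mul]
        exact Finset.sum_congr rfl fun k _ => mul_assoc _ _ _
      simpa [eval_finsetSum, hw] using this
  exact hc (funext (Fintype.linearIndependent_iff.mp hind c hQ))

end ChebyshevSystems

/-! ### Differential operators applied to the heat kernel. -/

section HeatPolynomials

open Polynomial MeasureTheory

/-- The operator on polynomials that corresponds to differentiation of `Q(y) e^{-y²/(4c)}`. -/
def heatOp (c : ℝ) : Module.End ℝ ℝ[X] := derivative - (1 / (2 * c)) • LinearMap.mulLeft ℝ X

/-- The polynomial `Q` such that `P(∂)` maps the heat kernel to `Q(y) e^{-y²/(4c)}`. -/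
def heatPoly (c : ℝ) (P : ℝ[X]) : ℝ[X] := aeval (heatOp c) P (C (√(Real.pi / c) / (2 * Real.pi)))

theorem heatPoly_add (c : ℝ) (P Q : ℝ[X]) : heatPoly c (P + Q) = heatPoly c P + heatPoly c Q := by
  rw [heatPoly, map_add]
  rfl

theorem heatPoly_C (c a : ℝ) :
    heatPoly c (C a) = C (a * (√(Real.pi / c) / (2 * Real.pi))) := by
  rw [heatPoly, aeval_C, Module.algebraMap_end_apply, smul_C, smul_eq_mul]

theorem heatPoly_mul_X (c : ℝ) (P : ℝ[X]) : heatPoly c (P * X) = heatOp c (heatPoly c P) := by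
  rw [heatPoly, mul_comm, map_mul, aeval_X]
  rfl

theorem heatOp_eval (c : ℝ) (Q : ℝ[X]) (y : ℝ) :
    (heatOp c Q).eval y = (derivative Q).eval y - 1 / (2 * c) * (y * Q.eval y) := by
  simp [heatOp]

theorem hasDerivAt_eval_mul_gauss {c : ℝ} (hc : c ≠ 0) (Q : ℝ[X]) (y : ℝ) :
    HasDerivAt (fun y => Q.eval y * Real.exp (-y ^ 2 / (4 * c)))
      ((heatOp c Q).eval y * Real.exp (-y ^ 2 / (4 * c))) y := by
  have h1 : HasDerivAt (fun y : ℝ => -y ^ 2 / (4 * c)) (-(2 * y) / (4 * c)) y := by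
    simpa using ((hasDerivAt_pow 2 y).fun_neg.div_const (4 * c))
  refine ((Q.hasDerivAt y).fun_mul h1.exp).congr_deriv ?_
  rw [heatOp_eval]
  field_simp
  ring

theorem heatOp_mem_degreeLT {c : ℝ} {n : ℕ} {Q : ℝ[X]} (h : Q ∈ degreeLT ℝ n) :
    heatOp c Q ∈ degreeLT ℝ (n + 1) := by
  rw [mem_degreeLT] at h ⊢
  have h1 : (derivative Q).degree < ((n + 1 : ℕ) : WithBot ℕ) :=
    (degree_derivative_le.trans_lt h).trans (by exact_mod_cast n.lt_succ_self)
  have h2 : ((1 / (2 * c)) • (X * Q)).degree < ((n + 1 : ℕ) : WithBot ℕ) := by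
    refine (degree_smul_le _ _).trans_lt ?_
    by_cases hQ : Q = 0
    · simp [hQ]
    rw [mul_comm, degree_mul_X, degree_eq_natDegree hQ] at *
    have : Q.natDegree < n := by exact_mod_cast h
    exact_mod_cast Nat.succ_lt_succ this
  exact (degree_sub_le _ _).trans_lt (max_lt h1 h2)

theorem degree_C_lt_degreeLT_one (a : ℝ) : (C a).degree < ((0 + 1 : ℕ) : WithBot ℕ) :=
  degree_C_le.trans_lt (by simp)

theorem heatPoly_mem_degreeLT {c : ℝ} {n : ℕ} {P : ℝ[X]} (h : P ∈ degreeLT ℝ n) :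
    heatPoly c P ∈ degreeLT ℝ n := by
  have hpow : ∀ (a : ℝ) (i : ℕ), ((heatOp c) ^ i) (C a) ∈ degreeLT ℝ (i + 1) := by
    intro a i
    induction i with
    | zero =>
      rw [pow_zero, Module.End.one_apply, mem_degreeLT]
      exact degree_C_lt_degreeLT_one a
    | succ i ih =>
      rw [pow_succ', Module.End.mul_apply]
      exact heatOp_mem_degreeLT ih
  by_cases hP : P = 0
  · rw [hP, heatPoly, map_zero]
    exact zero_mem _
  have hn : P.natDegree < n := by
    rw [mem_degreeLT, degree_eq_natDegree hP] at h
    exact_mod_cast h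
  rw [heatPoly, aeval_eq_sum_range, LinearMap.sum_apply]
  refine sum_mem fun i hi => Submodule.smul_mem _ _ (degreeLT_mono ?_ (hpow _ i))
  have := Finset.mem_range.mp hi
  lia

theorem integrable_eval_mul_exp_neg_mul_sq {b : ℝ} (hb : 0 < b) (Q : ℝ[X]) :
    Integrable fun y => Q.eval y * Real.exp (-b * y ^ 2) := by
  induction Q using Polynomial.induction_on' with
  | add p q hp hq =>
    simp only [eval_add, add_mul]
    exact hp.add hq
  | monomial n a =>
    have h := (integrable_rpow_mul_exp_neg_mul_sq hb (s := n)
      (by linarith [n.cast_nonneg (α := ℝ)])).const_mul a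
    refine h.congr (.of_forall fun y => ?_)
    simp only [eval_monomial, Real.rpow_natCast]
    ring

theorem exp_mul_gauss_eq {c : ℝ} (hc : 0 < c) (α y : ℝ) :
    Real.exp (-α * y) * Real.exp (-y ^ 2 / (4 * c))
      = Real.exp (c * α ^ 2) * Real.exp (-(1 / (4 * c)) * (y + 2 * c * α) ^ 2) := by
  rw [← Real.exp_add, ← Real.exp_add]
  congr 1
  field_simp
  ring

theorem integrable_exp_mul_eval_mul_gauss {c : ℝ} (hc : 0 < c) (α : ℝ) (Q : ℝ[X]) :
    Integrable fun y => Real.exp (-α * y) * (Q.eval y * Real.exp (-y ^ 2 / (4 * c))) := by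
  have h := ((integrable_eval_mul_exp_neg_mul_sq (b := 1 / (4 * c)) (by positivity)
    (Q.comp (X - C (2 * c * α)))).comp_add_right (2 * c * α)).const_mul (Real.exp (c * α ^ 2))
  refine h.congr (.of_forall fun y => ?_)
  simp only [eval_comp, eval_sub, eval_X, eval_C, add_sub_cancel_right]
  linear_combination -(Q.eval y) * exp_mul_gauss_eq hc α y

/-- Against e^{-αy}, integration by parts turns each ∂ of P(∂) into α. What remains is the Laplace
transform of the heat kernel. -/
theorem integral_exp_mul_heatPoly {c : ℝ} (hc : 0 < c) (α : ℝ) (P : ℝ[X]) :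
    ∫ y, Real.exp (-α * y) * ((heatPoly c P).eval y * Real.exp (-y ^ 2 / (4 * c)))
      = P.eval α * Real.exp (c * α ^ 2) := by
  have hX : ∀ P : ℝ[X], ∫ y, Real.exp (-α * y) * ((heatPoly c (P * X)).eval y
      * Real.exp (-y ^ 2 / (4 * c))) = α * ∫ y, Real.exp (-α * y) * ((heatPoly c P).eval y
      * Real.exp (-y ^ 2 / (4 * c))) := by
    intro P
    have hI := integrable_exp_mul_eval_mul_gauss hc α (heatPoly c P)
    have hI' := integrable_exp_mul_eval_mul_gauss hc α (heatPoly c (P * X))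
    have hd : ∀ y, HasDerivAt (fun y => Real.exp (-α * y) * ((heatPoly c P).eval y
        * Real.exp (-y ^ 2 / (4 * c)))) (Real.exp (-α * y) * ((heatPoly c (P * X)).eval y
        * Real.exp (-y ^ 2 / (4 * c))) - α * (Real.exp (-α * y) * ((heatPoly c P).eval y
        * Real.exp (-y ^ 2 / (4 * c))))) y := fun y => by
      have h1 : HasDerivAt (fun y : ℝ => -α * y) (-α) y := by
        simpa using (hasDerivAt_id y).const_mul (-α)
      refine (h1.exp.fun_mul (hasDerivAt_eval_mul_gauss hc.ne' (heatPoly c P) y)).congr_deriv ?_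
      rw [heatPoly_mul_X]
      ring
    have hz := integral_eq_zero_of_hasDerivAt_of_integrable hd (hI'.sub (hI.const_mul α)) hI
    rw [integral_sub hI' (hI.const_mul α), integral_const_mul] at hz
    linarith
  induction P using Polynomial.induction_on with
  | C a =>
    simp only [heatPoly_C, eval_C]
    have h1 : ∀ y, Real.exp (-α * y) * (a * (√(Real.pi / c) / (2 * Real.pi))
        * Real.exp (-y ^ 2 / (4 * c))) = a * (√(Real.pi / c) / (2 * Real.pi))
        * Real.exp (c * α ^ 2) * Real.exp (-(1 / (4 * c)) * (y + 2 * c * α) ^ 2) := fun y => by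
      linear_combination a * (√(Real.pi / c) / (2 * Real.pi)) * exp_mul_gauss_eq hc α y
    simp only [h1]
    rw [integral_const_mul, integral_add_right_eq_self
      (fun y => Real.exp (-(1 / (4 * c)) * y ^ 2)), integral_gaussian]
    have h2 : √(Real.pi / c) * √(Real.pi / (1 / (4 * c))) = 2 * Real.pi := by
      rw [← Real.sqrt_mul (by positivity), show Real.pi / c * (Real.pi / (1 / (4 * c)))
        = (2 * Real.pi) ^ 2 by field_simp; ring, Real.sqrt_sq (by positivity)]
    have h3 := Real.pi_pos.ne'
    calc _ = a * Real.exp (c * α ^ 2) * (√(Real.pi / c) * √(Real.pi / (1 / (4 * c))))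
          / (2 * Real.pi) := by ring
      _ = _ := by
        rw [h2]
        field_simp
  | add p q hp hq =>
    simp only [heatPoly_add, eval_add, add_mul, mul_add]
    rw [integral_add (integrable_exp_mul_eval_mul_gauss hc α _)
      (integrable_exp_mul_eval_mul_gauss hc α _), hp, hq]
  | monomial n a ih =>
    rw [pow_succ, ← mul_assoc, hX, ih]
    simp
    ring

/-- The Fourier transform of the polynomial `P(is)` times a Gaussian. -/
def fourierGauss (c : ℝ) (P : ℝ[X]) : ℂ × ℂ × ℂ → ℂ :=
  expInt volume (fun s : ℝ => 1 / (2 * (Real.pi : ℂ)) * Complex.exp (-c * s ^ 2)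
    * aeval ((s : ℂ) * Complex.I) P) fun s => (0, s * Complex.I, 0)

theorem expIntegrable_fourierGauss {c : ℝ} (hc : 2 ≤ c) (P : ℝ[X]) :
    ExpIntegrable volume (fun s : ℝ => 1 / (2 * (Real.pi : ℂ)) * Complex.exp (-c * s ^ 2)
    * aeval ((s : ℂ) * Complex.I) P) fun s => (0, s * Complex.I, 0) := by
  have h0 : ExpIntegrable volume (fun s : ℝ => 1 / (2 * (Real.pi : ℂ)) * Complex.exp (-c * s ^ 2))
      fun s => (0, s * Complex.I, 0) := by
    refine expIntegrable_of_continuous (by fun_prop) (by fun_prop) fun C =>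
      ⟨‖1 / (2 * (Real.pi : ℂ))‖ * Real.exp (C ^ 2), fun s => ?_⟩
    have e1 : ‖((0, s * Complex.I, 0) : ℂ × ℂ × ℂ)‖ = |s| := by simp [Prod.norm_def]
    have e2 : (-c * s ^ 2 : ℂ) = ((-c * s ^ 2 : ℝ) : ℂ) := by push_cast; ring
    rw [e1, norm_mul, Complex.norm_exp, e2, Complex.ofReal_re, mul_assoc, mul_assoc,
      ← Real.exp_add, ← Real.exp_add]
    refine mul_le_mul_of_nonneg_left (Real.exp_le_exp.mpr ?_) (norm_nonneg _)
    nlinarith [sq_nonneg (C - |s|), sq_abs s, sq_nonneg s, mul_nonneg (sub_nonneg.mpr hc) (sq_nonneg s), sq_nonneg C]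
  induction P using Polynomial.induction_on with
  | C a =>
    convert h0.const_mul (a : ℂ) using 2 with s
    simp only [aeval_C, Complex.coe_algebraMap]
    ring
  | add p q hp hq =>
    convert hp.add hq using 2 with s
    simp only [map_add]
    ring
  | monomial n a ih =>
    convert ih.mul_pair3 (0, 1, 0) using 2 with s
    simp only [pair3_apply, pow_succ, map_mul, aeval_X]
    ring

/-- A factor is under the integral is a derivative in y, which matches the recursion of `heatPoly`;
the constants are the Fourier transform of the Gaussian. This identifies the λ-integral of the
approximate kernel with real functions. -/
theorem fourierGauss_eq {c : ℝ} (hc : 2 ≤ c) (P : ℝ[X]) (y : ℝ) :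
    fourierGauss c P (0, (y : ℂ), 0)
      = (((heatPoly c P).eval y * Real.exp (-y ^ 2 / (4 * c)) : ℝ) : ℂ) := by
  have hc0 : 0 < c := by linarith
  induction P using Polynomial.induction_on generalizing y with
  | C a =>
    have h := fourierIntegral_gaussian (b := (c : ℂ)) (by simpa using hc0) (y : ℂ)
    have h1 : fourierGauss c (C a) (0, (y : ℂ), 0) = a * (1 / (2 * (Real.pi : ℂ)))
        * ∫ s : ℝ, Complex.exp (Complex.I * y * s) * Complex.exp (-c * s ^ 2) := by
      rw [fourierGauss, expInt, ← integral_const_mul]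
      congr 1
      ext s
      simp only [pair3_apply, aeval_C, Complex.coe_algebraMap, zero_mul, zero_add, add_zero]
      rw [show (s : ℂ) * Complex.I * y = Complex.I * y * s by ring]
      ring
    have h2 : ((Real.pi : ℂ) / c) ^ (1 / 2 : ℂ) = ((√(Real.pi / c) : ℝ) : ℂ) := by
      rw [Real.sqrt_eq_rpow, Complex.ofReal_cpow (by positivity)]
      push_cast
      rfl
    rw [h1, h, h2, heatPoly_C, eval_C]
    push_cast
    ring
  | add p q hp hq =>
    have : fourierGauss c (p + q) (0, (y : ℂ), 0)
        = fourierGauss c p (0, (y : ℂ), 0) + fourierGauss c q (0, (y : ℂ), 0) := by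
      rw [fourierGauss, fourierGauss, fourierGauss, ← expInt_add (expIntegrable_fourierGauss hc p)
        (expIntegrable_fourierGauss hc q)]
      congr 1
      ext s
      rw [map_add]
      ring
    rw [this, hp, hq, heatPoly_add, eval_add, add_mul, Complex.ofReal_add]
  | monomial n a ih =>
    set Q := C a * X ^ n with hQ
    have hd := (expIntegrable_fourierGauss hc Q).hasFDerivAt (0, (y : ℂ), 0)
    have hfd : fderiv ℂ (fourierGauss c Q) (0, (y : ℂ), 0) (0, 1, 0)
        = fourierGauss c (Q * X) (0, (y : ℂ), 0) := by
      rw [fourierGauss, (expIntegrable_fourierGauss hc Q).fderiv_apply, fourierGauss]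
      congr 1
      ext s
      simp only [pair3_apply, map_mul, aeval_X]
      ring
    have hcurve : HasDerivAt (fun t : ℝ => ((0, (t : ℂ), 0) : ℂ × ℂ × ℂ)) (0, 1, 0) y :=
      (hasDerivAt_const y (0 : ℂ)).prodMk
        ((by simpa using (hasDerivAt_id y).ofReal_comp : HasDerivAt (fun t : ℝ => (t : ℂ)) 1 y).prodMk
          (hasDerivAt_const y (0 : ℂ)))
    have hd' : HasFDerivAt (fourierGauss c Q) (fderiv ℂ (fourierGauss c Q) (0, (y : ℂ), 0))
        (0, (y : ℂ), 0) := hd.differentiableAt.hasFDerivAt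
    have h1 := (hd'.restrictScalars ℝ).comp_hasDerivAt y hcurve
    have h2 := (hasDerivAt_eval_mul_gauss hc0.ne' (heatPoly c Q) y).ofReal_comp
    have h3 := (h2.congr_of_eventuallyEq (.of_forall fun t => ih t)).unique h1
    rw [pow_succ, ← mul_assoc, ← hQ, heatPoly_mul_X, h3]
    exact hfd.symm

end HeatPolynomials

end

/-! ### Cauchy integrals of Gaussians over a narrower hyperbola. -/

noncomputable section

open Complex MeasureTheory Set Filter Topology

/-- A branch of a hyperbola to the right of `gammaR`, with the same orientation. -/
def gammaW (t : ℝ) : ℂ := ((2 * √(1 + t ^ 2) : ℝ) : ℂ) - t * I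

/-- The derivative of `gammaW`. -/
def dgammaW (t : ℝ) : ℂ := ((2 * (t / √(1 + t ^ 2)) : ℝ) : ℂ) - I

theorem hasDerivAt_gammaW (t : ℝ) : HasDerivAt gammaW (dgammaW t) t := by
  have h0 : HasDerivAt (fun t : ℝ => 2 * √(1 + t ^ 2)) (2 * (t / √(1 + t ^ 2))) t := by
    have h1 : HasDerivAt (fun t : ℝ => 1 + t ^ 2) (2 * t) t := by
      simpa using (hasDerivAt_pow 2 t).const_add 1
    refine ((h1.sqrt (by positivity)).const_mul 2).congr_deriv ?_
    rw [mul_div_mul_left _ _ two_ne_zero]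
  have h2 : HasDerivAt (fun t : ℝ => (t : ℂ) * I) I t := by
    simpa using (hasDerivAt_id t).ofReal_comp.mul_const I
  exact h0.ofReal_comp.sub h2

theorem continuous_gammaW : Continuous gammaW :=
  continuous_iff_continuousAt.2 fun t => (hasDerivAt_gammaW t).continuousAt

theorem continuous_dgammaW : Continuous dgammaW := by
  unfold dgammaW
  refine Continuous.sub (continuous_ofReal.comp ?_) continuous_const
  refine continuous_const.mul (continuous_id.div (by fun_prop) fun t => ?_)
  positivity

theorem gammaW_re (t : ℝ) : (gammaW t).re = 2 * √(1 + t ^ 2) := by simp [gammaW]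

theorem gammaW_im (t : ℝ) : (gammaW t).im = -t := by simp [gammaW]

theorem two_le_gammaW_re (t : ℝ) : 2 ≤ (gammaW t).re := by
  rw [gammaW_re]
  have : 1 ≤ √(1 + t ^ 2) := Real.one_le_sqrt.2 (by nlinarith [sq_nonneg t])
  linarith

theorem sqrt_one_add_sq_le (t : ℝ) : √(1 + t ^ 2) ≤ 1 + |t| := by
  rw [Real.sqrt_le_left (by positivity)]
  nlinarith [abs_nonneg t, sq_abs t]

theorem abs_le_sqrt_one_add_sq (t : ℝ) : |t| ≤ √(1 + t ^ 2) :=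
  Real.abs_le_sqrt (by linarith)

theorem norm_dgammaW_le (t : ℝ) : ‖dgammaW t‖ ≤ 3 := by
  have h1 : |t / √(1 + t ^ 2)| ≤ 1 := by
    rw [abs_div, abs_of_pos (show (0 : ℝ) < √(1 + t ^ 2) by positivity)]
    exact div_le_one_of_le₀ (abs_le_sqrt_one_add_sq t) (by positivity)
  calc ‖dgammaW t‖ ≤ ‖((2 * (t / √(1 + t ^ 2)) : ℝ) : ℂ)‖ + ‖I‖ := norm_sub_le _ _
    _ ≤ 2 * 1 + 1 := by
      rw [norm_real, Real.norm_eq_abs, abs_mul, norm_I, abs_of_pos (zero_lt_two' ℝ)]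
      gcongr
    _ = 3 := by norm_num

/-- Either the real part is still below the midpoint of 2 and β, or the imaginary part is already at
least (β - 2)/4. -/
theorem norm_gammaW_sub_ge (β : ℝ) (hβ : 2 < β) (t : ℝ) : (β - 2) / 4 ≤ ‖gammaW t - β‖ := by
  by_cases h : (gammaW t).re ≤ 2 + (β - 2) / 2
  · have := abs_re_le_norm (gammaW t - β)
    rw [sub_re, ofReal_re, abs_of_nonpos (by linarith)] at this
    linarith
  · have h1 := abs_im_le_norm (gammaW t - β)
    rw [sub_im, ofReal_im, sub_zero, gammaW_im, abs_neg] at h1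
    refine le_trans ?_ h1
    rw [gammaW_re] at h
    push Not at h
    refine Real.le_sqrt' (by linarith) |>.2 ?_ |>.trans_eq (Real.sqrt_sq_eq_abs t)
    have h3 : √(1 + t ^ 2) ^ 2 = 1 + t ^ 2 := Real.sq_sqrt (by positivity)
    nlinarith

/-- The exponential of a line minus a parabola. -/
def gaussExp (c x : ℝ) (z : ℂ) : ℂ := exp (-(x * z) - c * z ^ 2)

theorem differentiable_gaussExp (c x : ℝ) : Differentiable ℂ (gaussExp c x) := by
  unfold gaussExp; fun_prop

theorem norm_gaussExp (c x : ℝ) (z : ℂ) :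
    ‖gaussExp c x z‖ = Real.exp (-(x * z.re) - c * (z.re ^ 2 - z.im ^ 2)) := by
  rw [gaussExp, norm_exp]
  congr 1
  simp [pow_two]

/-- Decay of `gaussExp` to the right of `gammaW`. -/
theorem norm_gaussExp_le {c : ℝ} (hc : 2 ≤ c) (x T : ℝ) {z : ℂ} (hre : z.re = 2 * √(1 + T ^ 2))
    (him : |z.im| ≤ |T|) :
    ‖gaussExp c x z‖ ≤ Real.exp (x ^ 2 + 2 * |x|) * Real.exp (-T ^ 2) := by
  rw [norm_gaussExp, ← Real.exp_add, Real.exp_le_exp]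
  have h1 : z.re ^ 2 = 4 * (1 + T ^ 2) := by
    rw [hre, mul_pow, Real.sq_sqrt (by positivity)]; norm_num
  have h2 : z.im ^ 2 ≤ T ^ 2 := sq_le_sq.2 him
  have h3 : -(x * z.re) ≤ |x| * (2 * (1 + |T|)) := by
    calc -(x * z.re) ≤ |x * z.re| := neg_le_abs _
      _ = |x| * z.re := by rw [abs_mul, abs_of_nonneg (a := z.re)]; rw [hre]; positivity
      _ ≤ _ := by rw [hre]; gcongr; exact sqrt_one_add_sq_le T
  have h4 : 2 * (4 + 3 * T ^ 2) ≤ c * (z.re ^ 2 - z.im ^ 2) := by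
    rw [h1]
    exact mul_le_mul hc (by linarith) (by positivity) (by linarith)
  have h5 : 2 * (|x| * |T|) ≤ x ^ 2 + T ^ 2 := by
    nlinarith [sq_nonneg (|x| - |T|), sq_abs x, sq_abs T]
  nlinarith [sq_nonneg T]

/-- The aperture matters here: Re z² = 4 + 3t² on γ_W makes the Gaussian decay, whereas Re z² = 1 on
γ_R. The asymptotic slope 1/2 also stays within the sector where e^{z⁴/4} decays, so γ_W serves both
weights. -/
theorem integrable_gaussExp_gammaW {c : ℝ} (hc : 2 ≤ c) (x : ℝ) :
    Integrable fun t => gaussExp c x (gammaW t) * dgammaW t := by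
  have h0 : Integrable fun t : ℝ => 3 * Real.exp (x ^ 2 + 2 * |x|) * Real.exp (-1 * t ^ 2) :=
    (integrable_exp_neg_mul_sq one_pos).const_mul _
  refine h0.mono' ?_ (ae_of_all _ fun t => ?_)
  · exact (((differentiable_gaussExp c x).continuous.comp continuous_gammaW).mul
      continuous_dgammaW).aestronglyMeasurable
  · rw [norm_mul]
    have := norm_gaussExp_le hc x t (gammaW_re t) (by rw [gammaW_im, abs_neg])
    calc _ ≤ (Real.exp (x ^ 2 + 2 * |x|) * Real.exp (-t ^ 2)) * 3 := by
          gcongr; exact norm_dgammaW_le t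
      _ = _ := by rw [neg_one_mul]; ring

/-- The Cauchy type integral of `gaussExp` over `gammaW`. -/
def gaussCauchy (c x : ℝ) (β : ℂ) : ℂ :=
  ∫ t, gaussExp c x (gammaW t) * dgammaW t * (gammaW t - β)⁻¹

theorem integrable_gaussCauchy {c : ℝ} (hc : 2 ≤ c) (x : ℝ) {β : ℂ} {δ : ℝ} (hδ : 0 < δ)
    (hβ : ∀ t, δ ≤ ‖gammaW t - β‖) :
    Integrable fun t => gaussExp c x (gammaW t) * dgammaW t * (gammaW t - β)⁻¹ := by
  refine (integrable_gaussExp_gammaW hc x).mul_bdd (c := δ⁻¹) ?_ (ae_of_all _ fun t => ?_)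
  · refine Continuous.aestronglyMeasurable ((continuous_gammaW.sub continuous_const).inv₀ ?_)
    intro t ht
    have := hβ t
    rw [show gammaW t - β = 0 from ht, norm_zero] at this
    linarith
  · rw [norm_inv]
    exact inv_anti₀ hδ (hβ t)

theorem integral_eq_of_tendsto_symm {f : ℝ → ℂ} (hf : Integrable f) {L : ℂ} {g : ℝ → ℝ}
    (hg : Tendsto g atTop (𝓝 0)) (h : ∀ᶠ T in atTop, ‖(∫ t in (-T)..T, f t) - L‖ ≤ g T) :
    ∫ t, f t = L := by
  have h1 := intervalIntegral_tendsto_integral hf tendsto_neg_atTop_atBot tendsto_id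
  have h2 : Tendsto (fun T : ℝ => ∫ t in (-T)..T, f t) atTop (𝓝 L) :=
    tendsto_iff_norm_sub_tendsto_zero.2
      (squeeze_zero' (Eventually.of_forall fun _ => norm_nonneg _) h hg)
  exact tendsto_nhds_unique h1 h2

/-- Mean value inequality on a rectangle with sides parallel to the axes. -/
theorem norm_sub_le_of_hasDerivAt_box {G F : ℂ → ℂ} {a b c d C : ℝ}
    (hG : ∀ z : ℂ, z.re ∈ Icc a b → z.im ∈ Icc c d → HasDerivAt G (F z) z ∧ ‖F z‖ ≤ C)
    {z w : ℂ} (hz : z.re ∈ Icc a b ∧ z.im ∈ Icc c d) (hw : w.re ∈ Icc a b ∧ w.im ∈ Icc c d) :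
    ‖G w - G z‖ ≤ C * ‖w - z‖ := by
  have hconv : Convex ℝ ({z : ℂ | z.re ∈ Icc a b} ∩ {z : ℂ | z.im ∈ Icc c d}) :=
    ((convex_Icc a b).linear_preimage reLm).inter ((convex_Icc c d).linear_preimage imLm)
  exact hconv.norm_image_sub_le_of_norm_hasDerivWithin_le
    (fun u hu => (hG u hu.1 hu.2).1.hasDerivWithinAt) (fun u hu => (hG u hu.1 hu.2).2) hz hw

/-- A function holomorphic in the right half plane has a primitive on any bounded part of
`{1 ≤ re}`. -/
theorem exists_primitive_of_right_half_plane {F : ℂ → ℂ}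
    (hF : ∀ z : ℂ, 0 < z.re → DifferentiableAt ℂ F z) (R : ℝ) (hR : 0 < R) :
    ∃ G : ℂ → ℂ, ∀ z : ℂ, 1 ≤ z.re → ‖z‖ ^ 2 ≤ R → HasDerivAt G (F z) z := by
  have hre : ∀ z ∈ Metric.ball (R : ℂ) R, 0 < z.re := by
    intro z hz
    rw [mem_ball_iff_norm] at hz
    have := (abs_lt.1 ((abs_re_le_norm _).trans_lt hz)).1
    rw [sub_re, ofReal_re] at this
    linarith
  have hd : DifferentiableOn ℂ F (Metric.ball (R : ℂ) R) := fun z hz =>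
    (hF z (hre z hz)).differentiableWithinAt
  obtain ⟨G, hG⟩ := hd.isExactOn_ball
  -- The disc with center and radius R lies in the right half plane, and the two conditions on z
  -- give |z - R|² ≤ R² - R.
  refine ⟨G, fun z hz hzR => hG z ?_⟩
  rw [mem_ball_iff_norm]
  refine lt_of_pow_lt_pow_left₀ 2 hR.le ?_
  rw [← normSq_eq_norm_sq, normSq_apply] at *
  simp only [sub_re, sub_im, ofReal_re, ofReal_im, sub_zero]
  nlinarith

theorem integral_comp_path_eq_sub {γ γ' : ℝ → ℂ} (hγ : ∀ t, HasDerivAt γ (γ' t) t) {F G : ℂ → ℂ}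
    {T : ℝ} (hT : 0 ≤ T) (hG : ∀ t ∈ Icc (-T) T, HasDerivAt G (F (γ t)) (γ t))
    (hF : Continuous fun t => F (γ t) * γ' t) :
    ∫ t in (-T)..T, F (γ t) * γ' t = G (γ T) - G (γ (-T)) := by
  refine intervalIntegral.integral_eq_sub_of_hasDerivAt (f := fun t => G (γ t)) ?_
    (hF.intervalIntegrable _ _)
  intro t ht
  rw [uIcc_of_le (by linarith)] at ht
  exact HasDerivAt.comp_of_eq t (hG t ht) (hγ t) rfl

theorem tendsto_mul_exp_neg : Tendsto (fun T : ℝ => T * Real.exp (-T)) atTop (𝓝 0) := by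
  simpa using Real.tendsto_pow_mul_exp_neg_atTop_nhds_zero 1

theorem gammaW_neg_sub (T : ℝ) : ‖gammaW T - gammaW (-T)‖ = 2 * |T| := by
  have : gammaW T - gammaW (-T) = ((-2 * T : ℝ) : ℂ) * I := by
    simp [gammaW]; ring
  rw [this, norm_mul, norm_I, norm_real, Real.norm_eq_abs, abs_mul]
  norm_num

/-- The contribution of the vertical segment closing `gammaW` vanishes in the limit. -/
theorem norm_primitive_sub_le {c : ℝ} (hc : 2 ≤ c) (x : ℝ) {β : ℂ} {G : ℂ → ℂ} {T : ℝ} (hT : 1 ≤ T)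
    (hβ : β.re + 1 ≤ 2 * √(1 + T ^ 2))
    (hG : ∀ z : ℂ, z.re = 2 * √(1 + T ^ 2) → |z.im| ≤ T →
      HasDerivAt G (gaussExp c x z * (z - β)⁻¹) z) :
    ‖G (gammaW T) - G (gammaW (-T))‖ ≤
      2 * Real.exp (x ^ 2 + 2 * |x|) * (T * Real.exp (-T)) := by
  have hT0 : |T| = T := abs_of_nonneg (by linarith)
  have key := norm_sub_le_of_hasDerivAt_box (G := G) (F := fun z => gaussExp c x z * (z - β)⁻¹)
    (a := 2 * √(1 + T ^ 2)) (b := 2 * √(1 + T ^ 2)) (c := -T) (d := T)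
    (C := Real.exp (x ^ 2 + 2 * |x|) * Real.exp (-T)) (z := gammaW (-T)) (w := gammaW T) ?_ ?_ ?_
  · refine key.trans (le_of_eq ?_)
    rw [gammaW_neg_sub, hT0]
    ring
  · intro z hz hz'
    have hre : z.re = 2 * √(1 + T ^ 2) := le_antisymm hz.2 hz.1
    refine ⟨hG z hre (abs_le.2 hz'), ?_⟩
    rw [norm_mul, norm_inv]
    have h1 : 1 ≤ ‖z - β‖ := by
      refine le_trans ?_ ((le_abs_self _).trans (abs_re_le_norm (z - β)))
      rw [sub_re]; linarith
    calc _ ≤ (Real.exp (x ^ 2 + 2 * |x|) * Real.exp (-T ^ 2)) * 1 := by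
          gcongr
          · exact norm_gaussExp_le hc x T hre (by rw [hT0]; exact abs_le.2 hz')
          · exact inv_le_one_of_one_le₀ h1
      _ ≤ _ := by rw [mul_one]; gcongr; nlinarith
  · rw [gammaW_re, gammaW_im, neg_sq, neg_neg]
    exact ⟨⟨le_rfl, le_rfl⟩, by linarith, le_rfl⟩
  · rw [gammaW_re, gammaW_im]
    exact ⟨⟨le_rfl, le_rfl⟩, le_rfl, by linarith⟩

/-- The pole lies to the left of γ_W. A primitive replaces the truncated curve by the vertical chord
between its ends, whose contribution tends to 0. -/
theorem gaussCauchy_eq_zero {c : ℝ} (hc : 2 ≤ c) (x : ℝ) {β : ℂ} (hβ : β.re ≤ 0) :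
    gaussCauchy c x β = 0 := by
  have hne : ∀ z : ℂ, 0 < z.re → z - β ≠ 0 := by
    intro z hz h
    rw [sub_eq_zero] at h
    rw [h] at hz
    linarith
  have hdist : ∀ t, (2 : ℝ) ≤ ‖gammaW t - β‖ := by
    intro t
    refine le_trans ?_ ((le_abs_self _).trans (abs_re_le_norm _))
    rw [sub_re]
    have := two_le_gammaW_re t
    linarith
  refine integral_eq_of_tendsto_symm (integrable_gaussCauchy hc x two_pos hdist)
    (g := fun T => 2 * Real.exp (x ^ 2 + 2 * |x|) * (T * Real.exp (-T))) ?_ ?_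
  · simpa using tendsto_mul_exp_neg.const_mul (2 * Real.exp (x ^ 2 + 2 * |x|))
  · filter_upwards [eventually_ge_atTop 1] with T hT
    obtain ⟨G, hG⟩ := exists_primitive_of_right_half_plane
      (F := fun z => gaussExp c x z * (z - β)⁻¹)
      (fun z hz => ((differentiable_gaussExp c x).differentiableAt).mul
        ((differentiableAt_id.sub_const β).inv (hne z hz))) (4 + 5 * T ^ 2) (by positivity)
    have hG' : ∀ t ∈ Icc (-T) T, HasDerivAt G (gaussExp c x (gammaW t) * (gammaW t - β)⁻¹)
        (gammaW t) := by
      intro t ht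
      refine hG _ (by linarith [two_le_gammaW_re t]) ?_
      rw [← normSq_eq_norm_sq, normSq_apply, gammaW_re, gammaW_im]
      have := Real.mul_self_sqrt (show 0 ≤ 1 + t ^ 2 by positivity)
      have h2 : t ^ 2 ≤ T ^ 2 := sq_le_sq' ht.1 ht.2
      nlinarith
    have hcont : Continuous fun t => gaussExp c x (gammaW t) * (gammaW t - β)⁻¹ * dgammaW t :=
      ((((differentiable_gaussExp c x).continuous.comp continuous_gammaW).mul
        ((continuous_gammaW.sub continuous_const).inv₀ fun t =>
          hne _ (by linarith [two_le_gammaW_re t])))).mul continuous_dgammaW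
    have h1 := integral_comp_path_eq_sub hasDerivAt_gammaW (F := fun z => gaussExp c x z * (z - β)⁻¹)
      (by linarith) hG' hcont
    have h2 : ∀ t, gaussExp c x (gammaW t) * dgammaW t * (gammaW t - β)⁻¹ =
        gaussExp c x (gammaW t) * (gammaW t - β)⁻¹ * dgammaW t := fun t => by ring
    simp only [h2]
    rw [h1, sub_zero]
    have hs : 1 ≤ √(1 + T ^ 2) := Real.one_le_sqrt.2 (by nlinarith)
    refine norm_primitive_sub_le hc x (β := β) hT (by linarith) fun z hre him => hG z (by linarith) ?_
    rw [← normSq_eq_norm_sq, normSq_apply, hre]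
    have := Real.mul_self_sqrt (show 0 ≤ 1 + T ^ 2 by positivity)
    have h3 : z.im ^ 2 ≤ T ^ 2 := sq_le_sq' (abs_le.1 him).1 (abs_le.1 him).2
    nlinarith

/-- Split off the pole: h(z)/(z - β) is the slope of h, which is entire, plus h(β)/(z - β). Along
the curve log(β - z) is a primitive of 1/(z - β), and on the closing chord log(z - β) is. At the two
ends they differ by πi and -πi, which accounts for 2πi h(β); the sign is positive because the curve
runs downwards with β on its left. -/
theorem gaussCauchy_eq_residue {c : ℝ} (hc : 2 ≤ c) (x : ℝ) {β : ℝ} (hβ : 2 < β) :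
    gaussCauchy c x β = 2 * Real.pi * I * gaussExp c x β := by
  have hne : ∀ t, gammaW t - β ≠ 0 := fun t h => by
    have := norm_gammaW_sub_ge β hβ t
    rw [h, norm_zero] at this
    linarith
  refine integral_eq_of_tendsto_symm
    (integrable_gaussCauchy hc x (δ := (β - 2) / 4) (by linarith) (norm_gammaW_sub_ge β hβ))
    (g := fun T => 2 * Real.exp (x ^ 2 + 2 * |x|) * (T * Real.exp (-T))) ?_ ?_
  · simpa using tendsto_mul_exp_neg.const_mul (2 * Real.exp (x ^ 2 + 2 * |x|))
  filter_upwards [eventually_ge_atTop 1, eventually_ge_atTop β] with T hT hTβ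
  set h := gaussExp c x with hh
  have hd : Differentiable ℂ h := differentiable_gaussExp c x
  have hds : Differentiable ℂ (dslope h β) := by
    intro z
    have := (Complex.differentiableOn_dslope (s := univ) (c := (β : ℂ)) univ_mem).2
      hd.differentiableOn
    exact this.differentiableAt univ_mem
  obtain ⟨G, hG⟩ := hds.isExactOn_univ
  have hsl : ∀ z : ℂ, z - β ≠ 0 → dslope h β z = (h z - h β) * (z - β)⁻¹ := by
    intro z hz
    rw [dslope_of_ne _ (sub_ne_zero.1 hz), slope_def_field, div_eq_mul_inv]
  have hmem : ∀ t, (β : ℂ) - gammaW t ∈ slitPlane := by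
    intro t
    rw [mem_slitPlane_iff]
    by_cases ht : t = 0
    · left
      rw [ht, sub_re, gammaW_re, ofReal_re]
      norm_num
      linarith
    · right
      rw [sub_im, ofReal_im, gammaW_im]
      simpa using ht
  have h1 : ∀ t ∈ Icc (-T) T, HasDerivAt (fun z => G z + h β * log (β - z))
      (h (gammaW t) * (gammaW t - β)⁻¹) (gammaW t) := by
    intro t _
    have e1 := hG (gammaW t) (mem_univ _)
    have e2 : HasDerivAt (fun z : ℂ => (β : ℂ) - z) (-1) (gammaW t) := by
      simpa using (hasDerivAt_id (gammaW t)).const_sub (β : ℂ)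
    have e3 := e1.add ((e2.clog (hmem t)).const_mul (h β))
    refine e3.congr_deriv ?_
    rw [hsl _ (hne t)]
    have := hne t
    have h5 : (β : ℂ) - gammaW t ≠ 0 := fun h6 => this (by rw [← neg_sub, h6, neg_zero])
    field_simp
    ring
  have hcont : Continuous fun t => h (gammaW t) * (gammaW t - β)⁻¹ * dgammaW t :=
    ((hd.continuous.comp continuous_gammaW).mul
      ((continuous_gammaW.sub continuous_const).inv₀ hne)).mul continuous_dgammaW
  have h2 := integral_comp_path_eq_sub hasDerivAt_gammaW (F := fun z => h z * (z - β)⁻¹) (by linarith) h1 hcont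
  have h3 : ∀ t, h (gammaW t) * dgammaW t * (gammaW t - β)⁻¹ =
      h (gammaW t) * (gammaW t - β)⁻¹ * dgammaW t := fun t => by ring
  simp only [h3]
  rw [h2]
  have hl1 : log ((β : ℂ) - gammaW T) = log (gammaW T - β) + Real.pi * I := by
    have him : (gammaW T - β).im < 0 := by
      rw [sub_im, gammaW_im, ofReal_im]; linarith
    rw [← neg_sub, log, log, norm_neg, arg_neg_eq_arg_add_pi_of_im_neg him]
    push_cast; ring
  have hl2 : log ((β : ℂ) - gammaW (-T)) = log (gammaW (-T) - β) - Real.pi * I := by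
    have him : 0 < (gammaW (-T) - β).im := by
      rw [sub_im, gammaW_im, ofReal_im]; linarith
    rw [← neg_sub, log, log, norm_neg, arg_neg_eq_arg_sub_pi_of_im_pos him]
    push_cast; ring
  have hs : T ≤ √(1 + T ^ 2) := (le_abs_self T).trans (abs_le_sqrt_one_add_sq T)
  have h4 := norm_primitive_sub_le hc x (β := β) (G := fun z => G z + h β * log (z - β)) hT
    (by rw [ofReal_re]; linarith) ?_
  · refine le_trans (le_of_eq ?_) h4
    congr 1
    simp only [hl1, hl2]
    ring
  · intro z hre _
    have hz : 0 < (z - β).re := by rw [sub_re, ofReal_re, hre]; linarith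
    have hz0 : z - β ≠ 0 := fun h0 => by rw [h0] at hz; simp at hz
    have e1 := hG z (mem_univ _)
    have e3 := e1.add ((((hasDerivAt_id z).sub_const (β : ℂ)).clog
      (mem_slitPlane_iff.2 (Or.inl hz))).const_mul (h β))
    refine e3.congr_deriv ?_
    rw [hsl _ hz0]
    simp only [id]
    field_simp
    ring

end

noncomputable section

/-! ### A biorthogonal ensemble of exponentials and Gaussian polynomials. -/

section ExponentialModel

open Polynomial MeasureTheory Lagrange

variable {N : ℕ}

/-- The first family of a biorthogonal system: exponentials. -/
def modelU (α : Fin N → ℝ) (k : Fin N) (x : ℝ) : ℝ := Real.exp (-α k * x)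

/-- The multiples of the Lagrange basis polynomials with nodes `α k`. -/
def modelPoly (c : ℝ) (α : Fin N → ℝ) (k : Fin N) : ℝ[X] :=
  (Real.exp (-c * α k ^ 2) * nodalWeight Finset.univ α k) • nodal (Finset.univ.erase k) α

/-- The second family of a biorthogonal system: polynomials times a Gaussian. -/
def modelV (c : ℝ) (α : Fin N → ℝ) (k : Fin N) (y : ℝ) : ℝ :=
  (heatPoly c (modelPoly c α k)).eval y * Real.exp (-y ^ 2 / (4 * c))

theorem eval_modelPoly (c : ℝ) {α : Fin N → ℝ} (hα : Function.Injective α) (k l : Fin N) :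
    (modelPoly c α l).eval (α k) = if k = l then Real.exp (-c * α k ^ 2) else 0 := by
  rw [modelPoly, eval_smul, smul_eq_mul]
  split_ifs with h
  · subst h
    have h1 := nodalWeight_ne_zero (hα.injOn (s := (Finset.univ : Finset (Fin N)))) (Finset.mem_univ k)
    rw [nodalWeight_eq_eval_nodal_erase_inv] at h1 ⊢
    rw [mul_assoc, inv_mul_cancel₀ fun h2 => h1 (inv_eq_zero.2 h2), mul_one]
  · rw [eval_nodal_at_node (Finset.mem_erase.2 ⟨h, Finset.mem_univ k⟩), mul_zero]

theorem modelPoly_mem_degreeLT (c : ℝ) (α : Fin N → ℝ) (k : Fin N) :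
    modelPoly c α k ∈ degreeLT ℝ N := by
  refine Submodule.smul_mem _ _ (mem_degreeLT.2 ?_)
  rw [degree_nodal, Finset.card_erase_of_mem (Finset.mem_univ k), Finset.card_univ,
    Fintype.card_fin]
  exact_mod_cast Nat.sub_lt (Fin.pos k) one_pos

theorem integrable_modelU_mul_modelV {c : ℝ} (hc : 0 < c) (α : Fin N → ℝ) (k l : Fin N) :
    Integrable fun x => modelU α k x * modelV c α l x :=
  integrable_exp_mul_eval_mul_gauss hc (α k) _

/-- The pairing evaluates the polynomial at α_k and multiplies by e^{cα_k²}. The normalized Lagrange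
basis is chosen to make this the identity matrix. -/
theorem integral_modelU_mul_modelV {c : ℝ} (hc : 0 < c) {α : Fin N → ℝ} (hα : Function.Injective α)
    (k l : Fin N) : ∫ x, modelU α k x * modelV c α l x = if k = l then 1 else 0 := by
  have := integral_exp_mul_heatPoly hc (α k) (modelPoly c α l)
  rw [eval_modelPoly c hα] at this
  refine this.trans ?_
  split_ifs
  · rw [← Real.exp_add]; simp
  · rw [zero_mul]

theorem linearIndependent_heatPoly_modelPoly {c : ℝ} (hc : 0 < c) {α : Fin N → ℝ}
    (hα : Function.Injective α) : LinearIndependent ℝ fun k => heatPoly c (modelPoly c α k) := by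
  rw [Fintype.linearIndependent_iff]
  intro g hg l
  have h1 : heatPoly c (∑ k, g k • modelPoly c α k) = 0 := by
    rw [← hg]
    simp [heatPoly]
  have h2 := integral_exp_mul_heatPoly hc (α l) (∑ k, g k • modelPoly c α k)
  rw [h1] at h2
  simp only [eval_zero, zero_mul, mul_zero, integral_zero, eval_finsetSum, eval_smul,
    eval_modelPoly c hα, smul_eq_mul, mul_ite, Finset.sum_ite_eq, Finset.mem_univ, if_true] at h2
  have h3 := (mul_eq_zero.1 h2.symm).resolve_right (Real.exp_ne_zero _)
  exact (mul_eq_zero.1 h3).resolve_right (Real.exp_ne_zero _)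

theorem continuous_modelU (α : Fin N → ℝ) (k : Fin N) : Continuous (modelU α k) := by
  unfold modelU; fun_prop

theorem continuous_modelV (c : ℝ) (α : Fin N → ℝ) (k : Fin N) : Continuous (modelV c α k) := by
  unfold modelV; fun_prop

theorem gapDet_model_nonneg_and_antitone {c : ℝ} (hc : 0 < c) {α : Fin N → ℝ}
    (hα : Function.Injective α) (a : ℝ) :
    (∀ b, 0 ≤ gapDet (modelU α) (modelV c α) a b) ∧ Antitone (gapDet (modelU α) (modelV c α) a) :=
  gapDet_nonneg_and_antitone (continuous_modelU α) (continuous_modelV c α)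
    (integrable_modelU_mul_modelV hc α) (integral_modelU_mul_modelV hc hα)
    (fun _ hx => det_exp_ne_zero (α := fun k => -α k) (neg_injective.comp hα) hx)
    (fun _ hx => det_eval_mul_ne_zero (w := fun y => Real.exp (-y ^ 2 / (4 * c)))
      (fun _ => Real.exp_ne_zero _)
      (fun k => heatPoly_mem_degreeLT (modelPoly_mem_degreeLT c α k))
      (linearIndependent_heatPoly_modelPoly hc hα) hx) a

end ExponentialModel

/-! ### Double contour representation of the model kernel. -/

section HyperbolaKernel

open Complex MeasureTheory Set Filter Topology

/-- The integral over `gammaW` in the double contour representation of a kernel. -/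
def hyperbolaInner (W : ℂ → ℂ) (x : ℝ) (β : ℂ) : ℂ :=
  ∫ t, exp (-(x * gammaW t)) * (W (gammaW t))⁻¹ * dgammaW t * (gammaW t - β)⁻¹

/-- The kernel with the double contour representation with the even weight `W`. -/
def hyperbolaKernel (W : ℂ → ℂ) (x y : ℝ) : ℂ :=
  I / (4 * Real.pi ^ 2) * ∫ s : ℝ, exp (y * (s * I)) * W (s * I) *
    (hyperbolaInner W x (s * I) + hyperbolaInner W (-x) (-(s * I)))

variable {N : ℕ}

/-- Partial fractions, read off from the Lagrange interpolation of the constant 1. An empty product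
would be 1 against an empty sum, hence `hN`. -/
theorem prod_sub_inv_eq_sum {α : Fin N → ℝ} (hN : 0 < N) (hα : Function.Injective α) {μ : ℂ}
    (hμ : ∀ k, μ ≠ α k) : (∏ k, (μ - α k))⁻¹ =
      ∑ k, ((Lagrange.nodalWeight Finset.univ α k : ℝ) : ℂ) * (μ - α k)⁻¹ := by
  have hα' : Function.Injective fun k => (α k : ℂ) := ofReal_injective.comp hα
  have h1 := Lagrange.eval_interpolate_not_at_node (s := Finset.univ) (v := fun k => (α k : ℂ))
    (r := 1) (x := μ) fun k _ => hμ k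
  have : Nonempty (Fin N) := ⟨⟨0, hN⟩⟩
  rw [Lagrange.interpolate_one hα'.injOn Finset.univ_nonempty, Polynomial.eval_one,
    Lagrange.eval_nodal] at h1
  rw [inv_eq_of_mul_eq_one_right h1.symm]
  refine Finset.sum_congr rfl fun k _ => ?_
  simp [Lagrange.nodalWeight]

/-- Partial fractions reduce the integrand to simple poles at β and at the α_k. Only the α_k to the
right of γ_W leave a residue. The factor n is kept abstract so that the reflected zeros -α_k can
also be used. -/
theorem integral_gaussExp_mul_inv {c : ℝ} (hc : 2 ≤ c) (x : ℝ) {α w : Fin N → ℝ} {n : ℂ → ℂ}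
    (hα : ∀ k, 2 < |α k|)
    (hn : ∀ μ : ℂ, (∀ k, μ ≠ α k) → (n μ)⁻¹ = ∑ k, (w k : ℂ) * (μ - α k)⁻¹) {β : ℂ}
    (hβ : β.re = 0) :
    ∫ t, gaussExp c x (gammaW t) * (n (gammaW t))⁻¹ * dgammaW t * (gammaW t - β)⁻¹ =
      -∑ k, if 0 < α k then 2 * Real.pi * I * w k * gaussExp c x (α k) * (β - α k)⁻¹ else 0 := by
  have hβα : ∀ k, β ≠ α k := fun k h => by
    have := hα k
    rw [h, ofReal_re] at hβ
    rw [hβ, abs_zero] at this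
    linarith
  have hγβ : ∀ t, (2 : ℝ) ≤ ‖gammaW t - β‖ := fun t => by
    refine le_trans ?_ ((le_abs_self _).trans (abs_re_le_norm _))
    rw [sub_re, hβ, sub_zero]
    exact two_le_gammaW_re t
  have hγα : ∀ k, ∃ δ > 0, ∀ t, δ ≤ ‖gammaW t - α k‖ := fun k => by
    rcases lt_or_ge 0 (α k) with h | h
    · have h2 : 2 < α k := by simpa [abs_of_pos h] using hα k
      exact ⟨(α k - 2) / 4, by linarith, norm_gammaW_sub_ge _ h2⟩
    · refine ⟨2, two_pos, fun t => ?_⟩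
      refine le_trans ?_ ((le_abs_self _).trans (abs_re_le_norm _))
      rw [sub_re, ofReal_re]
      linarith [two_le_gammaW_re t]
  have hne : ∀ {z : ℂ} {δ : ℝ}, 0 < δ → δ ≤ ‖z‖ → z ≠ 0 := fun hδ h h0 => by
    rw [h0, norm_zero] at h; linarith
  have hi := fun k => let ⟨_, hδ, h⟩ := hγα k; integrable_gaussCauchy hc x hδ h
  have h1 : ∀ t, gaussExp c x (gammaW t) * (n (gammaW t))⁻¹ * dgammaW t * (gammaW t - β)⁻¹ =
      (n β)⁻¹ * (gaussExp c x (gammaW t) * dgammaW t * (gammaW t - β)⁻¹) -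
      ∑ k, w k * (β - α k)⁻¹ * (gaussExp c x (gammaW t) * dgammaW t * (gammaW t - α k)⁻¹) := by
    intro t
    have e0 := hne two_pos (hγβ t)
    have e1 : ∀ k, gammaW t - α k ≠ 0 := fun k => let ⟨_, hδ, h⟩ := hγα k; hne hδ (h t)
    rw [hn _ fun k => sub_ne_zero.1 (e1 k), hn _ hβα]
    simp only [Finset.mul_sum, Finset.sum_mul]
    rw [← Finset.sum_sub_distrib]
    refine Finset.sum_congr rfl fun k _ => ?_
    have e2 := e1 k
    have e3 := sub_ne_zero.2 (hβα k)
    field_simp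
    ring
  simp only [h1]
  rw [integral_sub ((integrable_gaussCauchy hc x two_pos hγβ).const_mul _)
    (integrable_finsetSum _ fun k _ => (hi k).const_mul _), integral_const_mul,
    integral_finsetSum _ fun k _ => (hi k).const_mul _]
  have h2 := gaussCauchy_eq_zero hc x hβ.le
  rw [gaussCauchy] at h2
  rw [h2, mul_zero, zero_sub]
  congr 1
  refine Finset.sum_congr rfl fun k _ => ?_
  rw [integral_const_mul]
  have h3 : ∫ t, gaussExp c x (gammaW t) * dgammaW t * (gammaW t - α k)⁻¹ =
    gaussCauchy c x (α k) := rfl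
  rw [h3]
  split_ifs with h
  · rw [gaussCauchy_eq_residue hc x (by simpa [abs_of_pos h] using hα k)]
    ring
  · rw [gaussCauchy_eq_zero hc x (by rw [ofReal_re]; linarith), mul_zero]

/-- The kernel of the exponential model as a double contour integral. -/
theorem sum_modelU_mul_modelV_eq {c : ℝ} (hc : 2 ≤ c) {α : Fin N → ℝ} (hN : 0 < N)
    (hinj : Function.Injective α) (hα : ∀ k, 2 < |α k|)
    (heven : ∀ z : ℂ, ∏ k, (-z - α k) = ∏ k, (z - α k)) {D : ℂ} (hD : D ≠ 0) {W : ℂ → ℂ}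
    (hW : ∀ z, W z = D * (∏ k, (z - α k)) * exp (c * z ^ 2)) (x y : ℝ) :
    ((∑ k, modelU α k x * modelV c α k y : ℝ) : ℂ) = hyperbolaKernel W x y := by
  set w : Fin N → ℝ := Lagrange.nodalWeight Finset.univ α with hw
  have hinner : ∀ (x : ℝ) (β : ℂ), hyperbolaInner W x β = D⁻¹ * ∫ t, gaussExp c x (gammaW t) *
      (∏ k, (gammaW t - α k))⁻¹ * dgammaW t * (gammaW t - β)⁻¹ := by
    intro x β
    rw [hyperbolaInner, ← integral_const_mul]
    congr 1
    ext t
    rw [hW, mul_inv, mul_inv, ← exp_neg, gaussExp, sub_eq_add_neg (-(x * gammaW t : ℂ)), exp_add]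
    ring
  -- The first term collects the residues at positive zeros. In the second, evenness lets the zeros
  -- be relisted as -α_k with weights -w_k, so that it supplies the negative ones.
  have hsum : ∀ s : ℝ, hyperbolaInner W x (s * I) + hyperbolaInner W (-x) (-(s * I)) =
      -(D⁻¹ * ∑ k, 2 * Real.pi * I * w k * gaussExp c x (α k) * (s * I - α k)⁻¹) := by
    intro s
    rw [hinner, hinner, integral_gaussExp_mul_inv hc x hα
      (fun μ hμ => prod_sub_inv_eq_sum hN hinj hμ) (by simp),
      integral_gaussExp_mul_inv hc (-x) (α := fun k => -α k) (w := fun k => -w k)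
      (n := fun z => ∏ k, (z - α k))
      (fun k => by simpa only [abs_neg] using hα k) ?_ (by simp), ← mul_add, ← neg_add, ← Finset.sum_add_distrib, mul_neg]
    · congr 2
      refine Finset.sum_congr rfl fun k _ => ?_
      have e1 : gaussExp c (-x) ((-α k : ℝ) : ℂ) = gaussExp c x (α k) := by
        simp [gaussExp]
      rcases lt_trichotomy 0 (α k) with h | h | h
      · rw [if_pos h, if_neg (by linarith), add_zero]
      · have := hα k
        rw [← h, abs_zero] at this
        linarith
      · rw [if_neg (by linarith), if_pos (by linarith), zero_add, e1]
        have e2 : (-(s * I : ℂ) - ((-α k : ℝ) : ℂ))⁻¹ = -(s * I - α k : ℂ)⁻¹ := by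
          rw [← inv_neg]; congr 1; push_cast; ring
        rw [e2]
        push_cast
        ring
    · intro μ hμ
      have hμ' : ∀ k, -μ ≠ α k := fun k h => hμ k (by push_cast; rw [← h, neg_neg])
      rw [← heven μ, prod_sub_inv_eq_sum hN hinj hμ']
      refine Finset.sum_congr rfl fun k _ => ?_
      have e2 : (μ - ((-α k : ℝ) : ℂ))⁻¹ = -(-μ - α k : ℂ)⁻¹ := by
        rw [← inv_neg]; congr 1; push_cast; ring
      rw [e2]
      push_cast
      ring
  have hF : ∀ k, (modelV c α k y : ℂ) = ∫ s : ℝ, 1 / (2 * (Real.pi : ℂ)) * exp (-c * s ^ 2) *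
      ((Real.exp (-c * α k ^ 2) * w k : ℝ) * ∏ j ∈ Finset.univ.erase k, (s * I - α j)) *
      exp (y * (s * I)) := by
    intro k
    rw [modelV, ← fourierGauss_eq hc, fourierGauss, expInt]
    congr 1
    ext s
    rw [modelPoly, map_smul, Lagrange.nodal, map_prod, pair3_apply]
    simp only [Polynomial.aeval_sub, Polynomial.aeval_X, Polynomial.aeval_C, coe_algebraMap,
      real_smul]
    congr 2
    ring
  have hFi : ∀ k, Integrable fun s : ℝ => 1 / (2 * (Real.pi : ℂ)) * exp (-c * s ^ 2) *
      ((Real.exp (-c * α k ^ 2) * w k : ℝ) * ∏ j ∈ Finset.univ.erase k, (s * I - α j)) *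
      exp (y * (s * I)) := by
    intro k
    have := (expIntegrable_fourierGauss hc (modelPoly c α k)).integrable_mul_exp (0, (y : ℂ), 0)
    refine this.congr (ae_of_all _ fun s => ?_)
    simp only
    rw [modelPoly, map_smul, Lagrange.nodal, map_prod, pair3_apply]
    simp only [Polynomial.aeval_sub, Polynomial.aeval_X, Polynomial.aeval_C, coe_algebraMap,
      real_smul]
    congr 2
    ring
  rw [hyperbolaKernel, ← integral_const_mul]
  push_cast
  simp only [hF, ← integral_const_mul]
  rw [← integral_finsetSum _ fun k _ => (hFi k).const_mul _]
  congr 1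
  ext s
  rw [hsum, hW]
  have hne : ∀ k, (s * I - α k : ℂ) ≠ 0 := fun k h => by
    have h1 := congrArg re h
    have h2 := hα k
    simp at h1
    rw [h1, abs_zero] at h2
    linarith
  rw [Finset.mul_sum, ← Finset.sum_neg_distrib, Finset.mul_sum, Finset.mul_sum]
  refine Finset.sum_congr rfl fun k _ => ?_
  -- The residue factor 1/(λ - α_k) removes one zero of W, leaving the nodal polynomial of the other
  -- zeros.
  rw [← Finset.mul_prod_erase _ _ (Finset.mem_univ k)]
  have e1 : gaussExp c x (α k) = (modelU α k x : ℂ) * (Real.exp (-c * α k ^ 2) : ℝ) := by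
    rw [modelU, ← ofReal_mul, ← Real.exp_add, gaussExp]
    push_cast
    congr 1
    ring
  have e2 : exp (c * (s * I : ℂ) ^ 2) = exp (-c * s ^ 2) := by
    congr 1
    rw [mul_pow, I_sq]; ring
  rw [e1, e2]
  have e3 := hne k
  have e4 : (Real.pi : ℂ) ≠ 0 := ofReal_ne_zero.2 Real.pi_ne_zero
  push_cast
  field_simp
  rw [I_sq]
  ring

end HyperbolaKernel

end

noncomputable section

/-! ### Deformation of the Pearcey contour. -/

section PearceyContour

open Complex MeasureTheory Set Filter Topology

/-- The weight of the Pearcey kernel. -/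
def pearceyWeight (τ : ℝ) (z : ℂ) : ℂ := exp (-(z ^ 4 / 4) + τ / 2 * z ^ 2)

theorem exp_mul_pearceyWeight_inv (τ x : ℝ) (z : ℂ) :
    exp (-(x * z)) * (pearceyWeight τ z)⁻¹ = exp (pearceyPhase τ x z) := by
  rw [pearceyWeight, ← exp_neg, ← exp_add, pearceyPhase]
  congr 1
  ring

/-- Bound for the exponent of the Pearcey integrand between `gammaR` and `gammaW`. -/
def pearceyBound (τ x : ℝ) : ℝ := 4 + 2 * |τ| + 2 * |x| + x ^ 2 + (4 + 5 / 2 * |τ|) ^ 2 / 4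

/-- Between the two hyperbolas Re z⁴ ≤ 16 + 8T² - 4T⁴. The quartic term absorbs the lower ones by
completing a square in T², leaving e^{-T²}. -/
theorem norm_exp_pearceyPhase_le (τ x : ℝ) {T : ℝ} {z : ℂ} (h1 : √(1 + T ^ 2) ≤ z.re)
    (h2 : z.re ≤ 2 * √(1 + T ^ 2)) (him : |z.im| = |T|) :
    ‖exp (pearceyPhase τ x z)‖ ≤ Real.exp (pearceyBound τ x) * Real.exp (-T ^ 2) := by
  rw [norm_exp, ← Real.exp_add, Real.exp_le_exp]
  have hre : (pearceyPhase τ x z).re = (z.re ^ 4 - 6 * z.re ^ 2 * z.im ^ 2 + z.im ^ 4) / 4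
      - τ / 2 * (z.re ^ 2 - z.im ^ 2) - x * z.re := by
    obtain ⟨a, b⟩ := z
    have h : pearceyPhase τ x ⟨a, b⟩ = ((a ^ 4 - 6 * a ^ 2 * b ^ 2 + b ^ 4) / 4
        - τ / 2 * (a ^ 2 - b ^ 2) - x * a : ℝ)
        + ((a ^ 3 * b - a * b ^ 3) - τ * a * b - x * b : ℝ) * I := by
      rw [pearceyPhase, mk_eq_add_mul_I]
      push_cast
      linear_combination (a ^ 2 * b ^ 2 * 3 / 2 + a * b ^ 3 * I + b ^ 4 / 4 * (I ^ 2 - 1)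
        - τ / 2 * b ^ 2 : ℂ) * I_sq
    rw [h, add_re, ofReal_re, re_ofReal_mul, I_re, mul_zero, add_zero]
  have hs : √(1 + T ^ 2) ^ 2 = 1 + T ^ 2 := Real.sq_sqrt (by positivity)
  have hs0 : 0 ≤ √(1 + T ^ 2) := Real.sqrt_nonneg _
  have hb : z.im ^ 2 = T ^ 2 := by rw [← sq_abs, him, sq_abs]
  have hA1 : 1 + T ^ 2 ≤ z.re ^ 2 := by nlinarith
  have hA2 : z.re ^ 2 ≤ 4 * (1 + T ^ 2) := by nlinarith
  have hb4 : z.im ^ 4 = T ^ 4 := by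
    rw [show z.im ^ 4 = (z.im ^ 2) ^ 2 by ring, hb]; ring
  have h4 : z.re ^ 4 - 6 * z.re ^ 2 * z.im ^ 2 + z.im ^ 4 ≤ 16 + 8 * T ^ 2 - 4 * T ^ 4 := by
    rw [hb, hb4]
    nlinarith [mul_nonneg (sub_nonneg.2 hA1) (sub_nonneg.2 hA2), sq_nonneg T,
      mul_nonneg (sub_nonneg.2 hA1) (sq_nonneg T)]
  have h5 : -(τ / 2 * (z.re ^ 2 - z.im ^ 2)) ≤ |τ| / 2 * (4 + 5 * T ^ 2) := by
    have e1 : |z.re ^ 2 - z.im ^ 2| ≤ 4 + 5 * T ^ 2 := by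
      rw [abs_le]; constructor <;> nlinarith [sq_nonneg T]
    calc _ ≤ |τ / 2 * (z.re ^ 2 - z.im ^ 2)| := neg_le_abs _
      _ = |τ| / 2 * |z.re ^ 2 - z.im ^ 2| := by rw [abs_mul, abs_div, abs_two]
      _ ≤ _ := by gcongr
  have h6 : -(x * z.re) ≤ |x| * (2 * (1 + |T|)) := by
    calc -(x * z.re) ≤ |x * z.re| := neg_le_abs _
      _ = |x| * z.re := by rw [abs_mul, abs_of_nonneg (a := z.re)]; linarith
      _ ≤ _ := by gcongr; linarith [sqrt_one_add_sq_le T]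
  have h7 : 2 * (|x| * |T|) ≤ x ^ 2 + T ^ 2 := by
    nlinarith [sq_nonneg (|x| - |T|), sq_abs x, sq_abs T]
  rw [hre, pearceyBound]
  nlinarith [sq_nonneg (T ^ 2 - (4 + 5 / 2 * |τ|) / 2), abs_nonneg τ]

theorem integrable_pearcey_contour (τ x : ℝ) {γ γ' : ℝ → ℂ} (hγ : ∀ t, HasDerivAt γ (γ' t) t)
    (hγ' : Continuous γ') (hγ'n : ∀ t, ‖γ' t‖ ≤ 3) (h1 : ∀ t, √(1 + t ^ 2) ≤ (γ t).re)
    (h2 : ∀ t, (γ t).re ≤ 2 * √(1 + t ^ 2)) (him : ∀ t, (γ t).im = -t) {β : ℂ} (hβ : β.re = 0) :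
    Continuous (fun t => exp (pearceyPhase τ x (γ t)) * (γ t - β)⁻¹ * γ' t) ∧
    Integrable fun t => exp (pearceyPhase τ x (γ t)) * (γ t - β)⁻¹ * γ' t := by
  have hone : ∀ t : ℝ, 1 ≤ √(1 + t ^ 2) := fun t => Real.one_le_sqrt.2 (by nlinarith [sq_nonneg t])
  have hd : ∀ t, 1 ≤ ‖γ t - β‖ := fun t => by
    refine le_trans ?_ ((le_abs_self _).trans (abs_re_le_norm _))
    rw [sub_re, hβ, sub_zero]
    exact (hone t).trans (h1 t)
  have hcγ : Continuous γ := continuous_iff_continuousAt.2 fun t => (hγ t).continuousAt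
  have hcont : Continuous fun t => exp (pearceyPhase τ x (γ t)) * (γ t - β)⁻¹ * γ' t := by
    refine Continuous.mul (Continuous.mul ?_ ?_) hγ'
    · unfold pearceyPhase; fun_prop
    · refine (hcγ.sub continuous_const).inv₀ fun t h => ?_
      have := hd t
      rw [show γ t - β = 0 from h, norm_zero] at this
      linarith
  refine ⟨hcont, ?_⟩
  have h0 : Integrable fun t : ℝ => 3 * Real.exp (pearceyBound τ x) * Real.exp (-1 * t ^ 2) :=
    (integrable_exp_neg_mul_sq one_pos).const_mul _
  refine h0.mono' hcont.aestronglyMeasurable (ae_of_all _ fun t => ?_)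
  rw [norm_mul, norm_mul, norm_inv]
  calc _ ≤ (Real.exp (pearceyBound τ x) * Real.exp (-t ^ 2)) * 1 * 3 := by
        gcongr
        · exact norm_exp_pearceyPhase_le τ x (h1 t) (h2 t) (by rw [him, abs_neg])
        · exact inv_le_one_of_one_le₀ (hd t)
        · exact hγ'n t
    _ = _ := by rw [neg_one_mul]; ring

/-- The contour `gammaR` can be replaced by `gammaW`. -/
theorem integral_gammaR_eq_hyperbolaInner (τ x : ℝ) {β : ℂ} (hβ : β.re = 0) :
    ∫ t, exp (pearceyPhase τ x (gammaR t)) * (gammaR t - β)⁻¹ * dgammaR t =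
      hyperbolaInner (pearceyWeight τ) x β := by
  have hone : ∀ t : ℝ, 1 ≤ √(1 + t ^ 2) := fun t => Real.one_le_sqrt.2 (by nlinarith [sq_nonneg t])
  obtain ⟨cR, iR⟩ := integrable_pearcey_contour τ x hasDerivAt_gammaR continuous_dgammaR
    (fun t => (norm_dgammaR_le t).trans (by norm_num)) (fun t => (gammaR_re t).ge)
    (fun t => by rw [gammaR_re]; linarith [hone t]) gammaR_im hβ
  obtain ⟨cW, iW⟩ := integrable_pearcey_contour τ x hasDerivAt_gammaW continuous_dgammaW
    norm_dgammaW_le (fun t => by rw [gammaW_re]; linarith [hone t]) (fun t => (gammaW_re t).le)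
    gammaW_im hβ
  have hW : hyperbolaInner (pearceyWeight τ) x β =
      ∫ t, exp (pearceyPhase τ x (gammaW t)) * (gammaW t - β)⁻¹ * dgammaW t := by
    rw [hyperbolaInner]
    congr 1
    ext t
    rw [exp_mul_pearceyWeight_inv]
    ring
  rw [hW, ← sub_eq_zero, ← integral_sub iR iW]
  refine integral_eq_of_tendsto_symm (iR.sub iW)
    (g := fun T => 4 * Real.exp (pearceyBound τ x) * (T * Real.exp (-T))) ?_ ?_
  · simpa using tendsto_mul_exp_neg.const_mul (4 * Real.exp (pearceyBound τ x))
  filter_upwards [eventually_ge_atTop 1] with T hT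
  simp only [Pi.sub_apply]
  rw [intervalIntegral.integral_sub (cR.intervalIntegrable _ _) (cW.intervalIntegrable _ _),
    sub_zero]
  have hne : ∀ z : ℂ, 0 < z.re → z - β ≠ 0 := by
    intro z hz h
    rw [sub_eq_zero] at h
    rw [h] at hz
    linarith
  obtain ⟨G, hG⟩ := exists_primitive_of_right_half_plane
    (F := fun z => exp (pearceyPhase τ x z) * (z - β)⁻¹) (fun z hz => by
      refine DifferentiableAt.mul (by unfold pearceyPhase; fun_prop) ?_
      exact (differentiableAt_id.sub_const β).inv (hne z hz)) (4 + 5 * T ^ 2) (by positivity)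
  have hG' : ∀ z : ℂ, 1 ≤ z.re → z.re ≤ 2 * √(1 + T ^ 2) → |z.im| ≤ T →
      HasDerivAt G (exp (pearceyPhase τ x z) * (z - β)⁻¹) z := by
    intro z hz1 hz2 hz3
    refine hG z hz1 ?_
    rw [← normSq_eq_norm_sq, normSq_apply]
    have e1 := Real.mul_self_sqrt (show 0 ≤ 1 + T ^ 2 by positivity)
    have e2 : z.im ^ 2 ≤ T ^ 2 := sq_le_sq' (abs_le.1 hz3).1 (abs_le.1 hz3).2
    nlinarith
  have hmono : ∀ t ∈ Icc (-T) T, √(1 + t ^ 2) ≤ √(1 + T ^ 2) := fun t ht =>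
    Real.sqrt_le_sqrt (by nlinarith [sq_le_sq' ht.1 ht.2])
  rw [integral_comp_path_eq_sub hasDerivAt_gammaR (F := fun z => exp (pearceyPhase τ x z) * (z - β)⁻¹)
      (by linarith) (fun t ht => hG' _ (one_le_gammaR_re t)
        (by rw [gammaR_re]; linarith [hmono t ht, hone T])
        (by rw [gammaR_im, abs_neg]; exact abs_le.2 ht)) cR,
    integral_comp_path_eq_sub hasDerivAt_gammaW (F := fun z => exp (pearceyPhase τ x z) * (z - β)⁻¹)
      (by linarith) (fun t ht => hG' _ (by linarith [two_le_gammaW_re t])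
        (by rw [gammaW_re]; linarith [hmono t ht])
        (by rw [gammaW_im, abs_neg]; exact abs_le.2 ht)) cW]
  -- Both curves have imaginary part -t, so their ends are joined by horizontal segments, of length
  -- √(1 + T²) ≤ 2T.
  have hseg : ∀ t : ℝ, |t| = T → ‖G (gammaR t) - G (gammaW t)‖ ≤
      Real.exp (pearceyBound τ x) * Real.exp (-T) * (2 * T) := by
    intro t ht
    have ht2 : t ^ 2 = T ^ 2 := by rw [← ht, sq_abs]
    have hsub : gammaR t - gammaW t = ((-√(1 + T ^ 2) : ℝ) : ℂ) := by
      rw [gammaR, gammaW, ht2]; push_cast; ring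
    have hn : ‖gammaR t - gammaW t‖ ≤ 2 * T := by
      rw [hsub, norm_real, Real.norm_eq_abs, abs_neg, abs_of_nonneg (Real.sqrt_nonneg _)]
      have := sqrt_one_add_sq_le T
      rw [abs_of_nonneg (by linarith)] at this
      linarith
    refine le_trans (norm_sub_le_of_hasDerivAt_box (G := G)
      (F := fun z => exp (pearceyPhase τ x z) * (z - β)⁻¹)
      (a := √(1 + T ^ 2)) (b := 2 * √(1 + T ^ 2)) (c := -t) (d := -t)
      (C := Real.exp (pearceyBound τ x) * Real.exp (-T)) (z := gammaW t) (w := gammaR t) ?_ ?_ ?_)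
      (by gcongr)
    · intro z hz hz'
      have him : z.im = -t := le_antisymm hz'.2 hz'.1
      have him' : |z.im| = T := by rw [him, abs_neg, ht]
      have hT1 := hone T
      refine ⟨hG' z (by linarith [hz.1]) hz.2 him'.le, ?_⟩
      rw [norm_mul, norm_inv]
      have hd : 1 ≤ ‖z - β‖ := by
        refine le_trans ?_ ((le_abs_self _).trans (abs_re_le_norm _))
        rw [sub_re, hβ]
        linarith [hz.1]
      calc _ ≤ (Real.exp (pearceyBound τ x) * Real.exp (-T ^ 2)) * 1 := by
            gcongr
            · exact norm_exp_pearceyPhase_le τ x hz.1 hz.2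
                (by rw [him', abs_of_nonneg (by linarith)])
            · exact inv_le_one_of_one_le₀ hd
        _ ≤ _ := by rw [mul_one]; gcongr; nlinarith
    · rw [gammaW_re, gammaW_im, ht2]
      exact ⟨⟨by linarith [hone T], le_rfl⟩, le_rfl, le_rfl⟩
    · rw [gammaR_re, gammaR_im, ht2]
      exact ⟨⟨le_rfl, by linarith [hone T]⟩, le_rfl, le_rfl⟩
  have e1 := hseg T (abs_of_nonneg (by linarith))
  have e2 := hseg (-T) (by rw [abs_neg]; exact abs_of_nonneg (by linarith))
  calc _ = ‖(G (gammaR T) - G (gammaW T)) - (G (gammaR (-T)) - G (gammaW (-T)))‖ := by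
        congr 1; ring
    _ ≤ _ := norm_sub_le _ _
    _ ≤ _ := add_le_add e1 e2
    _ = _ := by ring

/-- The substitution μ ↦ -μ folds the left branch onto the right one at the price of changing the
signs of x and λ, since the weight is even. -/
theorem kTot_eq_hyperbolaKernel (x y τ : ℝ) :
    kTot ((x : ℂ), (y : ℂ), (τ : ℂ)) = hyperbolaKernel (pearceyWeight τ) x y := by
  have key : ∀ σ : ℝ, IsSign (σ : ℂ) → ∀ s : ℝ, ∫ t, kDens σ (t, s)
      * exp (pair3 (kFreq σ (t, s)) ((x : ℂ), (y : ℂ), (τ : ℂ))) =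
      I / (4 * Real.pi ^ 2) * (exp (y * (s * I)) * pearceyWeight τ (s * I) *
        hyperbolaInner (pearceyWeight τ) (σ * x) (σ * (s * I))) := by
    intro σ hσ s
    rw [← integral_gammaR_eq_hyperbolaInner τ (σ * x) (by simp), ← integral_const_mul,
      ← integral_const_mul]
    congr 1
    ext t
    have hσ2 : (σ : ℂ) ^ 2 = 1 := hσ.sq
    have h1 : exp (y * (s * I)) * pearceyWeight τ (s * I)
        * exp (pearceyPhase τ (σ * x) (gammaR t)) = exp ((σ * gammaR t) ^ 4 / 4)
        * exp (-(s * I) ^ 4 / 4) * exp (pair3 (pFreq σ t) ((x : ℂ), (y : ℂ), (τ : ℂ))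
            + pair3 (bFreq s) ((x : ℂ), (y : ℂ), (τ : ℂ))) := by
      rw [pearceyWeight, ← exp_add, ← exp_add, ← exp_add, ← exp_add]
      congr 1
      simp only [pearceyPhase, pair3_apply, pFreq, bFreq]
      push_cast
      linear_combination (-gammaR t ^ 4 / 4 * (σ ^ 2 + 1) + τ / 2 * gammaR t ^ 2) * hσ2
    have h2 : (σ : ℂ) * (s * I - σ * gammaR t)⁻¹ = -(gammaR t - σ * (s * I))⁻¹ := by
      have hσ0 : (σ : ℂ) ≠ 0 := fun h => by rw [h] at hσ2; norm_num at hσ2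
      rw [show gammaR t - σ * (s * I) = -(σ * (s * I - σ * gammaR t)) by
        linear_combination (-gammaR t) * hσ2, inv_neg, neg_neg, mul_inv]
      congr 1
      exact eq_inv_of_mul_eq_one_left (by rw [← pow_two, hσ2])
    have h3 : cTwoPiI ^ 2 * I = -(I / (4 * Real.pi ^ 2)) := by
      have : (Real.pi : ℂ) ≠ 0 := ofReal_ne_zero.2 Real.pi_ne_zero
      rw [cTwoPiI, div_pow, mul_pow, mul_pow, I_sq]
      field_simp
      ring
    rw [pair3_kFreq]
    simp only [kDens, pDens, bDens, pow_zero, mul_one, pDens₀, bDens₀, cauchyKer]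
    calc _ = (cTwoPiI ^ 2 * I) * (exp ((σ * gammaR t) ^ 4 / 4)
        * exp (-(s * I) ^ 4 / 4) * exp (pair3 (pFreq σ t) ((x : ℂ), (y : ℂ), (τ : ℂ))
            + pair3 (bFreq s) ((x : ℂ), (y : ℂ), (τ : ℂ)))) *
            (σ * (s * I - σ * gammaR t)⁻¹) * dgammaR t := by ring
      _ = _ := by rw [← h1, h2, h3]; ring
  have hk : ∀ σ : ℝ, IsSign (σ : ℂ) → kInt σ ((x : ℂ), (y : ℂ), (τ : ℂ)) =
      (∫ s : ℝ, I / (4 * Real.pi ^ 2) * (exp (y * (s * I)) * pearceyWeight τ (s * I) *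
        hyperbolaInner (pearceyWeight τ) (σ * x) (σ * (s * I)))) ∧
      Integrable fun s : ℝ => I / (4 * Real.pi ^ 2) * (exp (y * (s * I)) * pearceyWeight τ (s * I) *
        hyperbolaInner (pearceyWeight τ) (σ * x) (σ * (s * I))) := by
    intro σ hσ
    have hi := (expIntegrable_kDens hσ).integrable_mul_exp ((x : ℂ), (y : ℂ), (τ : ℂ))
    have h1 := hi.integral_prod_right
    simp only [key σ hσ] at h1
    refine ⟨?_, h1⟩
    rw [kInt, expInt, integral_prod_symm _ hi]
    simp only [key σ hσ]
  have k1 := hk 1 (by simpa using isSign_one)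
  have k2 := hk (-1) (by simpa using isSign_neg_one)
  have c1 : ((1 : ℝ) : ℂ) = 1 := ofReal_one
  have c2 : ((-1 : ℝ) : ℂ) = -1 := by simp
  rw [c1] at k1
  rw [c2] at k2
  rw [kTot, k1.1, k2.1, ← integral_add k1.2 k2.2, hyperbolaKernel, ← integral_const_mul]
  congr 1
  ext s
  rw [one_mul, one_mul, neg_one_mul, neg_one_mul]
  ring

end PearceyContour

end

noncomputable section

/-! ### Approximation of the Pearcey weight by polynomials times Gaussians. -/

section ApproximateWeight

open Complex Filter Topology

/-- The size of the squared inverse zeros of the approximate Pearcey weight. -/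
def nodeScale (m : ℕ) : ℝ := (√(2 * m))⁻¹

/-- The squared inverse zeros of the approximate Pearcey weight. -/
def node (m : ℕ) (j : Fin m) : ℝ := nodeScale m * (1 + (j : ℝ) / m ^ 2)

/-- A polynomial times a Gaussian, approximating `pearceyWeight`. -/
def approxWeight (τ : ℝ) (m : ℕ) (z : ℂ) : ℂ :=
  exp (τ / 2 * z ^ 2) * ∏ j : Fin m, ((1 - node m j * z ^ 2) * exp (node m j * z ^ 2))

theorem nodeScale_pos {m : ℕ} (hm : 0 < m) : 0 < nodeScale m := by
  unfold nodeScale; positivity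

/-- The normalization behind the limit: the second order terms -w²/2 of log(1 - w) + w then add up
to -z⁴/4. -/
theorem mul_nodeScale_sq {m : ℕ} (hm : 0 < m) : (m : ℝ) * nodeScale m ^ 2 = 1 / 2 := by
  have : (m : ℝ) ≠ 0 := by positivity
  rw [nodeScale, inv_pow, Real.sq_sqrt (by positivity)]
  field_simp

theorem tendsto_nodeScale : Tendsto nodeScale atTop (𝓝 0) := by
  refine tendsto_inv_atTop_zero.comp (Real.tendsto_sqrt_atTop.comp ?_)
  exact tendsto_natCast_atTop_atTop.const_mul_atTop two_pos

theorem nodeScale_le_node {m : ℕ} (j : Fin m) : nodeScale m ≤ node m j := by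
  have : 0 < nodeScale m := nodeScale_pos (Fin.pos j)
  rw [node]
  nlinarith [show (0 : ℝ) ≤ (j : ℝ) / m ^ 2 by positivity]

theorem node_le {m : ℕ} (j : Fin m) : node m j ≤ nodeScale m * (1 + 1 / m) := by
  have hm := Fin.pos j
  have : 0 < nodeScale m := nodeScale_pos hm
  have h0 : (0 : ℝ) < m := by exact_mod_cast hm
  have h1 : (j : ℝ) ≤ m := by exact_mod_cast j.2.le
  rw [node]
  gcongr ?_ * (1 + ?_)
  rw [div_le_div_iff₀ (by positivity) h0]
  nlinarith

theorem node_pos {m : ℕ} (j : Fin m) : 0 < node m j :=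
  (nodeScale_pos (Fin.pos j)).trans_le (nodeScale_le_node j)

theorem node_le_two_mul {m : ℕ} (j : Fin m) : node m j ≤ 2 * nodeScale m := by
  have hm := Fin.pos j
  have h0 : (1 : ℝ) ≤ m := by exact_mod_cast hm
  have h1 : (1 : ℝ) / m ≤ 1 := by rw [div_le_one (by linarith)]; exact h0
  refine (node_le j).trans ?_
  nlinarith [nodeScale_pos hm]

/-- The perturbation 1 + j/m² serves only to make the zeros simple; being 1 + O(1/m), it disappears
in the limit. -/
theorem node_injective (m : ℕ) : Function.Injective (node m) := by
  intro i j h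
  have hm := Fin.pos i
  have h0 : (0 : ℝ) < m := by exact_mod_cast hm
  have h1 := mul_left_cancel₀ (nodeScale_pos hm).ne' h
  have h2 : (i : ℝ) / m ^ 2 = (j : ℝ) / m ^ 2 := by linarith
  rw [div_left_inj' (by positivity)] at h2
  exact Fin.ext (by exact_mod_cast h2)

theorem sum_node_sq_bounds {m : ℕ} (hm : 0 < m) :
    1 / 2 ≤ ∑ j, node m j ^ 2 ∧ ∑ j, node m j ^ 2 ≤ (1 + 1 / (m : ℝ)) ^ 2 / 2 := by
  have hs := nodeScale_pos hm
  constructor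
  · calc 1 / 2 = ∑ j : Fin m, nodeScale m ^ 2 := by
          rw [Finset.sum_const, Finset.card_univ, Fintype.card_fin, nsmul_eq_mul,
            mul_nodeScale_sq hm]
      _ ≤ _ := Finset.sum_le_sum fun j _ => by gcongr; exact nodeScale_le_node j
  · calc _ ≤ ∑ j : Fin m, (nodeScale m * (1 + 1 / m)) ^ 2 :=
          Finset.sum_le_sum fun j _ => by
            have := node_pos j
            gcongr; exact node_le j
      _ = _ := by
          rw [Finset.sum_const, Finset.card_univ, Fintype.card_fin, nsmul_eq_mul, mul_pow,
            ← mul_assoc, mul_nodeScale_sq hm]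
          ring

theorem tendsto_sum_node_sq : Tendsto (fun m => ∑ j, node m j ^ 2) atTop (𝓝 (1 / 2)) := by
  have h1 : Tendsto (fun m : ℕ => (1 + 1 / (m : ℝ)) ^ 2 / 2) atTop (𝓝 (1 / 2)) := by
    have := ((tendsto_one_div_atTop_nhds_zero_nat (𝕜 := ℝ)).const_add 1).pow 2 |>.div_const 2
    simpa using this
  refine tendsto_of_tendsto_of_tendsto_of_le_of_le' tendsto_const_nhds h1 ?_ ?_
  · filter_upwards [eventually_gt_atTop 0] with m hm using (sum_node_sq_bounds hm).1
  · filter_upwards [eventually_gt_atTop 0] with m hm using (sum_node_sq_bounds hm).2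

theorem norm_log_one_sub_add_le {w : ℂ} (hw : ‖w‖ ≤ 1 / 2) :
    ‖log (1 - w) + w + w ^ 2 / 2‖ ≤ ‖w‖ ^ 3 := by
  have h := norm_log_sub_logTaylor_le 2 (z := -w) (by rw [norm_neg]; linarith)
  have h1 : logTaylor (2 + 1) (-w) = -w - w ^ 2 / 2 := by
    simp [logTaylor, Finset.sum_range_succ]
    ring
  rw [h1, norm_neg] at h
  have h2 : (1 - ‖w‖)⁻¹ ≤ 2 := by
    rw [inv_le_comm₀ (by linarith) two_pos]; linarith
  calc _ = ‖log (1 + -w) - (-w - w ^ 2 / 2)‖ := by congr 1; ring_nf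
    _ ≤ _ := h
    _ ≤ ‖w‖ ^ 3 * 2 / 2 := by
      norm_num only
      gcongr
      norm_num
    _ = _ := by ring

/-- Each logarithm is -w²/2 up to |w|³. The squares sum to the quartic exponent, and the m cubic
remainders are of total order mσ³ = σ/2 with σ the scale of the nodes. -/
theorem tendsto_approxWeight (τ : ℝ) (z : ℂ) :
    Tendsto (fun m => approxWeight τ m z) atTop (𝓝 (pearceyWeight τ z)) := by
  have hsmall : ∀ᶠ m in atTop, nodeScale m * (2 * ‖z‖ ^ 2) < 1 / 2 := by
    have := tendsto_nodeScale.mul_const (2 * ‖z‖ ^ 2)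
    rw [zero_mul] at this
    exact this.eventually_lt_const (by norm_num)
  have hnorm : ∀ (m : ℕ) (j : Fin m), ‖(node m j : ℂ) * z ^ 2‖ ≤ nodeScale m * (2 * ‖z‖ ^ 2) := by
    intro m j
    rw [norm_mul, norm_pow, norm_real, Real.norm_eq_abs, abs_of_pos (node_pos j)]
    nlinarith [node_le_two_mul j, sq_nonneg ‖z‖]
  have hrem : Tendsto (fun m => ∑ j, (log (1 - node m j * z ^ 2) + node m j * z ^ 2
      + (node m j * z ^ 2) ^ 2 / 2)) atTop (𝓝 0) := by
    have hb : Tendsto (fun m => nodeScale m * ((2 * ‖z‖ ^ 2) ^ 3 / 2)) atTop (𝓝 0) := by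
      simpa using tendsto_nodeScale.mul_const ((2 * ‖z‖ ^ 2) ^ 3 / 2)
    refine squeeze_zero_norm' ?_ hb
    filter_upwards [hsmall, eventually_gt_atTop 0] with m hm hm0
    calc _ ≤ ∑ j : Fin m, (nodeScale m * (2 * ‖z‖ ^ 2)) ^ 3 := by
          refine (norm_sum_le _ _).trans (Finset.sum_le_sum fun j _ => ?_)
          refine (norm_log_one_sub_add_le ((hnorm m j).trans hm.le)).trans ?_
          gcongr
          exact hnorm m j
      _ = m * nodeScale m ^ 2 * nodeScale m * (2 * ‖z‖ ^ 2) ^ 3 := by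
          rw [Finset.sum_const, Finset.card_univ, Fintype.card_fin, nsmul_eq_mul]
          ring
      _ = _ := by rw [mul_nodeScale_sq hm0]; ring
  have hsq : Tendsto (fun m => ((∑ j, node m j ^ 2 : ℝ) : ℂ)) atTop (𝓝 ((1 / 2 : ℝ) : ℂ)) :=
    (continuous_ofReal.tendsto _).comp tendsto_sum_node_sq
  have hlim := (continuous_exp.tendsto _).comp
    (((hrem.sub (hsq.mul_const (z ^ 4 / 2))).const_add ((τ : ℂ) / 2 * z ^ 2)))
  have e : (τ : ℂ) / 2 * z ^ 2 + (0 - ((1 / 2 : ℝ) : ℂ) * (z ^ 4 / 2))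
      = -(z ^ 4 / 4) + τ / 2 * z ^ 2 := by push_cast; ring
  rw [e] at hlim
  refine hlim.congr' ?_
  filter_upwards [hsmall] with m hm
  rw [Function.comp_apply, exp_add, approxWeight]
  congr 1
  have h1 : ∀ j : Fin m, (1 - node m j * z ^ 2) * exp (node m j * z ^ 2)
      = exp (log (1 - node m j * z ^ 2) + node m j * z ^ 2) := by
    intro j
    rw [exp_add, exp_log]
    intro h0
    have h2 := (hnorm m j).trans_lt hm
    rw [← sub_eq_zero.1 h0, norm_one] at h2
    norm_num at h2
  rw [Finset.prod_congr rfl fun j _ => h1 j, ← exp_sum]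
  congr 1
  push_cast
  rw [Finset.sum_mul, ← Finset.sum_sub_distrib]
  refine Finset.sum_congr rfl fun j _ => ?_
  ring

theorem continuous_approxWeight (τ : ℝ) (m : ℕ) : Continuous (approxWeight τ m) := by
  unfold approxWeight; fun_prop

/-- One factor of the upper bound on the imaginary axis. -/
theorem one_add_le_exp {L σ u : ℝ} (hLσ : 4 * L * σ ≤ 1) (hu : 0 ≤ u) :
    1 + u ≤ Real.exp (u - 2 * L * σ * u + 2 * (4 * L ^ 2 + 128) * σ ^ 2) := by
  set v := u - 2 * L * σ * u + 2 * (4 * L ^ 2 + 128) * σ ^ 2 with hv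
  have h1 : u / 2 ≤ v := by
    have : 0 ≤ 2 * (4 * L ^ 2 + 128) * σ ^ 2 := by positivity
    nlinarith
  refine le_trans ?_ (Real.quadratic_le_exp_of_nonneg (by linarith))
  have h2 : (u / 2) ^ 2 ≤ v ^ 2 := by gcongr
  -- The summand 4L² of the constant completes this square; 128 is there for the companion bound on
  -- γ_W.
  nlinarith [sq_nonneg (u / 2 - 4 * L * σ), sq_nonneg σ]

theorem exp_neg_le_quadratic {y : ℝ} (hy : 0 ≤ y) : Real.exp (-y) ≤ 1 - y + y ^ 2 / 2 := by
  have h := Real.quadratic_le_exp_of_nonneg hy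
  have h0 : 0 < 1 - y + y ^ 2 / 2 := by nlinarith [sq_nonneg (y - 1)]
  rw [Real.exp_neg, inv_le_comm₀ (Real.exp_pos y) h0]
  refine le_trans ?_ h
  rw [inv_le_iff_one_le_mul₀ h0]
  nlinarith [sq_nonneg (y ^ 2)]

/-- One factor of the lower bound on `gammaW`. -/
theorem exp_le_normSq_mul {L σ r A : ℝ} (hL : 0 ≤ L) (hσ : 0 ≤ σ) (hLσ : 4 * L * σ ≤ 1)
    (hσ' : 2560 * σ ^ 2 ≤ 1) (hr : 0 ≤ r) (hA : 1 - 2 * r + 5 / 2 * r ^ 2 - 256 * σ ^ 2 ≤ A) :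
    Real.exp (4 * L * σ * r) ≤
      A * Real.exp (2 * r) * Real.exp (4 * (4 * L ^ 2 + 128) * σ ^ 2) := by
  have hy : 0 ≤ 2 * r - 4 * L * σ * r := by nlinarith
  have h1 := exp_neg_le_quadratic hy
  have h2 : (2 * r - 4 * L * σ * r) ^ 2 ≤ (2 * r) ^ 2 := by
    have : 0 ≤ 4 * L * σ * r := by positivity
    gcongr
    linarith
  -- The minimum of 1 - 2r + 5r²/2 is 3/5, and 2560σ² ≤ 1 says that subtracting 256σ² leaves at
  -- least 1/2.
  have hA0 : 1 / 2 ≤ A := by nlinarith [sq_nonneg (5 / 2 * r - 1)]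
  -- As A ≥ 1/2, the last factor adds at least 2(4L² + 128)σ². Of this 256σ² repays the loss in
  -- `hA`, and 8L²σ² completes the square (r - 4Lσ)²/2.
  have h3 : Real.exp (-(2 * r - 4 * L * σ * r)) ≤ A * (1 + 4 * (4 * L ^ 2 + 128) * σ ^ 2) := by
    have : 0 ≤ 4 * (4 * L ^ 2 + 128) * σ ^ 2 := by positivity
    nlinarith [sq_nonneg (r - 4 * L * σ), mul_nonneg (sub_nonneg.2 hA0) this]
  calc Real.exp (4 * L * σ * r)
      = Real.exp (-(2 * r - 4 * L * σ * r)) * Real.exp (2 * r) := by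
        rw [← Real.exp_add]; congr 1; ring
    _ ≤ A * (1 + 4 * (4 * L ^ 2 + 128) * σ ^ 2) * Real.exp (2 * r) := by gcongr
    _ ≤ A * Real.exp (4 * (4 * L ^ 2 + 128) * σ ^ 2) * Real.exp (2 * r) := by
        gcongr
        linarith [Real.add_one_le_exp (4 * (4 * L ^ 2 + 128) * σ ^ 2)]
    _ = _ := by ring

/-- The number of nodes is large enough for the bounds with the rate `L`. -/
def NodesLarge (L : ℝ) (m : ℕ) : Prop :=
  0 < m ∧ 4 * L * nodeScale m ≤ 1 ∧ 2560 * nodeScale m ^ 2 ≤ 1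

theorem eventually_nodesLarge (L : ℝ) : ∀ᶠ m in atTop, NodesLarge L m := by
  have h1 : Tendsto (fun m => 4 * L * nodeScale m) atTop (𝓝 0) := by
    simpa using tendsto_nodeScale.const_mul (4 * L)
  have h2 : Tendsto (fun m => 2560 * nodeScale m ^ 2) atTop (𝓝 0) := by
    simpa using (tendsto_nodeScale.pow 2).const_mul 2560
  filter_upwards [eventually_gt_atTop 0, h1.eventually_le_const one_pos,
    h2.eventually_le_const one_pos] with m h h' h'' using ⟨h, h', h''⟩

/-- Each of the m factors gains e^{-2Lσ²s²}, together e^{-Ls²} because mσ² = 1/2. The choice L =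
|τ|/2 + 1 outweighs the factor e^{|τ|s²/2} and leaves e^{-s²}. -/
theorem norm_approxWeight_imag_le (τ : ℝ) {m : ℕ} (hm : NodesLarge (|τ| / 2 + 1) m) (s : ℝ) :
    ‖approxWeight τ m (s * I)‖ ≤
      Real.exp (4 * (|τ| / 2 + 1) ^ 2 + 128) * Real.exp (-s ^ 2) := by
  set L := |τ| / 2 + 1 with hL
  have hL0 : 0 ≤ L := by positivity
  have hσ := nodeScale_pos hm.1
  have hz : ((s : ℂ) * I) ^ 2 = ((-s ^ 2 : ℝ) : ℂ) := by
    rw [mul_pow, I_sq]; push_cast; ring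
  have hfac : ∀ j : Fin m, ‖(1 - node m j * ((s : ℂ) * I) ^ 2) * exp (node m j * ((s : ℂ) * I) ^ 2)‖
      ≤ Real.exp (-2 * L * nodeScale m ^ 2 * s ^ 2
        + 2 * (4 * L ^ 2 + 128) * nodeScale m ^ 2) := by
    intro j
    have hu : 0 ≤ node m j * s ^ 2 := mul_nonneg (node_pos j).le (sq_nonneg s)
    have e1 : (1 - node m j * ((s : ℂ) * I) ^ 2) = ((1 + node m j * s ^ 2 : ℝ) : ℂ) := by
      rw [hz]; push_cast; ring
    have e2 : (node m j * ((s : ℂ) * I) ^ 2) = ((-(node m j * s ^ 2) : ℝ) : ℂ) := by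
      rw [hz]; push_cast; ring
    rw [norm_mul, e1, e2, norm_exp, ofReal_re, norm_real, Real.norm_eq_abs,
      abs_of_nonneg (by linarith)]
    calc _ ≤ Real.exp (node m j * s ^ 2 - 2 * L * nodeScale m * (node m j * s ^ 2)
          + 2 * (4 * L ^ 2 + 128) * nodeScale m ^ 2) * Real.exp (-(node m j * s ^ 2)) := by
          gcongr; exact one_add_le_exp hm.2.1 hu
      _ ≤ _ := by
          rw [← Real.exp_add, Real.exp_le_exp]
          have h1 : nodeScale m * s ^ 2 ≤ node m j * s ^ 2 := by
            gcongr; exact nodeScale_le_node j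
          have h2 := mul_le_mul_of_nonneg_left h1 (show 0 ≤ 2 * L * nodeScale m by positivity)
          nlinarith
  rw [approxWeight, norm_mul, norm_prod, hz]
  rw [hz] at hfac
  calc _ ≤ Real.exp (|τ| / 2 * s ^ 2) * ∏ j : Fin m, Real.exp (-2 * L * nodeScale m ^ 2 * s ^ 2
        + 2 * (4 * L ^ 2 + 128) * nodeScale m ^ 2) := by
        refine mul_le_mul ?_ (Finset.prod_le_prod (fun _ _ => norm_nonneg _) fun j _ => hfac j)
          (Finset.prod_nonneg fun _ _ => norm_nonneg _) (Real.exp_pos _).le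
        have e3 : (τ : ℂ) / 2 * ((-s ^ 2 : ℝ) : ℂ) = ((τ / 2 * -s ^ 2 : ℝ) : ℂ) := by push_cast; ring
        rw [e3, norm_exp, ofReal_re, Real.exp_le_exp]
        nlinarith [sq_nonneg s, neg_abs_le τ]
    _ = Real.exp (4 * L ^ 2 + 128) * Real.exp (-s ^ 2) := by
        rw [Finset.prod_const, Finset.card_univ, Fintype.card_fin, ← Real.exp_nat_mul,
          ← Real.exp_add, ← Real.exp_add]
        congr 1
        have := mul_nodeScale_sq hm.1
        rw [hL]
        linear_combination (-2 * (|τ| / 2 + 1) * s ^ 2 + 2 * (4 * (|τ| / 2 + 1) ^ 2 + 128)) * this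

/-- A factor compares |1 - w|² = 1 - 2 Re w + |w|² with e^{-2 Re w}. To win at second order |w|²
must exceed 2(Re w)², that is Re z⁴ < 0, which holds on γ_W for large t; the bounded rest costs a
constant. -/
theorem norm_approxWeight_gammaW_inv_le (τ : ℝ) {m : ℕ} (hm : NodesLarge (|τ| / 2 + 1) m)
    (t : ℝ) : ‖(approxWeight τ m (gammaW t))⁻¹‖ ≤
      Real.exp (4 * (|τ| / 2 + 1) ^ 2 + 128) * Real.exp (-(4 + 3 * t ^ 2)) := by
  set L := |τ| / 2 + 1 with hL
  set R := 4 + 3 * t ^ 2 with hR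
  have hR0 : 0 < R := by positivity
  have hL0 : 0 ≤ L := by positivity
  have hσ := nodeScale_pos hm.1
  have hre : (gammaW t ^ 2).re = R := by
    rw [pow_two, mul_re, gammaW_re, gammaW_im]
    have := Real.mul_self_sqrt (show 0 ≤ 1 + t ^ 2 by positivity)
    linear_combination 4 * this
  have him : (gammaW t ^ 2).im ^ 2 = 16 * t ^ 2 * (1 + t ^ 2) := by
    rw [pow_two (gammaW t), mul_im, gammaW_re, gammaW_im]
    have := Real.sq_sqrt (show 0 ≤ 1 + t ^ 2 by positivity)
    linear_combination 16 * t ^ 2 * this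
  have hfac : ∀ j : Fin m, Real.exp (4 * L * nodeScale m ^ 2 * R) ≤
      ‖(1 - node m j * gammaW t ^ 2) * exp (node m j * gammaW t ^ 2)‖ ^ 2 *
        Real.exp (4 * (4 * L ^ 2 + 128) * nodeScale m ^ 2) := by
    intro j
    have hn := node_pos j
    have e1 : ‖(1 - node m j * gammaW t ^ 2) * exp (node m j * gammaW t ^ 2)‖ ^ 2 =
        ((1 - node m j * R) ^ 2 + node m j ^ 2 * (16 * t ^ 2 * (1 + t ^ 2)))
          * Real.exp (2 * (node m j * R)) := by
      rw [norm_mul, mul_pow, norm_exp, re_ofReal_mul, hre, ← Real.exp_nat_mul,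
        ← normSq_eq_norm_sq, normSq_apply, sub_re, sub_im, re_ofReal_mul, im_ofReal_mul, hre,
        one_re, one_im, ← him]
      push_cast
      ring
    have hsq : node m j ^ 2 ≤ 4 * nodeScale m ^ 2 := by
      nlinarith [node_le_two_mul j]
    have key := exp_le_normSq_mul (L := L) (σ := nodeScale m) (r := node m j * R)
      (A := (1 - node m j * R) ^ 2 + node m j ^ 2 * (16 * t ^ 2 * (1 + t ^ 2))) hL0 hσ.le
      hm.2.1 hm.2.2 (by positivity) (by
        -- The constant 64 is sharp, with equality at t² = 4. Combined with `hsq` it gives the loss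
        -- 256σ².
        have h64 : 5 / 2 * R ^ 2 - 64 ≤ R ^ 2 + 16 * t ^ 2 * (1 + t ^ 2) := by
          rw [hR]; nlinarith [sq_nonneg (t ^ 2 - 4)]
        have h65 := mul_le_mul_of_nonneg_left h64 (sq_nonneg (node m j))
        nlinarith)
    rw [e1]
    refine le_trans (Real.exp_le_exp.2 ?_) key
    have h1 : nodeScale m * R ≤ node m j * R := by gcongr; exact nodeScale_le_node j
    have h2 := mul_le_mul_of_nonneg_left h1 (show 0 ≤ 4 * L * nodeScale m by positivity)
    nlinarith
  set P := ∏ j : Fin m, ‖(1 - node m j * gammaW t ^ 2) * exp (node m j * gammaW t ^ 2)‖ with hP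
  have hP0 : 0 ≤ P := Finset.prod_nonneg fun _ _ => norm_nonneg _
  have hprod : Real.exp (2 * L * R) ≤ P ^ 2 * Real.exp (2 * (4 * L ^ 2 + 128)) := by
    have h := Finset.prod_le_prod (s := (Finset.univ : Finset (Fin m)))
      (fun _ _ => (Real.exp_pos _).le) fun j _ => hfac j
    rw [Finset.prod_mul_distrib, Finset.prod_pow, Finset.prod_const, Finset.prod_const,
      Finset.card_univ, Fintype.card_fin, ← Real.exp_nat_mul, ← Real.exp_nat_mul] at h
    have h3 := mul_nodeScale_sq hm.1
    have e4 : (m : ℝ) * (4 * L * nodeScale m ^ 2 * R) = 2 * L * R := by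
      linear_combination 4 * L * R * h3
    have e5 : (m : ℝ) * (4 * (4 * L ^ 2 + 128) * nodeScale m ^ 2) = 2 * (4 * L ^ 2 + 128) := by
      linear_combination 4 * (4 * L ^ 2 + 128) * h3
    rwa [e4, e5] at h
  have hPlow : Real.exp (L * R - (4 * L ^ 2 + 128)) ≤ P := by
    refine le_of_sq_le_sq ?_ hP0
    rw [← Real.exp_nat_mul]
    have e6 : Real.exp (2 * L * R) = Real.exp (((2 : ℕ) : ℝ) * (L * R - (4 * L ^ 2 + 128)))
        * Real.exp (2 * (4 * L ^ 2 + 128)) := by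
      rw [← Real.exp_add]; congr 1; push_cast; ring
    rw [e6] at hprod
    exact le_of_mul_le_mul_right hprod (Real.exp_pos _)
  have hW : Real.exp (R - (4 * L ^ 2 + 128)) ≤ ‖approxWeight τ m (gammaW t)‖ := by
    rw [approxWeight, norm_mul, norm_prod]
    have e7 : (τ : ℂ) / 2 = ((τ / 2 : ℝ) : ℂ) := by push_cast; ring
    rw [e7, norm_exp, re_ofReal_mul, hre]
    calc _ ≤ Real.exp (τ / 2 * R) * Real.exp (L * R - (4 * L ^ 2 + 128)) := by
          rw [← Real.exp_add, Real.exp_le_exp, hL]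
          nlinarith [neg_abs_le τ]
      _ ≤ _ := by gcongr
  rw [norm_inv, ← Real.exp_add]
  calc _ ≤ (Real.exp (R - (4 * L ^ 2 + 128)))⁻¹ := inv_anti₀ (Real.exp_pos _) hW
    _ = _ := by rw [← Real.exp_neg]; congr 1; ring

end ApproximateWeight

end

noncomputable section

/-! ### Convergence of the kernels under uniform weight bounds. -/

section KernelLimit

open Complex MeasureTheory Set Filter Topology

theorem norm_hyperbola_integrand_le {W : ℂ → ℂ} {A : ℝ}
    (hW : ∀ t, ‖(W (gammaW t))⁻¹‖ ≤ A * Real.exp (-(4 + 3 * t ^ 2))) (x : ℝ) {β : ℂ}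
    (hβ : β.re = 0) (t : ℝ) :
    ‖exp (-(x * gammaW t)) * (W (gammaW t))⁻¹ * dgammaW t * (gammaW t - β)⁻¹‖ ≤
      3 * A * Real.exp (x ^ 2 + 2 * |x|) * Real.exp (-1 * t ^ 2) := by
  have hd : 1 ≤ ‖gammaW t - β‖ := by
    refine le_trans ?_ ((le_abs_self _).trans (abs_re_le_norm _))
    rw [sub_re, hβ]
    linarith [two_le_gammaW_re t]
  have hA : 0 ≤ A := by
    have := (norm_nonneg _).trans (hW t)
    exact nonneg_of_mul_nonneg_left this (Real.exp_pos _)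
  have he : ‖exp (-(x * gammaW t))‖ ≤ Real.exp (x ^ 2 + 2 * |x| + t ^ 2) := by
    rw [norm_exp, Real.exp_le_exp, neg_re, re_ofReal_mul, gammaW_re]
    have h1 := sqrt_one_add_sq_le t
    have h0 : 0 ≤ √(1 + t ^ 2) := Real.sqrt_nonneg _
    have h2 : -x * √(1 + t ^ 2) ≤ |x| * (1 + |t|) :=
      (mul_le_mul_of_nonneg_right (neg_le_abs x) h0).trans (by gcongr)
    nlinarith [sq_nonneg (|x| - |t|), sq_abs x, sq_abs t]
  rw [norm_mul, norm_mul, norm_mul, norm_inv (gammaW t - β)]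
  calc _ ≤ Real.exp (x ^ 2 + 2 * |x| + t ^ 2) * (A * Real.exp (-(4 + 3 * t ^ 2))) * 3 * 1 := by
        gcongr
        · exact hW t
        · exact norm_dgammaW_le t
        · exact inv_le_one_of_one_le₀ hd
    _ = 3 * A * (Real.exp (x ^ 2 + 2 * |x| + t ^ 2) * Real.exp (-(4 + 3 * t ^ 2))) := by ring
    _ ≤ 3 * A * (Real.exp (x ^ 2 + 2 * |x|) * Real.exp (-1 * t ^ 2)) := by
        rw [← Real.exp_add, ← Real.exp_add]
        refine mul_le_mul_of_nonneg_left (Real.exp_le_exp.2 ?_) (by positivity)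
        nlinarith [sq_nonneg t]
    _ = _ := by ring

theorem measurable_hyperbola_integrand {W : ℂ → ℂ} (hW : Continuous W) (x : ℝ) (β : ℂ) :
    Measurable fun t =>
      exp (-(x * gammaW t)) * (W (gammaW t))⁻¹ * dgammaW t * (gammaW t - β)⁻¹ := by
  have h1 := continuous_gammaW.measurable
  have h2 := continuous_dgammaW.measurable
  have h3 := (hW.comp continuous_gammaW).measurable
  exact (((((h1.const_mul (x : ℂ)).neg).cexp).mul h3.inv).mul h2).mul (h1.sub_const β).inv

theorem norm_hyperbolaInner_le {W : ℂ → ℂ} {A : ℝ}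
    (hW : ∀ t, ‖(W (gammaW t))⁻¹‖ ≤ A * Real.exp (-(4 + 3 * t ^ 2))) (x : ℝ) {β : ℂ}
    (hβ : β.re = 0) :
    ‖hyperbolaInner W x β‖ ≤
      3 * A * Real.exp (x ^ 2 + 2 * |x|) * ∫ t : ℝ, Real.exp (-1 * t ^ 2) := by
  rw [← integral_const_mul]
  exact norm_integral_le_of_norm_le ((integrable_exp_neg_mul_sq one_pos).const_mul _)
    (ae_of_all _ fun t => norm_hyperbola_integrand_le hW x hβ t)

theorem tendsto_hyperbolaInner {W : ℕ → ℂ → ℂ} {W₀ : ℂ → ℂ} {A : ℝ} (hc : ∀ n, Continuous (W n))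
    (hW : ∀ n t, ‖(W n (gammaW t))⁻¹‖ ≤ A * Real.exp (-(4 + 3 * t ^ 2)))
    (hlim : ∀ z, Tendsto (fun n => W n z) atTop (𝓝 (W₀ z))) (h0 : ∀ z, W₀ z ≠ 0) (x : ℝ) {β : ℂ}
    (hβ : β.re = 0) :
    Tendsto (fun n => hyperbolaInner (W n) x β) atTop (𝓝 (hyperbolaInner W₀ x β)) := by
  refine tendsto_integral_of_dominated_convergence
    (fun t => 3 * A * Real.exp (x ^ 2 + 2 * |x|) * Real.exp (-1 * t ^ 2))
    (fun n => (measurable_hyperbola_integrand (hc n) x β).aestronglyMeasurable)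
    ((integrable_exp_neg_mul_sq one_pos).const_mul _)
    (fun n => ae_of_all _ fun t => norm_hyperbola_integrand_le (hW n) x hβ t)
    (ae_of_all _ fun t => ?_)
  exact ((((hlim _).inv₀ (h0 _)).const_mul _).mul_const _).mul_const _

theorem measurable_hyperbolaInner {W : ℂ → ℂ} (hW : Continuous W) (x c : ℝ) :
    Measurable fun s : ℝ => hyperbolaInner W x (c * (s * I)) := by
  refine (StronglyMeasurable.integral_prod_right (ν := volume) (f := fun s t : ℝ =>
    exp (-(x * gammaW t)) * (W (gammaW t))⁻¹ * dgammaW t * (gammaW t - c * (s * I))⁻¹)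
    (Measurable.stronglyMeasurable ?_)).measurable
  have h1 : Measurable fun p : ℝ × ℝ => gammaW p.2 := continuous_gammaW.measurable.comp measurable_snd
  have h2 : Measurable fun p : ℝ × ℝ => dgammaW p.2 :=
    continuous_dgammaW.measurable.comp measurable_snd
  have h3 : Measurable fun p : ℝ × ℝ => W (gammaW p.2) := hW.measurable.comp h1
  have h4 : Measurable fun p : ℝ × ℝ => (c * (p.1 * I) : ℂ) := by
    have : Continuous fun p : ℝ × ℝ => (c * (p.1 * I) : ℂ) := by fun_prop
    exact this.measurable
  exact (((((h1.const_mul (x : ℂ)).neg).cexp).mul h3.inv).mul h2).mul (h1.sub h4).inv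

/-- The bound for the integrand of `hyperbolaKernel`. -/
def hyperbolaBound (A x s : ℝ) : ℝ :=
  A * (2 * (3 * A * Real.exp (x ^ 2 + 2 * |x|) * ∫ t : ℝ, Real.exp (-1 * t ^ 2)))
    * Real.exp (-1 * s ^ 2)

/-- On the imaginary axis e^{yλ} has modulus one, so the bound does not involve y. -/
theorem norm_hyperbolaKernel_integrand_le {W : ℂ → ℂ} {A : ℝ}
    (hW : ∀ t, ‖(W (gammaW t))⁻¹‖ ≤ A * Real.exp (-(4 + 3 * t ^ 2)))
    (hW' : ∀ s : ℝ, ‖W (s * I)‖ ≤ A * Real.exp (-s ^ 2)) (x y s : ℝ) :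
    ‖exp (y * (s * I)) * W (s * I) *
      (hyperbolaInner W x (s * I) + hyperbolaInner W (-x) (-(s * I)))‖ ≤ hyperbolaBound A x s := by
  have h1 : ‖exp (y * (s * I))‖ = 1 := by
    rw [← mul_assoc, ← ofReal_mul, norm_exp_ofReal_mul_I]
  have h2 := norm_hyperbolaInner_le hW x (β := s * I) (by simp)
  have h3 := norm_hyperbolaInner_le hW (-x) (β := -(s * I)) (by simp)
  rw [neg_sq, abs_neg] at h3
  rw [norm_mul, norm_mul, h1, one_mul, hyperbolaBound, neg_one_mul]
  calc _ ≤ A * Real.exp (-s ^ 2) * (2 * (3 * A * Real.exp (x ^ 2 + 2 * |x|) *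
      ∫ t : ℝ, Real.exp (-1 * t ^ 2))) := by
        refine mul_le_mul (hW' s) ?_ (norm_nonneg _) ((norm_nonneg _).trans (hW' s))
        exact (norm_add_le _ _).trans (by linarith)
    _ = _ := by ring

theorem integrable_hyperbolaBound (A x : ℝ) : Integrable (hyperbolaBound A x) :=
  (integrable_exp_neg_mul_sq one_pos).const_mul _

theorem norm_hyperbolaKernel_le {W : ℂ → ℂ} {A : ℝ}
    (hW : ∀ t, ‖(W (gammaW t))⁻¹‖ ≤ A * Real.exp (-(4 + 3 * t ^ 2)))
    (hW' : ∀ s : ℝ, ‖W (s * I)‖ ≤ A * Real.exp (-s ^ 2)) (x y : ℝ) :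
    ‖hyperbolaKernel W x y‖ ≤ ‖I / (4 * (Real.pi : ℂ) ^ 2)‖ * ∫ s, hyperbolaBound A x s := by
  rw [hyperbolaKernel, norm_mul]
  gcongr
  exact norm_integral_le_of_norm_le (integrable_hyperbolaBound A x)
    (ae_of_all _ fun s => norm_hyperbolaKernel_integrand_le hW hW' x y s)

theorem integral_hyperbolaBound_mono {A x B : ℝ} (hA : 0 ≤ A) (hx : |x| ≤ B) :
    ∫ s, hyperbolaBound A x s ≤ ∫ s, hyperbolaBound A B s := by
  have hB : |x| ≤ |B| := hx.trans (le_abs_self B)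
  refine integral_mono (integrable_hyperbolaBound A x) (integrable_hyperbolaBound A B) fun s => ?_
  have h0 : 0 ≤ ∫ t : ℝ, Real.exp (-1 * t ^ 2) := integral_nonneg fun t => (Real.exp_pos _).le
  have h1 : x ^ 2 ≤ B ^ 2 := sq_le_sq.2 hB
  unfold hyperbolaBound
  gcongr

theorem tendsto_hyperbolaKernel {W : ℕ → ℂ → ℂ} {W₀ : ℂ → ℂ} {A : ℝ} (hc : ∀ n, Continuous (W n))
    (hW : ∀ n t, ‖(W n (gammaW t))⁻¹‖ ≤ A * Real.exp (-(4 + 3 * t ^ 2)))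
    (hW' : ∀ n (s : ℝ), ‖W n (s * I)‖ ≤ A * Real.exp (-s ^ 2))
    (hlim : ∀ z, Tendsto (fun n => W n z) atTop (𝓝 (W₀ z))) (h0 : ∀ z, W₀ z ≠ 0) (x y : ℝ) :
    Tendsto (fun n => hyperbolaKernel (W n) x y) atTop (𝓝 (hyperbolaKernel W₀ x y)) := by
  refine Tendsto.const_mul _ (tendsto_integral_of_dominated_convergence (hyperbolaBound A x)
    (fun n => ?_) (integrable_hyperbolaBound A x)
    (fun n => ae_of_all _ fun s => norm_hyperbolaKernel_integrand_le (hW n) (hW' n) x y s)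
    (ae_of_all _ fun s => ?_))
  · have h1 := measurable_hyperbolaInner (hc n) x 1
    have h2 := measurable_hyperbolaInner (hc n) (-x) (-1)
    simp only [ofReal_one, one_mul, ofReal_neg, neg_one_mul] at h1 h2
    have h3 : Continuous fun s : ℝ => exp (y * (s * I)) * W n (s * I) := by
      have := hc n
      fun_prop
    exact (h3.measurable.mul (h1.add h2)).aestronglyMeasurable
  · exact ((hlim _).const_mul _).mul ((tendsto_hyperbolaInner hc hW hlim h0 x (by simp)).add
      (tendsto_hyperbolaInner hc hW hlim h0 (-x) (by simp)))

end KernelLimit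

/-! ### Positivity of the Pearcey determinant. -/

section PearceyPositivity

open Complex MeasureTheory Set Filter Topology

/-- The zeros of the approximate Pearcey weight. -/
def weightZero (m : ℕ) : Fin (m + m) → ℝ :=
  Fin.append (fun j => (√(node m j))⁻¹) fun j => -(√(node m j))⁻¹

theorem weightZero_injective (m : ℕ) : Function.Injective (weightZero m) := by
  have hpos : ∀ j : Fin m, 0 < (√(node m j))⁻¹ := fun j => by
    have := node_pos j
    positivity
  have hinj : ∀ i j : Fin m, (√(node m i))⁻¹ = (√(node m j))⁻¹ → i = j := fun i j h =>
    node_injective m ((Real.sqrt_inj (node_pos i).le (node_pos j).le).1 (inv_injective h))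
  intro i j
  refine Fin.addCases (fun i => ?_) (fun i => ?_) i <;>
    refine Fin.addCases (fun j => ?_) (fun j => ?_) j <;>
    simp only [weightZero, Fin.append_left, Fin.append_right] <;> intro h
  · rw [hinj i j h]
  · linarith [hpos i, hpos j]
  · linarith [hpos i, hpos j]
  · rw [hinj i j (neg_injective h)]

/-- The vertex of γ_W is 2; real zeros beyond it are the ones that produce residues. -/
theorem two_lt_abs_weightZero {m : ℕ} (hm : 2560 * nodeScale m ^ 2 ≤ 1) (k : Fin (m + m)) :
    2 < |weightZero m k| := by
  have key : ∀ j : Fin m, 2 < (√(node m j))⁻¹ := fun j => by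
    have h0 := node_pos j
    have h1 := node_le_two_mul j
    have h2 : node m j < (1 / 2) ^ 2 := by
      have := nodeScale_pos (Fin.pos j)
      nlinarith
    rw [lt_inv_comm₀ two_pos (by positivity), Real.sqrt_lt h0.le (by norm_num), ← one_div]
    exact h2
  refine Fin.addCases (fun j => ?_) (fun j => ?_) k
  · simpa only [weightZero, Fin.append_left] using (key j).trans_le (le_abs_self _)
  · simpa only [weightZero, Fin.append_right, abs_neg] using (key j).trans_le (le_abs_self _)

theorem prod_sub_weightZero (m : ℕ) (z : ℂ) :
    ∏ k, (z - weightZero m k) = ∏ j : Fin m, (z ^ 2 - (node m j : ℂ)⁻¹) := by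
  rw [Fin.prod_univ_add, ← Finset.prod_mul_distrib]
  refine Finset.prod_congr rfl fun j _ => ?_
  have h : ((√(node m j) : ℝ) : ℂ) ^ 2 = node m j := by
    rw [← ofReal_pow, Real.sq_sqrt (node_pos j).le]
  rw [weightZero, Fin.append_left, Fin.append_right, ← h, ofReal_neg, ofReal_inv, ← inv_pow]
  ring

theorem approxWeight_eq (τ : ℝ) (m : ℕ) (z : ℂ) : approxWeight τ m z =
    (∏ j : Fin m, -(node m j : ℂ)) * (∏ k, (z - weightZero m k)) *
      exp ((τ / 2 + ∑ j, node m j : ℝ) * z ^ 2) := by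
  rw [prod_sub_weightZero, approxWeight, Finset.prod_mul_distrib, ← exp_sum,
    ← Finset.prod_mul_distrib]
  have h : ∀ j : Fin m, (1 - node m j * z ^ 2 : ℂ) = -(node m j : ℂ) * (z ^ 2 - (node m j : ℂ)⁻¹) := by
    intro j
    have : (node m j : ℂ) ≠ 0 := ofReal_ne_zero.2 (node_pos j).ne'
    field_simp
    ring
  rw [Finset.prod_congr rfl fun j _ => h j]
  push_cast
  rw [add_mul, exp_add, Finset.sum_mul]
  ring

/-- The sum of the nodes is at least mσ = √(m/2), so the Gaussian coefficient is eventually large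
for every τ. -/
theorem eventually_two_le_exponent (τ : ℝ) :
    ∀ᶠ m in atTop, 2 ≤ τ / 2 + ∑ j : Fin m, node m j := by
  have h := tendsto_nodeScale.const_mul (2 * (2 + |τ|))
  rw [mul_zero] at h
  filter_upwards [eventually_gt_atTop 0, h.eventually_le_const one_pos] with m hm hm'
  have hσ := nodeScale_pos hm
  have h1 : (m : ℝ) * nodeScale m ≤ ∑ j : Fin m, node m j := by
    calc (m : ℝ) * nodeScale m = ∑ _j : Fin m, nodeScale m := by
          rw [Finset.sum_const, Finset.card_univ, Fintype.card_fin, nsmul_eq_mul]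
      _ ≤ _ := Finset.sum_le_sum fun j _ => nodeScale_le_node j
  have h2 : 2 + |τ| ≤ (m : ℝ) * nodeScale m := by
    have := mul_nodeScale_sq hm
    have h3 : (2 + |τ|) * nodeScale m ≤ (m * nodeScale m) * nodeScale m := by nlinarith
    exact le_of_mul_le_mul_right h3 hσ
  linarith [neg_abs_le τ, abs_nonneg τ]

/-- The Pearcey determinants are limits of determinants with values that are nonnegative and
decreasing in the right end point. -/
theorem exists_tendsto_pearceyDet (a τ : ℝ) : ∃ d : ℕ → ℝ → ℝ,
    (∀ n b, 0 ≤ d n b) ∧ (∀ n, Antitone (d n)) ∧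
    ∀ b, a < b → Tendsto (fun n => (d n b : ℂ)) atTop (𝓝 (pearceyDet a b τ)) := by
  -- Beyond n₀ the weight bounds hold, the zeros lie outside [-2, 2] and the Gaussian coefficient is
  -- at least 2.
  obtain ⟨n₀, hn₀⟩ := eventually_atTop.1
    ((eventually_nodesLarge (|τ| / 2 + 1)).and (eventually_two_le_exponent τ))
  let M : ℕ → ℕ := fun n => n + n₀
  have hM : ∀ n, NodesLarge (|τ| / 2 + 1) (M n) ∧ 2 ≤ τ / 2 + ∑ j : Fin (M n), node (M n) j :=
    fun n => hn₀ _ (Nat.le_add_left _ _)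
  let c : ℕ → ℝ := fun n => τ / 2 + ∑ j : Fin (M n), node (M n) j
  let u := fun n => modelU (weightZero (M n))
  let v := fun n => modelV (c n) (weightZero (M n))
  let A : ℝ := Real.exp (4 * (|τ| / 2 + 1) ^ 2 + 128)
  have hgap := fun n => gapDet_model_nonneg_and_antitone (c := c n) (two_pos.trans_le (hM n).2)
    (weightZero_injective (M n)) a
  have hker : ∀ n x y, ((∑ k, u n k x * v n k y : ℝ) : ℂ) =
      hyperbolaKernel (approxWeight τ (M n)) x y := fun n x y =>
    sum_modelU_mul_modelV_eq (hM n).2 (by have := (hM n).1.1; omega)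
      (weightZero_injective _) (two_lt_abs_weightZero (hM n).1.2.2)
      (fun z => by rw [prod_sub_weightZero, prod_sub_weightZero, neg_sq])
      (Finset.prod_ne_zero_iff.2 fun j _ => neg_ne_zero.2 (ofReal_ne_zero.2 (node_pos j).ne'))
      (approxWeight_eq τ (M n)) x y
  have hW : ∀ n t, ‖(approxWeight τ (M n) (gammaW t))⁻¹‖ ≤ A * Real.exp (-(4 + 3 * t ^ 2)) :=
    fun n t => norm_approxWeight_gammaW_inv_le τ (hM n).1 t
  have hW' : ∀ n (s : ℝ), ‖approxWeight τ (M n) (s * I)‖ ≤ A * Real.exp (-s ^ 2) :=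
    fun n s => norm_approxWeight_imag_le τ (hM n).1 s
  refine ⟨fun n => gapDet (u n) (v n) a, fun n => (hgap n).1, fun n => (hgap n).2, fun b hab => ?_⟩
  have h1 : ∀ n, (gapDet (u n) (v n) a b : ℂ) =
      fredholmDet (fun x y => ((∑ k, u n k x * v n k y : ℝ) : ℂ)) a b := fun n =>
    (fredholmDet_sum_mul (continuous_modelU _) (continuous_modelV _ _) hab).symm
  simp only [h1]
  refine tendsto_fredholmDet (C := ‖I / (4 * (Real.pi : ℂ) ^ 2)‖ *
    ∫ s, hyperbolaBound A (max |a| |b|) s) hab.le (fun n => ?_) (fun n x hx y _ => ?_)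
    fun x _ y _ => ?_
  · refine continuous_ofReal.comp (continuous_finsetSum _ fun k _ => ?_)
    exact ((continuous_modelU _ k).comp continuous_fst).mul
      ((continuous_modelV _ _ k).comp continuous_snd)
  · rw [hker]
    refine (norm_hyperbolaKernel_le (hW n) (hW' n) x y).trans ?_
    exact mul_le_mul_of_nonneg_left (integral_hyperbolaBound_mono (Real.exp_pos _).le
      (abs_le_max_abs_abs hx.1 hx.2)) (norm_nonneg _)
  · simp only [hker]
    rw [pearceyKernel_eq_kTot, kTot_eq_hyperbolaKernel]
    refine tendsto_hyperbolaKernel (fun n => continuous_approxWeight τ (M n)) hW hW' (fun z => ?_)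
      (fun z => exp_ne_zero _) x y
    exact (tendsto_approxWeight τ z).comp (tendsto_add_atTop_nat n₀)

/-- The rescaled kernel carries the factor b - a, so only the term of order 0 survives. -/
theorem pearceyDetC_self (a τ : ℂ) : pearceyDetC (a, a, τ) = 1 := by
  rw [pearceyDetC, fredholmDet, tsum_eq_single 0]
  · have h : (univ.pi fun _ : Fin 0 => Icc (0 : ℝ) 1) = univ := eq_univ_of_forall fun x i => i.elim0
    rw [h, Measure.restrict_univ, volume_pi, Measure.pi_of_empty _]
    simp
  · intro n hn
    have : Nonempty (Fin n) := ⟨⟨0, Nat.pos_of_ne_zero hn⟩⟩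
    have h0 : ∀ x : Fin n → ℝ, (Matrix.of fun i j : Fin n =>
        (((a, a, τ) : ℂ × ℂ × ℂ).2.1 - ((a, a, τ) : ℂ × ℂ × ℂ).1)
          * kTot (gridMap (x i) (x j) (a, a, τ))).det = 0 := by
      intro x
      have : (Matrix.of fun i j : Fin n => (((a, a, τ) : ℂ × ℂ × ℂ).2.1 - ((a, a, τ) : ℂ × ℂ × ℂ).1)
          * kTot (gridMap (x i) (x j) (a, a, τ))) = 0 := by
        ext i j
        simp
      rw [this, Matrix.det_zero]
    simp only [h0, integral_zero, mul_zero]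

/-- Limits of nonnegative decreasing functions of b are nonnegative and decreasing. A zero at b
gives zeros at all larger b', so the function, entire in b, vanishes identically, against its value
1 at b = a. -/
theorem pearceyDet_pos (a b τ : ℝ) (hab : a < b) :
    (pearceyDet a b τ).im = 0 ∧ 0 < (pearceyDet a b τ).re := by
  obtain ⟨d, hd0, hd1, hlim⟩ := exists_tendsto_pearceyDet a τ
  have him : ∀ b, a < b → (pearceyDet a b τ).im = 0 := fun b hb => by
    have h := (continuous_im.tendsto _).comp (hlim b hb)
    exact tendsto_nhds_unique h (by simp [Function.comp_def])
  have hre : ∀ b, a < b → Tendsto (fun n => d n b) atTop (𝓝 (pearceyDet a b τ).re) := fun b hb => by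
    simpa [Function.comp_def] using (continuous_re.tendsto _).comp (hlim b hb)
  have hnonneg : ∀ b, a < b → 0 ≤ (pearceyDet a b τ).re := fun b hb =>
    ge_of_tendsto' (hre b hb) fun n => hd0 n b
  refine ⟨him b hab, lt_of_le_of_ne (hnonneg b hab) fun h0 => ?_⟩
  have hzero : ∀ b' : ℝ, b < b' → pearceyDetC (a, b', τ) = 0 := fun b' hb' => by
    rw [← pearceyDet_eq a b' τ (hab.trans hb')]
    refine Complex.ext ?_ (him b' (hab.trans hb'))
    refine le_antisymm ?_ (hnonneg b' (hab.trans hb'))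
    rw [zero_re, h0]
    exact le_of_tendsto_of_tendsto' (hre b' (hab.trans hb')) (hre b hab) fun n => hd1 n hb'.le
  have hdiff : Differentiable ℂ fun z : ℂ => pearceyDetC (a, z, τ) :=
    (contDiff_pearceyDetC.differentiable (by simp)).comp
      ((differentiable_const _).prodMk (differentiable_id.prodMk (differentiable_const _)))
  have hana : AnalyticOnNhd ℂ (fun z : ℂ => pearceyDetC (a, z, τ)) univ :=
    hdiff.differentiableOn.analyticOnNhd isOpen_univ
  have hfreq : ∃ᶠ z in 𝓝[≠] ((b + 1 : ℝ) : ℂ), pearceyDetC (a, z, τ) = 0 := by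
    have ht : Tendsto (fun n : ℕ => ((b + 1 + 1 / ((n : ℝ) + 1) : ℝ) : ℂ)) atTop
        (𝓝[≠] ((b + 1 : ℝ) : ℂ)) := by
      refine tendsto_nhdsWithin_iff.2 ⟨(continuous_ofReal.tendsto _).comp ?_, ?_⟩
      · simpa using (tendsto_one_div_add_atTop_nhds_zero_nat (𝕜 := ℝ)).const_add (b + 1)
      · refine Eventually.of_forall fun n h => ?_
        have h1 : b + 1 + 1 / ((n : ℝ) + 1) = b + 1 := ofReal_injective h
        have h2 : 0 < 1 / ((n : ℝ) + 1) := by positivity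
        linarith
    refine ht.frequently (Frequently.of_forall fun n => hzero _ ?_)
    have h2 : 0 < 1 / ((n : ℝ) + 1) := by positivity
    linarith
  have := hana.eqOn_zero_of_preconnected_of_frequently_eq_zero isPreconnected_univ (mem_univ _)
    hfreq (mem_univ (a : ℂ))
  exact one_ne_zero ((pearceyDetC_self a τ).symm.trans this)

end PearceyPositivity

end

theorem mainTheorem3 :
    (∀ a b τ : ℝ, a < b → (pearceyDet a b τ).im = 0 ∧ 0 < (pearceyDet a b τ).re) ∧
    SmoothOnIntervals pearceyLogDet ∧
    (∀ a b τ : ℝ, a < b →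
      PearceyPDE1 pearceyLogDet a b τ ∧
      PearceyPDE2 pearceyLogDet a b τ ∧
      PearceyPDE3 pearceyLogDet a b τ) ∧
    (∃ u : ℝ → ℝ → ℝ → ℝ, SmoothOnIntervals u ∧
      (∀ a b τ : ℝ, a < b → PearceyPDE1 u a b τ ∧ PearceyPDE2 u a b τ) ∧
      ∃ a b τ : ℝ, a < b ∧ ¬ PearceyPDE3 u a b τ) :=
  ⟨pearceyDet_pos, smoothOnIntervals_pearceyLogDet pearceyDet_pos,
    fun _ _ _ hab => pearceyLogDet_pdes pearceyDet_pos hab,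
    exists_pearceyPDE1_pearceyPDE2_not_pearceyPDE3⟩
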